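/- **Definitions.** Let $G$ be a connected Lie group with a left-invariant Riemannian metric and the corresponding left-invariant volume, and let $1\le p<\infty$. All functions and forms are real-valued, and $d$ is taken in the sense of distributions. Let $Z^{p}(G)$ be the space of closed $1$-forms in $L^p$, and $B^{p}(G)=\{du : u\in L^p(G),\ du\in L^p\}\subset Z^p(G)$. The $L^p$-cohomology of $G$ in degree $1$ is $H^{1,p}(G)=Z^p(G)/B^p(G)$. Its torsion $T^{1,p}(G)\subset H^{1,p}(G)$ is the subspace of classes of forms in $Z^p(G)$ that are $L^p$-limits of elements of $B^p(G)$. The reduced $L^p$-cohomology is $R^{1,p}(G)=H^{1,p}(G)/T^{1,p}(G)$. **Proposition.** Let $N$ be a simply connected nilpotent Lie group of dimension $n-1\ge 1$ with Lie algebra $\mathfrak n$. Let $\alpha$ be a derivation of $\mathfrak n$ such that the real parts of its complex eigenvalues, counted with algebraic multiplicity, are $$0<\lambda_1\le\lambda_2\le\dots\le\lambda_{n-1}.$$ Let $(\varphi_t)_{t\in\mathbb R}$ be the smooth one-parameter group of automorphisms of $N$ whose differential at the identity is $e^{t\alpha}$, and let $G=N\rtimes_\alpha\mathbb R$ be the manifold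 $N\times\mathbb R$ with the group law $(x,t)(y,s)=(x\,\varphi_t(y),\,t+s)$. Equip $G$ with any left-invariant Riemannian metric and set $$p(G)=\frac{\lambda_1+\dots+\lambda_{n-1}}{\lambda_1}.$$ Then, for real $p$: 1. $T^{1,p}(G)=0$ for every $p\ge 1$; 2. $R^{1,p}(G)=0$ for every $p$ with $1\le p\le p(G)$; 3. $R^{1,p}(G)\neq 0$ for every $p>p(G)$. -/

import Mathlib

open scoped Manifold ContDiff ENNReal Nat
open MeasureTheory Filter Topology

noncomputable section

instance instLEInftyMinSmoothnessReal : ENat.LEInfty (minSmoothness ℝ 3) :=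
  ⟨by
    rw [minSmoothness_of_isRCLikeNormedField]
    exact ENat.LEInfty.out⟩

instance instFiniteDimensionalTangentSpace {E H M : Type*} [NormedAddCommGroup E]
    [NormedSpace ℝ E] [FiniteDimensional ℝ E] [TopologicalSpace H] (I : ModelWithCorners ℝ E H)
    [TopologicalSpace M] [ChartedSpace H M] (x : M) : FiniteDimensional ℝ (TangentSpace I x) :=
  inferInstanceAs (FiniteDimensional ℝ E)

/-! ## First `L^p`-cohomology of a Lie group with a left-invariant Riemannian metric -/

namespace LpCohomology

lemma integrable_mul_test {X : Type*} [TopologicalSpace X] [T2Space X] [MeasurableSpace X]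
    [BorelSpace X] {ν : Measure X} {f ψ : X → ℝ} (hf : LocallyIntegrable f ν)
    (hc : Continuous ψ) (hs : HasCompactSupport ψ) : Integrable (fun g => f g * ψ g) ν :=
  hf.integrable_smul_right_of_hasCompactSupport hc hs

section General

variable {E H : Type*} [NormedAddCommGroup E] [NormedSpace ℝ E] [TopologicalSpace H]
  {I : ModelWithCorners ℝ E H} {G : Type*} [TopologicalSpace G] [ChartedSpace H G]

variable (I G) in
/-- (Not necessarily continuous) differential `1`-forms on `G`. -/
def OneForm : Type _ := (g : G) → TangentSpace I g →L[ℝ] ℝ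

instance : AddCommGroup (OneForm I G) :=
  inferInstanceAs (AddCommGroup ((g : G) → TangentSpace I g →L[ℝ] ℝ))

instance : Module ℝ (OneForm I G) :=
  inferInstanceAs (Module ℝ ((g : G) → TangentSpace I g →L[ℝ] ℝ))

/-- Real-valued test functions: smooth and compactly supported. -/
def IsTestFunction (I : ModelWithCorners ℝ E H) (ψ : G → ℝ) : Prop :=
  ContMDiff I 𝓘(ℝ, ℝ) ∞ ψ ∧ HasCompactSupport ψ

variable [Group G]

/-- The function `θ(X)`, where `X` is seen as a left-invariant vector field. -/
def OneForm.apply (θ : OneForm I G) (X : GroupLieAlgebra I G) (g : G) : ℝ :=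
  θ g (mulInvariantVectorField X g)

/-- The derivative `X ψ` of the function `ψ` along the left-invariant vector field `X`. -/
def invDeriv (X : GroupLieAlgebra I G) (ψ : G → ℝ) (g : G) : ℝ :=
  mfderiv I 𝓘(ℝ, ℝ) ψ g (mulInvariantVectorField X g)

/-- The components of a `1`-form in the frame of left-invariant vector fields given by the
basis `b` of the Lie algebra. For the left-invariant Riemannian metric in which this frame is
orthonormal, the Euclidean norm of `θ.coeff b g` is the Riemannian norm of the covector `θ g`.
All left-invariant Riemannian metrics are obtained in this way. -/
def OneForm.coeff {ι : Type*} (b : Module.Basis ι ℝ (GroupLieAlgebra I G)) (θ : OneForm I G)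
    (g : G) : EuclideanSpace ℝ ι :=
  WithLp.toLp 2 fun i => θ.apply (b i) g

section Lemmas

@[simp] lemma OneForm.zero_apply' (X : GroupLieAlgebra I G) :
    (0 : OneForm I G).apply X = 0 := rfl

@[simp] lemma OneForm.add_apply' (θ η : OneForm I G) (X : GroupLieAlgebra I G) :
    (θ + η).apply X = θ.apply X + η.apply X := rfl

@[simp] lemma OneForm.smul_apply' (c : ℝ) (θ : OneForm I G) (X : GroupLieAlgebra I G) :
    (c • θ).apply X = c • θ.apply X := rfl

variable {ι : Type*} (b : Module.Basis ι ℝ (GroupLieAlgebra I G))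

@[simp] lemma OneForm.coeff_zero : (0 : OneForm I G).coeff b = 0 := rfl

@[simp] lemma OneForm.coeff_add (θ η : OneForm I G) :
    (θ + η).coeff b = θ.coeff b + η.coeff b := rfl

@[simp] lemma OneForm.coeff_smul (c : ℝ) (θ : OneForm I G) :
    (c • θ).coeff b = c • θ.coeff b := rfl

lemma hasCompactSupport_invDeriv (X : GroupLieAlgebra I G) {ψ : G → ℝ}
    (hψ : IsTestFunction I ψ) : HasCompactSupport (invDeriv X ψ) := by
  refine hψ.2.mono' fun g hg => ?_
  by_contra h
  apply hg
  have h0 : ψ =ᶠ[𝓝 g] fun _ => 0 := notMem_tsupport_iff_eventuallyEq.mp h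
  simp only [invDeriv]
  rw [h0.mfderiv_eq, mfderiv_const]
  rfl

lemma continuous_invDeriv [LieGroup I ∞ G] (X : GroupLieAlgebra I G) {ψ : G → ℝ}
    (hψ : IsTestFunction I ψ) : Continuous (invDeriv X ψ) := by
  have h1 : Continuous (fun g : G => (mulInvariantVectorField X g : TangentBundle I G)) :=
    (contMDiff_mulInvariantVectorField X).continuous
  have : IsManifold I 1 G := by
    have := (inferInstance : LieGroup I ∞ G).toIsManifold
    infer_instance
  have h2 : Continuous (tangentMap I 𝓘(ℝ, ℝ) ψ) := hψ.1.continuous_tangentMap (by simp)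
  have h3 := (tangentBundleModelSpaceHomeomorph 𝓘(ℝ, ℝ)).continuous.comp (h2.comp h1)
  exact (continuous_snd.comp h3 : _)

end Lemmas

variable [MeasurableSpace G]

/-- `θ = du` in the sense of distributions. Here `μ` is a left Haar measure, so `μ.inv` is a right
Haar measure, i.e. a smooth positive density for which all left-invariant vector fields are
divergence free: integration by parts against it has no zeroth order term. -/
def IsWeakDifferential (μ : Measure G) (u : G → ℝ) (θ : OneForm I G) : Prop :=
  LocallyIntegrable u μ.inv ∧ (∀ X : GroupLieAlgebra I G, LocallyIntegrable (θ.apply X) μ.inv) ∧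
  ∀ (X : GroupLieAlgebra I G) (ψ : G → ℝ), IsTestFunction I ψ →
    ∫ g, u g * invDeriv X ψ g ∂μ.inv = - ∫ g, θ.apply X g * ψ g ∂μ.inv

/-- `dθ = 0` in the sense of distributions, where
`dθ(X, Y) = X θ(Y) - Y θ(X) - θ([X, Y])` for left-invariant vector fields `X` and `Y`. -/
def IsWeaklyClosed (μ : Measure G) (θ : OneForm I G) : Prop :=
  (∀ X : GroupLieAlgebra I G, LocallyIntegrable (θ.apply X) μ.inv) ∧
  ∀ (X Y : GroupLieAlgebra I G) (ψ : G → ℝ), IsTestFunction I ψ →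
    - (∫ g, θ.apply Y g * invDeriv X ψ g ∂μ.inv) + (∫ g, θ.apply X g * invDeriv Y ψ g ∂μ.inv)
      - (∫ g, θ.apply ⁅X, Y⁆ g * ψ g ∂μ.inv) = 0

section Integrability

variable [BorelSpace G] [T2Space G] [LieGroup I ∞ G]

lemma IsWeakDifferential.add {μ : Measure G} {u v : G → ℝ} {θ η : OneForm I G}
    (h : IsWeakDifferential μ u θ) (h' : IsWeakDifferential μ v η) :
    IsWeakDifferential μ (u + v) (θ + η) := by
  refine ⟨h.1.add h'.1, fun X => (h.2.1 X).add (h'.2.1 X), fun X ψ hψ => ?_⟩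
  have e := h.2.2 X ψ hψ
  have e' := h'.2.2 X ψ hψ
  have c := continuous_invDeriv X hψ
  have s := hasCompactSupport_invDeriv X hψ
  simp only [OneForm.add_apply', Pi.add_apply, add_mul]
  rw [integral_add (integrable_mul_test h.1 c s) (integrable_mul_test h'.1 c s),
    integral_add (integrable_mul_test (h.2.1 X) hψ.1.continuous hψ.2)
      (integrable_mul_test (h'.2.1 X) hψ.1.continuous hψ.2), e, e']
  ring

lemma IsWeaklyClosed.add {μ : Measure G} {θ η : OneForm I G}
    (h : IsWeaklyClosed μ θ) (h' : IsWeaklyClosed μ η) : IsWeaklyClosed μ (θ + η) := by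
  refine ⟨fun X => (h.1 X).add (h'.1 X), fun X Y ψ hψ => ?_⟩
  have e := h.2 X Y ψ hψ
  have e' := h'.2 X Y ψ hψ
  have cX := continuous_invDeriv X hψ
  have sX := hasCompactSupport_invDeriv X hψ
  have cY := continuous_invDeriv Y hψ
  have sY := hasCompactSupport_invDeriv Y hψ
  simp only [OneForm.add_apply', Pi.add_apply, add_mul]
  rw [integral_add (integrable_mul_test (h.1 Y) cX sX) (integrable_mul_test (h'.1 Y) cX sX),
    integral_add (integrable_mul_test (h.1 X) cY sY) (integrable_mul_test (h'.1 X) cY sY),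
    integral_add (integrable_mul_test (h.1 _) hψ.1.continuous hψ.2)
      (integrable_mul_test (h'.1 _) hψ.1.continuous hψ.2)]
  linarith

end Integrability

lemma IsWeakDifferential.smul {μ : Measure G} {u : G → ℝ} {θ : OneForm I G} (c : ℝ)
    (h : IsWeakDifferential μ u θ) : IsWeakDifferential μ (c • u) (c • θ) := by
  refine ⟨h.1.smul c, fun X => (h.2.1 X).smul c, fun X ψ hψ => ?_⟩
  simp only [OneForm.smul_apply', Pi.smul_apply, smul_eq_mul, mul_assoc, integral_const_mul,
    h.2.2 X ψ hψ, mul_neg]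

lemma IsWeaklyClosed.smul {μ : Measure G} {θ : OneForm I G} (c : ℝ)
    (h : IsWeaklyClosed μ θ) : IsWeaklyClosed μ (c • θ) := by
  refine ⟨fun X => (h.1 X).smul c, fun X Y ψ hψ => ?_⟩
  have e := h.2 X Y ψ hψ
  simp only [OneForm.smul_apply', Pi.smul_apply, smul_eq_mul, mul_assoc, integral_const_mul]
  linear_combination c * e

lemma IsWeakDifferential.zero (μ : Measure G) :
    IsWeakDifferential μ (0 : G → ℝ) (0 : OneForm I G) :=
  ⟨locallyIntegrable_zero, fun _ => locallyIntegrable_zero, fun X ψ _ => by simp⟩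

lemma IsWeaklyClosed.zero (μ : Measure G) : IsWeaklyClosed μ (0 : OneForm I G) :=
  ⟨fun _ => locallyIntegrable_zero, fun X Y ψ _ => by simp⟩

variable [BorelSpace G] [T2Space G] [LieGroup I ∞ G] {ι : Type*} [Fintype ι]
  (b : Module.Basis ι ℝ (GroupLieAlgebra I G)) (μ : Measure G) (p : ℝ≥0∞)

/-- The closed `L^p` `1`-forms on `G`, where `G` carries the left Haar measure `μ` and the
left-invariant Riemannian metric in which the frame `b` is orthonormal. -/
def closedForms : Submodule ℝ (OneForm I G) where
  carrier := {θ | MemLp (θ.coeff b) p μ ∧ IsWeaklyClosed μ θ}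
  zero_mem' := ⟨MemLp.zero, IsWeaklyClosed.zero μ⟩
  add_mem' h h' := ⟨h.1.add h'.1, h.2.add h'.2⟩
  smul_mem' c _ h := ⟨h.1.const_smul c, h.2.smul c⟩

/-- The differentials of `L^p` functions with `L^p` gradient. As weak differentials are only
determined almost everywhere, this contains all measurable forms that vanish almost everywhere. -/
def exactForms : Submodule ℝ (OneForm I G) where
  carrier := {θ | MemLp (θ.coeff b) p μ ∧ ∃ u : G → ℝ, MemLp u p μ ∧ IsWeakDifferential μ u θ}
  zero_mem' := ⟨MemLp.zero, 0, MemLp.zero, IsWeakDifferential.zero μ⟩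
  add_mem' := by
    rintro θ η ⟨h, u, hu, hd⟩ ⟨h', v, hv, hd'⟩
    exact ⟨h.add h', u + v, hu.add hv, hd.add hd'⟩
  smul_mem' := by
    rintro c θ ⟨h, u, hu, hd⟩
    exact ⟨h.const_smul c, c • u, hu.const_smul c, hd.smul c⟩

/-- The closed `L^p` forms that are limits in `L^p` of differentials of `L^p` functions. -/
def limitForms : Submodule ℝ (OneForm I G) where
  carrier := {θ | θ ∈ closedForms b μ p ∧ ∃ η : ℕ → OneForm I G, (∀ k, η k ∈ exactForms b μ p) ∧
    Tendsto (fun k => eLpNorm ((θ - η k).coeff b) p μ) atTop (𝓝 0)}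
  zero_mem' := ⟨zero_mem _, fun _ => 0, fun _ => zero_mem _, by simp⟩
  add_mem' := by
    rintro θ θ' ⟨h, η, hη, ht⟩ ⟨h', η', hη', ht'⟩
    refine ⟨add_mem h h', fun k => η k + η' k, fun k => add_mem (hη k) (hη' k), ?_⟩
    have hlim : Tendsto (fun k => ENNReal.LpAddConst p * (eLpNorm ((θ - η k).coeff b) p μ +
        eLpNorm ((θ' - η' k).coeff b) p μ)) atTop (𝓝 0) := by
      have := ENNReal.Tendsto.const_mul (a := ENNReal.LpAddConst p) (ht.add ht')
        (Or.inr (ENNReal.LpAddConst_lt_top p).ne)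
      simpa using this
    refine tendsto_of_tendsto_of_tendsto_of_le_of_le tendsto_const_nhds hlim
      (fun _ => zero_le) fun k => ?_
    have e : (θ + θ' - (η k + η' k)).coeff b = (θ - η k).coeff b + (θ' - η' k).coeff b := by
      rw [add_sub_add_comm]; rfl
    simp only [e]
    exact eLpNorm_add_le' (h.1.sub (hη k).1).aestronglyMeasurable
      (h'.1.sub (hη' k).1).aestronglyMeasurable p
  smul_mem' := by
    rintro c θ ⟨h, η, hη, ht⟩
    refine ⟨Submodule.smul_mem _ c h, fun k => c • η k,
      fun k => Submodule.smul_mem _ c (hη k), ?_⟩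
    have e : ∀ k, eLpNorm ((c • θ - c • η k).coeff b) p μ =
        ‖c‖ₑ * eLpNorm ((θ - η k).coeff b) p μ := fun k => by
      rw [← smul_sub, OneForm.coeff_smul, eLpNorm_const_smul]
    simp only [e]
    simpa using ENNReal.Tendsto.const_mul (a := ‖c‖ₑ) ht (Or.inr enorm_ne_top)

/-- The first `L^p`-cohomology `H^{1,p}(G)`. -/
abbrev H1 : Type _ := closedForms b μ p ⧸ (exactForms b μ p).submoduleOf (closedForms b μ p)

/-- The torsion `T^{1,p}(G)`, a subspace of `H^{1,p}(G)`. -/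
def torsion : Submodule ℝ (H1 b μ p) :=
  ((limitForms b μ p).submoduleOf (closedForms b μ p)).map (Submodule.mkQ _)

/-- The reduced `L^p`-cohomology `R^{1,p}(G) = H^{1,p}(G) / T^{1,p}(G)`. -/
abbrev R1 : Type _ := H1 b μ p ⧸ torsion b μ p

end General

end LpCohomology

/-! ## Semidirect products `N ⋊_α ℝ` -/

section Semidirect

variable {E H : Type*} [NormedAddCommGroup E] [NormedSpace ℝ E] [TopologicalSpace H]
  {I : ModelWithCorners ℝ E H} {N : Type*} [TopologicalSpace N] [ChartedSpace H N] [Group N]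

/-- The smooth action of `ℝ` by automorphisms on the Lie group `N` that integrates `α`: the
differential at the identity of the automorphism attached to `t` is `exp (t α)`. -/
structure IntegratedAction (α : GroupLieAlgebra I N →ₗ[ℝ] GroupLieAlgebra I N) where
  /-- The action by automorphisms. -/
  hom : Multiplicative ℝ →* MulAut N
  /-- The action is smooth. -/
  smooth : ContMDiff (𝓘(ℝ, ℝ).prod I) I ∞ fun q : ℝ × N => hom (Multiplicative.ofAdd q.1) q.2
  /-- The action integrates `α`. -/
  hasSum_exp : ∀ (t : ℝ) (X : GroupLieAlgebra I N),
    HasSum (fun k : ℕ => (t ^ k / k !) • (α ^ k) X)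
      (mfderiv I I (fun x => hom (Multiplicative.ofAdd t) x) 1 X : GroupLieAlgebra I N)

variable {α : GroupLieAlgebra I N →ₗ[ℝ] GroupLieAlgebra I N}

/-- The semidirect product `N ⋊_α ℝ`: the manifold `N × ℝ` with the product
`(x, t) (y, s) = (x φ_t(y), t + s)`, where `φ` is the action of `ℝ` on `N` integrating `α`. -/
def SemidirectLine (_A : IntegratedAction α) : Type _ := N × ℝ

namespace SemidirectLine

variable (A : IntegratedAction α)

instance : TopologicalSpace (SemidirectLine A) := inferInstanceAs (TopologicalSpace (N × ℝ))

instance [T2Space N] : T2Space (SemidirectLine A) := inferInstanceAs (T2Space (N × ℝ))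

instance : ChartedSpace (ModelProd H ℝ) (SemidirectLine A) :=
  inferInstanceAs (ChartedSpace (ModelProd H ℝ) (N × ℝ))

instance : MeasurableSpace (SemidirectLine A) := borel _

instance : BorelSpace (SemidirectLine A) := ⟨rfl⟩

/-- The identification with Mathlib's semidirect product of groups. -/
def equivSemidirectProduct : SemidirectLine A ≃ N ⋊[A.hom] Multiplicative ℝ where
  toFun g := ⟨g.1, Multiplicative.ofAdd g.2⟩
  invFun g := (g.left, g.right.toAdd)
  left_inv _ := rfl
  right_inv _ := rfl

instance : Group (SemidirectLine A) := (equivSemidirectProduct A).group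

lemma mul_def (g h : SemidirectLine A) :
    g * h = (g.1 * A.hom (Multiplicative.ofAdd g.2) h.1, g.2 + h.2) := rfl

lemma inv_def (g : SemidirectLine A) :
    g⁻¹ = (A.hom (Multiplicative.ofAdd (-g.2)) g.1⁻¹, -g.2) := rfl

lemma one_def : (1 : SemidirectLine A) = ((1 : N), (0 : ℝ)) := rfl

instance [LieGroup I ∞ N] : LieGroup (I.prod 𝓘(ℝ, ℝ)) ∞ (SemidirectLine A) := by
  have hN : IsManifold I ∞ N := (inferInstance : LieGroup I ∞ N).toIsManifold
  have : IsManifold (I.prod 𝓘(ℝ, ℝ)) ∞ (SemidirectLine A) :=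
    inferInstanceAs (IsManifold (I.prod 𝓘(ℝ, ℝ)) ∞ (N × ℝ))
  have hmul : ContMDiff ((I.prod 𝓘(ℝ, ℝ)).prod (I.prod 𝓘(ℝ, ℝ))) (I.prod 𝓘(ℝ, ℝ)) ∞
      (fun q : (N × ℝ) × (N × ℝ) =>
        (q.1.1 * A.hom (Multiplicative.ofAdd q.1.2) q.2.1, q.1.2 + q.2.2)) := by
    have h11 : ContMDiff ((I.prod 𝓘(ℝ, ℝ)).prod (I.prod 𝓘(ℝ, ℝ))) I ∞
        (fun q : (N × ℝ) × (N × ℝ) => q.1.1) := contMDiff_fst.comp contMDiff_fst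
    have h12 : ContMDiff ((I.prod 𝓘(ℝ, ℝ)).prod (I.prod 𝓘(ℝ, ℝ))) 𝓘(ℝ, ℝ) ∞
        (fun q : (N × ℝ) × (N × ℝ) => q.1.2) := contMDiff_snd.comp contMDiff_fst
    have h21 : ContMDiff ((I.prod 𝓘(ℝ, ℝ)).prod (I.prod 𝓘(ℝ, ℝ))) I ∞
        (fun q : (N × ℝ) × (N × ℝ) => q.2.1) := contMDiff_fst.comp contMDiff_snd
    have h22 : ContMDiff ((I.prod 𝓘(ℝ, ℝ)).prod (I.prod 𝓘(ℝ, ℝ))) 𝓘(ℝ, ℝ) ∞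
        (fun q : (N × ℝ) × (N × ℝ) => q.2.2) := contMDiff_snd.comp contMDiff_snd
    exact (h11.mul (A.smooth.comp (h12.prodMk h21))).prodMk (h12.add h22)
  have hinv : ContMDiff (I.prod 𝓘(ℝ, ℝ)) (I.prod 𝓘(ℝ, ℝ)) ∞
      (fun q : N × ℝ => (A.hom (Multiplicative.ofAdd (-q.2)) q.1⁻¹, -q.2)) :=
    (A.smooth.comp ((contMDiff_snd.neg).prodMk (contMDiff_fst.inv))).prodMk contMDiff_snd.neg
  exact { contMDiff_mul := hmul, contMDiff_inv := hinv }

end SemidirectLine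

end Semidirect

end

/-! Let `μ` be left Haar measure, `ν = μ.inv` the right Haar measure, `ξ = lineVec A` the direction
of the second factor, `a s = line A s` its one-parameter subgroup, and `h = ∑ i, lam i`.
Left-invariant fields generate right translations and are divergence free for `ν`, so weak
identities are integrations by parts against `ν`, while norms are taken for `μ`. The two measures
are comparable on compact sets. Everything rests on `Δ(a s) = exp (h s)`, the modular function being
governed by the trace of `ad ξ`, which is the trace of `α`.

Torsion. In `L^p(μ)`, right translation by `a (-s)` multiplies norms by `exp (-h s / p)`. Hence, for
`F` in `L^p`, the integral of `F(g a(-s))` over `s > 0` converges in `L^p` and solves `ξ u = F`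
(`exists_flowPrimitive`); tested against `η` it is `flowPairing`. An `L^p` solution is unique
(`integral_eq_flowPairing`). So `θ = du` with `u` in `L^p` is an equation in `θ` alone, expressed by
functionals continuous in `L^p`; it passes to limits, and the exact forms are closed
(`limitForms_le_exactForms`).

Small exponents. For a closed `θ` let `u` be the primitive of `θ(ξ)` along the flow. The form `du -
θ`, tested through `defect`, is closed and vanishes on `ξ`, hence is invariant under the flow
(`defect_eq_flow`). Transport it along the flow by time `s`. A direction `Y` of `𝔫` becomes
`exp(sα)Y`, and pairings with the translated test functions carry the factor `exp (-h s / p)` times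
an `L^p` norm over a set escaping to infinity. Take for `Y` the real or imaginary part of an
eigenvector whose eigenvalue has real part `lam 0`: the growth is then at most `exp (lam 0 * s)`
with no polynomial factor, and `p * lam 0 ≤ h` makes the product bounded. Escape to infinity
supplies the convergence to zero, which is why the critical exponent is included. The defect thus
vanishes along the `α`-orbit of `Y`.

The other directions follow by commutation (`defect_inclVec_eq_zero_of_commute`). If the defect
vanishes along the orbit of `Y`, and `X` is fixed by the adjoint action of the corresponding
subgroups, one transports along those subgroups instead. The points `φ_{kT}(y)` with `y ≠ 1` escape
to infinity, because the action in negative time contracts `N`, yet they are conjugate in `G` to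
`y`, so the modular function is constant on them. This passes from `Y` to a nonzero central
direction, which exists by nilpotency, and from there to all of `𝔫`.

Large exponents. Let `v = χ(t) w(x)`, with `w` a test function on `N` and `χ` a cutoff equal to 1
for very negative `t`. Down the second factor `dv` decays like `exp (-r k)` for any `r < lam 0`,
while volumes grow like `exp (h k)`, so `dv` lies in `L^p` as soon as `h < p * lam 0`. The only
candidate for an `L^p` primitive is `v - w`, the flow primitive of `ξ v`, and its differential
misses `dv` by `dw ≠ 0`. -/

set_option linter.unusedSectionVars false

noncomputable section

/-! ### Smooth dependence of a partial derivative on the other variable. -/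

section Partial

variable {E H : Type*} [NormedAddCommGroup E] [NormedSpace ℝ E] [TopologicalSpace H]
  {I : ModelWithCorners ℝ E H} {M : Type*} [TopologicalSpace M] [ChartedSpace H M]
  [IsManifold I ∞ M]
  {E' H' : Type*} [NormedAddCommGroup E'] [NormedSpace ℝ E'] [TopologicalSpace H']
  {I' : ModelWithCorners ℝ E' H'} {M' : Type*} [TopologicalSpace M'] [ChartedSpace H' M']
  [IsManifold I' ∞ M']

/-- The partial derivative at a fixed point of a smooth function of two variables is smooth in
the other variable. -/
lemma contMDiff_mfderiv_partial {F : M × M' → ℝ} (hF : ContMDiff (I.prod I') 𝓘(ℝ, ℝ) ∞ F)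
    (y : M') (v : TangentSpace I' y) :
    ContMDiff I 𝓘(ℝ, ℝ) ∞
      (fun x => (mfderiv I' 𝓘(ℝ, ℝ) (fun z => F (x, z)) y v : ℝ)) := by
  let f1 : M → TangentBundle I M := fun x => Bundle.TotalSpace.mk' E x 0
  have s1 : ContMDiff I I.tangent ∞ f1 := Bundle.contMDiff_zeroSection ℝ (TangentSpace I)
  let f2 : M → TangentBundle I' M' := fun _ => Bundle.TotalSpace.mk' E' y v
  have s2 : ContMDiff I I'.tangent ∞ f2 := contMDiff_const
  have S : ContMDiff I 𝓘(ℝ, ℝ).tangent ∞ (tangentMap (I.prod I') 𝓘(ℝ, ℝ) F ∘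
      (equivTangentBundleProd I M I' M').symm ∘ fun x => (f1 x, f2 x)) :=
    (hF.contMDiff_tangentMap (m := ∞) (by simp)).comp
      (contMDiff_equivTangentBundleProd_symm.comp (s1.prodMk s2))
  have T := (contMDiff_snd_tangentBundle_modelSpace ℝ 𝓘(ℝ, ℝ) (n := ∞)).comp S
  refine T.congr fun x => ?_
  have hd : MDifferentiableAt (I.prod I') 𝓘(ℝ, ℝ) F (x, y) := hF.mdifferentiableAt (by simp)
  have := mfderiv_prod_eq_add_apply (I := I) (I' := I') (v := ((0, v) : E × E')) hd
  refine Eq.trans ?_ this.symm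
  refine Eq.trans (zero_add _).symm ?_
  exact congrArg₂ (fun a b : ℝ => a + b)
    (map_zero (mfderiv I 𝓘(ℝ, ℝ) (fun z => F (z, y)) x)).symm rfl

end Partial

/-! ### Calculus with left-invariant vector fields. -/

namespace LpCohomology

section Calculus

variable {E H : Type*} [NormedAddCommGroup E] [NormedSpace ℝ E] [TopologicalSpace H]
  {I : ModelWithCorners ℝ E H} {G : Type*} [TopologicalSpace G] [ChartedSpace H G] [Group G]

section Linear
variable (X Y : GroupLieAlgebra I G) (c : ℝ) (ψ : G → ℝ) (θ : OneForm I G)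

lemma invDeriv_add : invDeriv (X + Y) ψ = invDeriv X ψ + invDeriv Y ψ := by
  funext g
  exact (congrArg (mfderiv I 𝓘(ℝ, ℝ) ψ g)
    (congrFun (mulInvariantVectorField_add X Y) g)).trans (map_add _ _ _)

lemma invDeriv_smul : invDeriv (c • X) ψ = c • invDeriv X ψ := by
  funext g
  exact (congrArg (mfderiv I 𝓘(ℝ, ℝ) ψ g)
    (congrFun (mulInvariantVectorField_smul c X) g)).trans (map_smul _ _ _)

lemma OneForm.apply_add : θ.apply (X + Y) = θ.apply X + θ.apply Y := by
  funext g
  exact (congrArg (θ g) (congrFun (mulInvariantVectorField_add X Y) g)).trans (map_add _ _ _)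

lemma OneForm.apply_smul : θ.apply (c • X) = c • θ.apply X := by
  funext g
  exact (congrArg (θ g) (congrFun (mulInvariantVectorField_smul c X) g)).trans (map_smul _ _ _)

/-- `X ↦ X ψ` as a linear map. -/
def invDerivLinear : GroupLieAlgebra I G →ₗ[ℝ] (G → ℝ) where
  toFun X := invDeriv X ψ
  map_add' X Y := invDeriv_add X Y ψ
  map_smul' c X := invDeriv_smul X c ψ

/-- `X ↦ θ(X)` as a linear map. -/
def OneForm.applyLinear : GroupLieAlgebra I G →ₗ[ℝ] (G → ℝ) where
  toFun X := θ.apply X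
  map_add' X Y := θ.apply_add X Y
  map_smul' c X := θ.apply_smul X c

end Linear

variable [LieGroup I ∞ G]

/-- Moving the derivative to the identity makes the tangent space independent of `g`. Smoothness in
`g` then follows from the two-variable function `ψ (g * h)`. -/
lemma invDeriv_eq_mfderiv_one {ψ : G → ℝ} (hψ : ContMDiff I 𝓘(ℝ, ℝ) ∞ ψ)
    (X : GroupLieAlgebra I G) (g : G) :
    invDeriv X ψ g = (mfderiv I 𝓘(ℝ, ℝ) (fun h => ψ (g * h)) 1 X : ℝ) := by
  have h1 : MDifferentiableAt I I (fun h : G => g * h) 1 :=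
    (contMDiff_mul_left (I := I) (n := ∞) (a := g)).mdifferentiableAt (by simp)
  have h2 : MDifferentiableAt I 𝓘(ℝ, ℝ) ψ ((fun h : G => g * h) 1) :=
    hψ.mdifferentiableAt (by simp)
  have := mfderiv_comp (I := I) (I' := I) (I'' := 𝓘(ℝ, ℝ)) (1 : G) h2 h1
  have h3 := congrArg (fun L => L X) this
  refine Eq.trans ?_ h3.symm
  simp only [invDeriv, mulInvariantVectorField]
  rw [mul_one]
  rfl

lemma contMDiff_invDeriv {ψ : G → ℝ} (hψ : ContMDiff I 𝓘(ℝ, ℝ) ∞ ψ)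
    (X : GroupLieAlgebra I G) : ContMDiff I 𝓘(ℝ, ℝ) ∞ (invDeriv X ψ) := by
  have h : ContMDiff (I.prod I) 𝓘(ℝ, ℝ) ∞ (fun q : G × G => ψ (q.1 * q.2)) :=
    hψ.comp (contMDiff_fst.mul contMDiff_snd)
  exact (contMDiff_mfderiv_partial h 1 X).congr fun g => invDeriv_eq_mfderiv_one hψ X g

lemma IsTestFunction.invDeriv {ψ : G → ℝ} (hψ : IsTestFunction I ψ) (X : GroupLieAlgebra I G) :
    IsTestFunction I (invDeriv X ψ) :=
  ⟨contMDiff_invDeriv hψ.1 X, hasCompactSupport_invDeriv X hψ⟩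

variable (I) in
/-- The adjoint action of `g⁻¹` on the Lie algebra. -/
def adInv (g : G) (X : GroupLieAlgebra I G) : GroupLieAlgebra I G :=
  (mfderiv I I (fun x => g⁻¹ * x * g) 1 X : E)

lemma contMDiff_conjInv (g : G) : ContMDiff I I ∞ (fun x : G => g⁻¹ * x * g) :=
  (contMDiff_const.mul contMDiff_id).mul contMDiff_const

/-- The derivative of a right translate. -/
lemma invDeriv_comp_mul_right {ψ : G → ℝ} (hψ : ContMDiff I 𝓘(ℝ, ℝ) ∞ ψ)
    (X : GroupLieAlgebra I G) (a g : G) :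
    LpCohomology.invDeriv X (fun x => ψ (x * a)) g =
      LpCohomology.invDeriv (adInv I a X) ψ (g * a) := by
  have hψa : ContMDiff I 𝓘(ℝ, ℝ) ∞ (fun x => ψ (x * a)) :=
    hψ.comp (contMDiff_mul_right (I := I) (n := ∞) (a := a))
  rw [invDeriv_eq_mfderiv_one hψa, invDeriv_eq_mfderiv_one hψ]
  -- A right translate is a left translate precomposed with conjugation, since `h a = a (a⁻¹ h a)`;
  -- the conjugation produces `adInv`.
  have e : (fun h => ψ (g * h * a)) = (fun h => ψ (g * a * h)) ∘ (fun x => a⁻¹ * x * a) := by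
    funext h
    simp only [Function.comp_apply]
    congr 1
    group
  have h1 : MDifferentiableAt I I (fun x : G => a⁻¹ * x * a) 1 :=
    (contMDiff_conjInv a).mdifferentiableAt (by simp)
  have h2 : MDifferentiableAt I 𝓘(ℝ, ℝ) (fun h => ψ (g * a * h))
      ((fun x : G => a⁻¹ * x * a) 1) :=
    (hψ.comp (contMDiff_mul_left (I := I) (n := ∞) (a := g * a))).mdifferentiableAt (by simp)
  have := mfderiv_comp (I := I) (I' := I) (I'' := 𝓘(ℝ, ℝ)) (1 : G) h2 h1
  rw [e, this]
  have e1 : a⁻¹ * 1 * a = 1 := by group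
  change (mfderiv I 𝓘(ℝ, ℝ) (fun h => ψ (g * a * h)) (a⁻¹ * 1 * a)
    (mfderiv I I (fun x => a⁻¹ * x * a) 1 X) : ℝ) = _
  rw [e1]
  rfl

lemma IsTestFunction.comp_mul_right {ψ : G → ℝ} (hψ : IsTestFunction I ψ) (a : G) :
    IsTestFunction I (fun x => ψ (x * a)) := by
  have : IsTopologicalGroup G := topologicalGroup_of_lieGroup I ∞
  exact ⟨hψ.1.comp (contMDiff_mul_right (I := I) (n := ∞) (a := a)),
    hψ.2.comp_homeomorph (Homeomorph.mulRight a)⟩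

lemma IsTestFunction.mul_left {F ψ : G → ℝ} (hF : ContMDiff I 𝓘(ℝ, ℝ) ∞ F)
    (hψ : IsTestFunction I ψ) : IsTestFunction I (fun x => F x * ψ x) :=
  ⟨hF.mul hψ.1, hψ.2.mul_left⟩

lemma invDeriv_mul {F ψ : G → ℝ} (hF : ContMDiff I 𝓘(ℝ, ℝ) ∞ F)
    (hψ : ContMDiff I 𝓘(ℝ, ℝ) ∞ ψ) (X : GroupLieAlgebra I G) (g : G) :
    LpCohomology.invDeriv X (fun x => F x * ψ x) g =
      F g * LpCohomology.invDeriv X ψ g + LpCohomology.invDeriv X F g * ψ g := by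
  have h1 : HasMFDerivAt I 𝓘(ℝ, ℝ) F g (mfderiv I 𝓘(ℝ, ℝ) F g) :=
    (hF.mdifferentiableAt (by simp)).hasMFDerivAt
  have h2 : HasMFDerivAt I 𝓘(ℝ, ℝ) ψ g (mfderiv I 𝓘(ℝ, ℝ) ψ g) :=
    (hψ.mdifferentiableAt (by simp)).hasMFDerivAt
  have := (h1.mul h2).mfderiv
  have h3 := congrArg (fun L => L (mulInvariantVectorField X g)) this
  refine h3.trans ?_
  have : ∀ a b c : ℝ, a + b * c = a + c * b := fun a b c => by ring
  exact this _ _ _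

/-- `c` has at time `t` the velocity given by the left-invariant vector field `Z`. -/
def HasVelocityAt (c : ℝ → G) (Z : GroupLieAlgebra I G) (t : ℝ) : Prop :=
  HasMFDerivAt 𝓘(ℝ, ℝ) I c t
    ((1 : ℝ →L[ℝ] ℝ).smulRight (mulInvariantVectorField Z (c t)))

lemma HasVelocityAt.hasDerivAt {c : ℝ → G} {Z : GroupLieAlgebra I G} {t : ℝ}
    (hc : HasVelocityAt c Z t) {ψ : G → ℝ} (hψ : ContMDiff I 𝓘(ℝ, ℝ) ∞ ψ) :
    HasDerivAt (fun s => ψ (c s)) (LpCohomology.invDeriv Z ψ (c t)) t := by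
  have h2 : HasMFDerivAt I 𝓘(ℝ, ℝ) ψ (c t) (mfderiv I 𝓘(ℝ, ℝ) ψ (c t)) :=
    (hψ.mdifferentiableAt (by simp)).hasMFDerivAt
  have h3 := HasMFDerivAt.comp (I' := I) t h2 hc
  let L : ℝ →L[ℝ] ℝ := (mfderiv I 𝓘(ℝ, ℝ) ψ (c t)).comp
    ((1 : ℝ →L[ℝ] ℝ).smulRight (mulInvariantVectorField Z (c t)))
  have h3' : HasFDerivAt (fun s => ψ (c s)) L t := hasMFDerivAt_iff_hasFDerivAt.1 h3
  have h5 : HasDerivAt (fun s => ψ (c s)) (L 1) t := h3'.hasDerivAt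
  have h4 : ((1 : ℝ →L[ℝ] ℝ).smulRight (mulInvariantVectorField Z (c t))) 1 =
    mulInvariantVectorField Z (c t) := one_smul ℝ _
  have h6 : L 1 = LpCohomology.invDeriv Z ψ (c t) := congrArg (mfderiv I 𝓘(ℝ, ℝ) ψ (c t)) h4
  rwa [h6] at h5

lemma mfderiv_mul_left_mulInvariantVectorField (a g : G) (Z : GroupLieAlgebra I G) :
    mfderiv I I (fun x => a * x) g (mulInvariantVectorField Z g) =
      mulInvariantVectorField Z (a * g) := by
  have h1 : MDifferentiableAt I I (fun h : G => g * h) 1 :=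
    (contMDiff_mul_left (I := I) (n := ∞) (a := g)).mdifferentiableAt (by simp)
  have h2 : MDifferentiableAt I I (fun x : G => a * x) ((fun h : G => g * h) 1) :=
    (contMDiff_mul_left (I := I) (n := ∞) (a := a)).mdifferentiableAt (by simp)
  have := mfderiv_comp (I := I) (I' := I) (I'' := I) (1 : G) h2 h1
  have e : (fun x : G => a * g * x) = (fun x : G => a * x) ∘ (fun h : G => g * h) := by
    funext x; simp [mul_assoc]
  have h3 := congrArg (fun L => L Z) this
  simp only [mulInvariantVectorField]
  rw [e]
  refine Eq.trans ?_ h3.symm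
  change (mfderiv I I (fun x => a * x) g (mfderiv I I (fun h : G => g * h) 1 Z) : E) =
   (mfderiv I I (fun x => a * x) (g * 1) (mfderiv I I (fun h : G => g * h) 1 Z) : E)
  rw [mul_one]

lemma HasVelocityAt.mul_left {c : ℝ → G} {Z : GroupLieAlgebra I G} {t : ℝ}
    (hc : HasVelocityAt c Z t) (a : G) : HasVelocityAt (fun s => a * c s) Z t := by
  have h2 : HasMFDerivAt I I (fun x : G => a * x) (c t) (mfderiv I I (fun x : G => a * x) (c t)) :=
    ((contMDiff_mul_left (I := I) (n := ∞) (a := a)).mdifferentiableAt (by simp)).hasMFDerivAt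
  have h3 := HasMFDerivAt.comp (I' := I) t h2 hc
  refine h3.congr_mfderiv ?_
  ext
  have h4 := mfderiv_mul_left_mulInvariantVectorField a (c t) Z
  have h5 : ((1 : ℝ →L[ℝ] ℝ).smulRight (mulInvariantVectorField Z (c t))) 1 =
    mulInvariantVectorField Z (c t) := one_smul ℝ _
  have h6 : ((1 : ℝ →L[ℝ] ℝ).smulRight (mulInvariantVectorField Z (a * c t))) 1 =
    mulInvariantVectorField Z (a * c t) := one_smul ℝ _
  exact (congrArg (mfderiv I I (fun x : G => a * x) (c t)) h5).trans (h4.trans h6.symm)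

end Calculus

end LpCohomology

/-! ### One-parameter subgroups, homomorphisms and the adjoint action. -/

namespace LpCohomology

section OneParameter

variable {E H : Type*} [NormedAddCommGroup E] [NormedSpace ℝ E] [FiniteDimensional ℝ E]
  [TopologicalSpace H] {I : ModelWithCorners ℝ E H} [I.Boundaryless]
  {G : Type*} [TopologicalSpace G] [ChartedSpace H G] [Group G] [LieGroup I ∞ G] [T2Space G]

/-- There is a test function with prescribed differential at the identity. -/
lemma exists_testFunction_invDeriv_one (l : E →L[ℝ] ℝ) :
    ∃ ψ : G → ℝ, IsTestFunction I ψ ∧ ∀ Z : GroupLieAlgebra I G, invDeriv Z ψ 1 = l Z := by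
  obtain ⟨f⟩ : Nonempty (SmoothBumpFunction I (1 : G)) := inferInstance
  let F : G → ℝ := fun x => l (extChartAt I (1 : G) x)
  have hF : ContMDiffOn I 𝓘(ℝ, ℝ) ∞ F (chartAt H (1 : G)).source := by
    have h1 : ContMDiffOn I 𝓘(ℝ, E) ∞ (extChartAt I (1 : G)) (chartAt H (1 : G)).source :=
      contMDiffOn_extChartAt
    exact l.contDiff.contMDiff.comp_contMDiffOn h1
  have hs : ContMDiff I 𝓘(ℝ, ℝ) ∞ (fun x => f x • F x) := f.contMDiff_smul hF
  refine ⟨fun x => f x • F x, ⟨hs, f.hasCompactSupport.smul_right⟩, fun Z => ?_⟩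
  rw [invDeriv_eq_mfderiv_one hs]
  have e : (fun h => f (1 * h) • F (1 * h)) =ᶠ[𝓝 1] F := by
    filter_upwards [f.eventuallyEq_one] with x hx
    simp [hx]
  have h2 : HasMFDerivAt I 𝓘(ℝ, ℝ) F 1 (l : TangentSpace I (1 : G) →L[ℝ] ℝ) := by
    refine ⟨((hF.contMDiffAt ((chartAt H (1 : G)).open_source.mem_nhds
      (mem_chart_source H 1))).continuousAt), ?_⟩
    have h3 : HasFDerivWithinAt l l (Set.range I) (extChartAt I (1 : G) 1) :=
      l.hasFDerivAt.hasFDerivWithinAt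
    refine h3.congr_of_eventuallyEq ?_ ?_
    · filter_upwards [extChartAt_target_mem_nhdsWithin (I := I) (1 : G)] with y hy
      simp only [writtenInExtChartAt, F, extChartAt_model_space_eq_id, PartialEquiv.refl_coe,
        Function.comp_apply, id]
      rw [(extChartAt I (1 : G)).right_inv hy]
    · simp only [writtenInExtChartAt, F, extChartAt_model_space_eq_id, PartialEquiv.refl_coe,
        Function.comp_apply, id, extChartAt_to_inv]
  have h4 := (h2.congr_of_eventuallyEq e).mfderiv
  exact congrArg (fun L => L Z) h4

/-- Test functions realise every linear functional on the tangent space at the identity. Identities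
in the Lie algebra can therefore be checked weakly. -/
lemma eq_of_invDeriv_one_eq {X Y : GroupLieAlgebra I G}
    (h : ∀ ψ : G → ℝ, IsTestFunction I ψ → invDeriv X ψ 1 = invDeriv Y ψ 1) : X = Y := by
  refine (SeparatingDual.eq_iff_forall_dual_eq (R := ℝ) (V := E)).2 fun l => ?_
  obtain ⟨ψ, h1, h2⟩ := exists_testFunction_invDeriv_one (I := I) (G := G) l
  have := h ψ h1
  rwa [h2, h2] at this

variable {E' H' : Type*} [NormedAddCommGroup E'] [NormedSpace ℝ E'] [FiniteDimensional ℝ E']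
  [TopologicalSpace H'] {I' : ModelWithCorners ℝ E' H'} [I'.Boundaryless]
  {G' : Type*} [TopologicalSpace G'] [ChartedSpace H' G'] [Group G'] [LieGroup I' ∞ G']
  [T2Space G']

variable (I I') in
/-- The differential at the identity, as a map between Lie algebras. -/
def homDeriv (f : G → G') : GroupLieAlgebra I G →ₗ[ℝ] GroupLieAlgebra I' G' :=
  ContinuousLinearMap.toLinearMap (M := E) (M₂ := E') (mfderiv I I' f 1)

variable {f : G → G'} (hs : ContMDiff I I' ∞ f) (hm : ∀ x y, f (x * y) = f x * f y)
include hs hm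

lemma mfderiv_mulInvariantVectorField (g : G) (X : GroupLieAlgebra I G) :
    (mfderiv I I' f g (mulInvariantVectorField X g) : E') =
      mulInvariantVectorField (homDeriv I I' f X) (f g) := by
  have f1 : f 1 = 1 := by simpa using hm 1 1
  have h1 : MDifferentiableAt I I (fun h : G => g * h) 1 :=
    (contMDiff_mul_left (I := I) (n := ∞) (a := g)).mdifferentiableAt (by simp)
  have h2 : MDifferentiableAt I I' f ((fun h : G => g * h) 1) := hs.mdifferentiableAt (by simp)
  have h3 : MDifferentiableAt I' I' (fun x : G' => f g * x) (f 1) :=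
    (contMDiff_mul_left (I := I') (n := ∞) (a := f g)).mdifferentiableAt (by simp)
  have h4 : MDifferentiableAt I I' f 1 := hs.mdifferentiableAt (by simp)
  have e : f ∘ (fun h : G => g * h) = (fun x : G' => f g * x) ∘ f := by
    funext x; simp [hm]
  have h5 := mfderiv_comp (I := I) (I' := I) (I'' := I') (1 : G) h2 h1
  have h6 := mfderiv_comp (I := I) (I' := I') (I'' := I') (1 : G) h3 h4
  rw [e] at h5
  have h7 := congrArg (fun L => (L X : E')) (h5.symm.trans h6)
  change (mfderiv I I' f (g * 1) (mulInvariantVectorField X g) : E') =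
    mfderiv I' I' (fun x : G' => f g * x) (f 1) (homDeriv I I' f X) at h7
  rw [f1, mul_one] at h7
  exact h7

lemma invDeriv_comp_hom {ψ : G' → ℝ} (hψ : ContMDiff I' 𝓘(ℝ, ℝ) ∞ ψ)
    (X : GroupLieAlgebra I G) (g : G) :
    invDeriv X (fun x => ψ (f x)) g = invDeriv (homDeriv I I' f X) ψ (f g) := by
  have h1 : MDifferentiableAt I I' f g := hs.mdifferentiableAt (by simp)
  have h2 : MDifferentiableAt I' 𝓘(ℝ, ℝ) ψ (f g) := hψ.mdifferentiableAt (by simp)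
  have h3 := mfderiv_comp (I := I) (I' := I') (I'' := 𝓘(ℝ, ℝ)) g h2 h1
  have h4 := congrArg (fun L => (L (mulInvariantVectorField X g) : ℝ)) h3
  refine h4.trans ?_
  exact congrArg (mfderiv I' 𝓘(ℝ, ℝ) ψ (f g)) (mfderiv_mulInvariantVectorField hs hm g X)

lemma HasVelocityAt.map {c : ℝ → G} {Z : GroupLieAlgebra I G} {t : ℝ}
    (hc : HasVelocityAt c Z t) : HasVelocityAt (fun s => f (c s)) (homDeriv I I' f Z) t := by
  have h2 : HasMFDerivAt I I' f (c t) (mfderiv I I' f (c t)) :=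
    (hs.mdifferentiableAt (by simp)).hasMFDerivAt
  have h3 := HasMFDerivAt.comp (I' := I) t h2 hc
  refine h3.congr_mfderiv ?_
  ext
  have h4 := mfderiv_mulInvariantVectorField hs hm (c t) Z
  have h5 : ((1 : ℝ →L[ℝ] ℝ).smulRight (mulInvariantVectorField Z (c t))) 1 =
    mulInvariantVectorField Z (c t) := one_smul ℝ _
  have h6 : ((1 : ℝ →L[ℝ] ℝ).smulRight (mulInvariantVectorField (homDeriv I I' f Z) (f (c t)))) 1 =
    mulInvariantVectorField (homDeriv I I' f Z) (f (c t)) := one_smul ℝ _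
  exact (congrArg (mfderiv I I' f (c t)) h5).trans (h4.trans h6.symm)

omit hs hm

/-- `γ` is the one-parameter subgroup generated by `X`. -/
structure IsOneParameter (γ : ℝ → G) (X : GroupLieAlgebra I G) : Prop where
  zero : γ 0 = 1
  add : ∀ s t, γ (s + t) = γ s * γ t
  velocity : ∀ t, HasVelocityAt γ X t

lemma IsOneParameter.map (hs : ContMDiff I I' ∞ f) (hm : ∀ x y, f (x * y) = f x * f y)
    {γ : ℝ → G} {X : GroupLieAlgebra I G} (h : IsOneParameter γ X) :
    IsOneParameter (fun t => f (γ t)) (homDeriv I I' f X) where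
  zero := by rw [h.zero]; simpa using hm 1 1
  add s t := by rw [h.add, hm]
  velocity t := (h.velocity t).map hs hm

lemma IsOneParameter.neg {γ : ℝ → G} {X : GroupLieAlgebra I G} (h : IsOneParameter γ X) (t : ℝ) :
    γ (-t) = (γ t)⁻¹ := by
  rw [eq_inv_iff_mul_eq_one, ← h.add, neg_add_cancel, h.zero]

lemma IsOneParameter.continuous {γ : ℝ → G} {X : GroupLieAlgebra I G} (h : IsOneParameter γ X) :
    Continuous γ :=
  continuous_iff_continuousAt.2 fun t => (h.velocity t).continuousAt

lemma contMDiff_one_mulInvariantVectorField (X : GroupLieAlgebra I G) :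
    ContMDiff I I.tangent 1
      (fun g : G => (⟨g, mulInvariantVectorField X g⟩ : TangentBundle I G)) :=
  (contMDiff_mulInvariantVectorField X).of_le (by
    refine le_trans ?_ le_minSmoothness
    norm_num)

lemma eq_of_hasVelocityAt {γ γ' : ℝ → G} {X : GroupLieAlgebra I G}
    (h : ∀ t, HasVelocityAt γ X t) (h' : ∀ t, HasVelocityAt γ' X t) (h0 : γ 0 = γ' 0) : γ = γ' := by
  have : CompleteSpace E := FiniteDimensional.complete ℝ E
  have : IsManifold I 1 G := IsManifold.of_le (n := ∞) (by simp)
  exact isMIntegralCurve_Ioo_eq_of_contMDiff_boundaryless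
    (contMDiff_one_mulInvariantVectorField X) h h' h0

/-- Left translates of one local integral curve through the identity are integral curves through
every other point, all with the same existence time, so the curve extends to the whole line.
Additivity is uniqueness of integral curves. -/
lemma exists_isOneParameter (X : GroupLieAlgebra I G) : ∃ γ : ℝ → G, IsOneParameter γ X := by
  have : CompleteSpace E := FiniteDimensional.complete ℝ E
  have : IsManifold I 1 G := IsManifold.of_le (n := ∞) (by simp)
  obtain ⟨γ₀, h0, h1⟩ := exists_isMIntegralCurveAt_of_contMDiffAt_boundaryless (t₀ := 0)
    (contMDiff_one_mulInvariantVectorField (I := I) X).contMDiffAt (x₀ := (1 : G))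
  obtain ⟨ε, hε, h2⟩ := isMIntegralCurveAt_iff'.1 h1
  obtain ⟨γ, h3, h4⟩ := exists_isMIntegralCurve_of_isMIntegralCurveOn
    (contMDiff_one_mulInvariantVectorField (I := I) X) hε (x := (1 : G)) fun x =>
      ⟨fun s => x * γ₀ s, by simp [h0], fun t ht => by
        have h5 : HasVelocityAt γ₀ X t := by
          have hb : Set.Ioo (-ε) ε = Metric.ball (0 : ℝ) ε := by
            rw [Real.ball_eq_Ioo]; simp
          exact (h2 t (hb ▸ ht)).hasMFDerivAt (Metric.isOpen_ball.mem_nhds (hb ▸ ht))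
        exact (h5.mul_left x).hasMFDerivWithinAt⟩
  refine ⟨γ, h3, fun s t => ?_, h4⟩
  have h5 : (fun t => γ (t + s)) = fun t => γ s * γ t := by
    refine eq_of_hasVelocityAt (X := X) (IsMIntegralCurve.comp_add (I := I) h4 s) (fun t => ?_) ?_
    · exact HasVelocityAt.mul_left (h4 t) (γ s)
    · simp [h3]
  rw [add_comm]
  exact congrFun h5 t

lemma adInv_eq_homDeriv (g : G) (X : GroupLieAlgebra I G) :
    adInv I g X = homDeriv I I (fun x => g⁻¹ * x * g) X := rfl

lemma HasVelocityAt.unique {c : ℝ → G} {X Y : GroupLieAlgebra I G} {t : ℝ} (ht : c t = 1)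
    (hX : HasVelocityAt c X t) (hY : HasVelocityAt c Y t) : X = Y := by
  refine eq_of_invDeriv_one_eq fun ψ hψ => ?_
  have := (hX.hasDerivAt hψ.1).unique (hY.hasDerivAt hψ.1)
  rwa [ht] at this

lemma conj_mul (g x y : G) : g⁻¹ * (x * y) * g = (g⁻¹ * x * g) * (g⁻¹ * y * g) := by group

lemma adInv_eq_self {γ : ℝ → G} {X : GroupLieAlgebra I G} (h : IsOneParameter γ X) {g : G}
    (hg : ∀ t, g⁻¹ * γ t * g = γ t) : adInv I g X = X := by
  have h1 := (h.velocity 0).map (contMDiff_conjInv (I := I) g) (conj_mul g)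
  simp only [hg] at h1
  exact h1.unique h.zero (h.velocity 0)

lemma IsOneParameter.adInv_self {γ : ℝ → G} {X : GroupLieAlgebra I G} (h : IsOneParameter γ X)
    (t : ℝ) : adInv I (γ t) X = X :=
  adInv_eq_self h fun s => by rw [← h.neg, ← h.add, ← h.add]; congr 1; ring

/-- Conjugation maps the subgroup to the one generated by `adInv I g X`. If this is again `X`,
uniqueness of integral curves identifies the two; together with `adInv_eq_self` this replaces any
use of an exponential map. -/
lemma IsOneParameter.conj_eq {γ : ℝ → G} {X : GroupLieAlgebra I G} (h : IsOneParameter γ X) {g : G}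
    (hg : adInv I g X = X) (t : ℝ) : g⁻¹ * γ t * g = γ t := by
  have h1 := h.map (contMDiff_conjInv (I := I) g) (conj_mul g)
  have h2 := h1.velocity
  rw [← adInv_eq_homDeriv, hg] at h2
  exact congrFun (eq_of_hasVelocityAt h2 h.velocity (by rw [h1.zero, h.zero])) t

variable (I) in
lemma adInv_mul (a b : G) (X : GroupLieAlgebra I G) :
    adInv I (a * b) X = adInv I b (adInv I a X) := by
  refine eq_of_invDeriv_one_eq fun ψ hψ => ?_
  obtain ⟨h1, -⟩ := hψ.comp_mul_right b
  have e := invDeriv_comp_mul_right hψ.1 X (a * b) (b⁻¹ * a⁻¹)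
  have e1 := invDeriv_comp_mul_right h1 X a (b⁻¹ * a⁻¹)
  have e2 := invDeriv_comp_mul_right hψ.1 (adInv I a X) b b⁻¹
  simp only [mul_assoc, inv_mul_cancel, mul_one, inv_mul_cancel_left] at e e1 e2
  rw [← e, ← e2, ← e1]

end OneParameter

end LpCohomology

/-! ### The Lie bracket as a commutator of derivations. -/

namespace LpCohomology

section Bracket

variable {E H : Type*} [NormedAddCommGroup E] [NormedSpace ℝ E] [FiniteDimensional ℝ E]
  [TopologicalSpace H] {I : ModelWithCorners ℝ E H} [I.Boundaryless]

section Chart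

variable {M : Type*} [TopologicalSpace M] [ChartedSpace H M] [IsManifold I ∞ M]

lemma mfderiv_comp_extChartAt_inverse {x g : M} (hg : g ∈ (extChartAt I x).source) {q : E → ℝ}
    (hq : DifferentiableAt ℝ q (extChartAt I x g)) (v : E) :
    (mfderiv I 𝓘(ℝ, ℝ) (fun z => q (extChartAt I x z)) g
      ((mfderiv I 𝓘(ℝ, E) (extChartAt I x) g).inverse v) : ℝ) =
      fderiv ℝ q (extChartAt I x g) v := by
  have : IsManifold I 1 M := IsManifold.of_le (n := ∞) (by simp)
  have h1 : MDifferentiableAt I 𝓘(ℝ, E) (extChartAt I x) g :=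
    mdifferentiableAt_extChartAt (extChartAt_source I x ▸ hg)
  have h2 := mfderiv_comp (I := I) (I' := 𝓘(ℝ, E)) (I'' := 𝓘(ℝ, ℝ)) g hq.mdifferentiableAt h1
  have h3 := congrArg
    (fun L => (L ((mfderiv I 𝓘(ℝ, E) (extChartAt I x) g).inverse v) : ℝ)) h2
  refine h3.trans ?_
  have h4 : mfderiv I 𝓘(ℝ, E) (extChartAt I x) g
      ((mfderiv I 𝓘(ℝ, E) (extChartAt I x) g).inverse v) = v :=
    (isInvertible_mfderiv_extChartAt hg).self_apply_inverse v
  refine (congrArg (mfderiv 𝓘(ℝ, E) 𝓘(ℝ, ℝ) q (extChartAt I x g)) h4).trans ?_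
  rw [mfderiv_eq_fderiv]
  rfl

end Chart

variable {G : Type*} [TopologicalSpace G] [ChartedSpace H G] [Group G] [LieGroup I ∞ G]

/-- In a chart, `X (Y ψ)` is the Hessian of `ψ` on `(X, Y)` plus the differential of `ψ` on the
derivative of `Y` along `X`. Antisymmetrising removes the Hessian and leaves the coordinate formula
for the bracket. -/
lemma invDeriv_bracket_one {ψ : G → ℝ} (hψ : ContMDiff I 𝓘(ℝ, ℝ) ∞ ψ)
    (X Y : GroupLieAlgebra I G) :
    invDeriv ⁅X, Y⁆ ψ 1 = invDeriv X (invDeriv Y ψ) 1 - invDeriv Y (invDeriv X ψ) 1 := by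
  have : CompleteSpace E := FiniteDimensional.complete ℝ E
  have : IsManifold I 2 G := IsManifold.of_le (n := ∞) ENat.LEInfty.out
  set κ := extChartAt I (1 : G) with hκ
  set ψ' : E → ℝ := fun y => ψ (κ.symm y) with hψ'
  let V : GroupLieAlgebra I G → E → E := fun Z =>
    VectorField.mpullbackWithin 𝓘(ℝ, E) I κ.symm (mulInvariantVectorField Z) (Set.range I)
  have hsmooth : ∀ y ∈ κ.target, ContDiffAt ℝ ∞ ψ' y := fun y hy => by
    have h1 : ContMDiffOn 𝓘(ℝ, E) I ∞ κ.symm κ.target := contMDiffOn_extChartAt_symm 1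
    have h2 : ContMDiffAt 𝓘(ℝ, E) I ∞ κ.symm y :=
      h1.contMDiffAt ((isOpen_extChartAt_target (1 : G)).mem_nhds hy)
    exact (hψ.contMDiffAt.comp y h2).contDiffAt
  have h1 : (1 : G) ∈ κ.source := mem_extChartAt_source 1
  have hnear : ∀ g ∈ κ.source, ψ =ᶠ[𝓝 g] fun z => ψ' (κ z) := fun g hg => by
    filter_upwards [(isOpen_extChartAt_source (1 : G)).mem_nhds hg] with z hz
    simp only [hψ']
    rw [κ.left_inv hz]
  have hV : ∀ Z : GroupLieAlgebra I G, ∀ᶠ g in 𝓝 (1 : G), (mulInvariantVectorField Z g : E) =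
      (mfderiv I 𝓘(ℝ, E) κ g).inverse (V Z (κ g)) := fun Z => by
    have := VectorField.eventuallyEq_mpullback_mpullbackWithin_extChartAt (I := I) (x := (1 : G))
      (s := Set.univ) (mulInvariantVectorField Z)
    rw [nhdsWithin_univ] at this
    exact this
  have hform : ∀ Z : GroupLieAlgebra I G, ∀ᶠ g in 𝓝 (1 : G),
      invDeriv Z ψ g = fderiv ℝ ψ' (κ g) (V Z (κ g)) := fun Z => by
    filter_upwards [hV Z, (isOpen_extChartAt_source (1 : G)).mem_nhds h1] with g hg hgs
    rw [← mfderiv_comp_extChartAt_inverse hgs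
      ((hsmooth _ (κ.map_source hgs)).differentiableAt (by simp))]
    rw [← (hnear g hgs).mfderiv_eq]
    exact congrArg (mfderiv I 𝓘(ℝ, ℝ) ψ g) hg
  have hdV : ∀ Z : GroupLieAlgebra I G, DifferentiableAt ℝ (V Z) (κ 1) := fun Z => by
    have h := (mdifferentiableAt_mulInvariantVectorField (I := I) Z (g := 1)).mdifferentiableWithinAt
      (s := Set.univ)
    have h2 := h.differentiableWithinAt_mpullbackWithin_vectorField
    simp only [Set.preimage_univ, I.range_eq_univ, Set.inter_univ] at h2
    have h3 := differentiableWithinAt_univ.1 h2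
    simp only [V, I.range_eq_univ]
    exact h3
  have hψ2 : ContDiffAt ℝ ∞ ψ' (κ 1) := hsmooth _ (κ.map_source h1)
  have hdψ : DifferentiableAt ℝ (fderiv ℝ ψ') (κ 1) :=
    (hψ2.fderiv_right (m := 1) (by rw [one_add_one_eq_two]; exact ENat.LEInfty.out)).differentiableAt (by simp)
  have key : ∀ X Y : GroupLieAlgebra I G, invDeriv X (invDeriv Y ψ) 1 =
      fderiv ℝ (fderiv ℝ ψ') (κ 1) (V X (κ 1)) (V Y (κ 1)) +
        fderiv ℝ ψ' (κ 1) (fderiv ℝ (V Y) (κ 1) (V X (κ 1))) := fun X Y => by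
    let q : E → ℝ := fun y => fderiv ℝ ψ' y (V Y y)
    have hq : HasFDerivAt q _ (κ 1) := hdψ.hasFDerivAt.clm_apply (hdV Y).hasFDerivAt
    have e1 : invDeriv Y ψ =ᶠ[𝓝 1] fun z => q (κ z) := hform Y
    have e2 : invDeriv X (invDeriv Y ψ) 1 = fderiv ℝ q (κ 1) (V X (κ 1)) := by
      rw [← mfderiv_comp_extChartAt_inverse h1 hq.differentiableAt, ← e1.mfderiv_eq]
      exact congrArg (mfderiv I 𝓘(ℝ, ℝ) (invDeriv Y ψ) 1) (hV X).self_of_nhds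
    rw [e2, hq.fderiv]
    simp [add_comm]
  have hbr : invDeriv ⁅X, Y⁆ ψ 1 = fderiv ℝ ψ' (κ 1)
      (fderiv ℝ (V Y) (κ 1) (V X (κ 1)) - fderiv ℝ (V X) (κ 1) (V Y (κ 1))) := by
    rw [← mfderiv_comp_extChartAt_inverse h1 (hψ2.differentiableAt (by simp)),
      ← (hnear 1 h1).mfderiv_eq]
    have e : (mulInvariantVectorField ⁅X, Y⁆ (1 : G) : E) = (mfderiv I 𝓘(ℝ, E) κ 1).inverse
        (fderiv ℝ (V Y) (κ 1) (V X (κ 1)) - fderiv ℝ (V X) (κ 1) (V Y (κ 1))) := by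
      have e3 : VectorField.lieBracketWithin ℝ (V X) (V Y) (Set.univ ∩ Set.range I) (κ 1) =
        fderiv ℝ (V Y) (κ 1) (V X (κ 1)) - fderiv ℝ (V X) (κ 1) (V Y (κ 1)) := by
        rw [I.range_eq_univ, Set.univ_inter, VectorField.lieBracketWithin_univ]
        rfl
      rw [← e3]
      have e4 : mulInvariantVectorField (I := I) ⁅X, Y⁆ (1 : G) = ⁅X, Y⁆ := by
        have e5 : (fun x : G => 1 * x) = id := by funext x; simp
        simp only [mulInvariantVectorField]
        rw [e5, mfderiv_id]
        rfl
      exact e4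
    exact congrArg (mfderiv I 𝓘(ℝ, ℝ) ψ 1) e
  have hsymm := (hψ2.isSymmSndFDerivAt (n := ∞)
    (by rw [minSmoothness_of_isRCLikeNormedField]; exact ENat.LEInfty.out)).eq (V X (κ 1)) (V Y (κ 1))
  rw [hbr, key X Y, key Y X, hsymm, map_sub]
  ring

lemma invDeriv_comp_mul_left {ψ : G → ℝ} (hψ : ContMDiff I 𝓘(ℝ, ℝ) ∞ ψ)
    (X : GroupLieAlgebra I G) (a : G) :
    invDeriv X (fun x => ψ (a * x)) = fun g => invDeriv X ψ (a * g) := by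
  funext g
  have hc : ContMDiff I 𝓘(ℝ, ℝ) ∞ (fun x => ψ (a * x)) :=
    hψ.comp (contMDiff_mul_left (I := I) (n := ∞) (a := a))
  have e : (fun h => ψ (a * g * h)) = fun h => ψ (a * (g * h)) := by simp only [mul_assoc]
  rw [invDeriv_eq_mfderiv_one hψ, invDeriv_eq_mfderiv_one hc, e]
  rfl

lemma invDeriv_bracket {ψ : G → ℝ} (hψ : ContMDiff I 𝓘(ℝ, ℝ) ∞ ψ)
    (X Y : GroupLieAlgebra I G) (g : G) :
    invDeriv ⁅X, Y⁆ ψ g = invDeriv X (invDeriv Y ψ) g - invDeriv Y (invDeriv X ψ) g := by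
  have h := invDeriv_bracket_one
    (hψ.comp (contMDiff_mul_left (I := I) (n := ∞) (a := g))) X Y
  simp only [Function.comp_def] at h
  rw [invDeriv_comp_mul_left hψ, invDeriv_comp_mul_left hψ, invDeriv_comp_mul_left hψ,
    invDeriv_comp_mul_left (contMDiff_invDeriv hψ _),
    invDeriv_comp_mul_left (contMDiff_invDeriv hψ _)] at h
  simpa using h

lemma invDeriv_one_eq_mfderiv {ψ : G → ℝ} (hψ : ContMDiff I 𝓘(ℝ, ℝ) ∞ ψ)
    (X : GroupLieAlgebra I G) : invDeriv X ψ 1 = (mfderiv I 𝓘(ℝ, ℝ) ψ 1 X : ℝ) := by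
  have e : (fun h => ψ (1 * h)) = ψ := by simp only [one_mul]
  rw [invDeriv_eq_mfderiv_one hψ, e]
  rfl

/-- The adjoint action is smooth. -/
lemma contMDiff_adInv [T2Space G] (l : E →L[ℝ] ℝ) (X : GroupLieAlgebra I G) :
    ContMDiff I 𝓘(ℝ, ℝ) ∞ (fun g : G => l (adInv I g X)) := by
  obtain ⟨ψ, h1, h2⟩ := exists_testFunction_invDeriv_one (I := I) (G := G) l
  have h : ContMDiff (I.prod I) 𝓘(ℝ, ℝ) ∞ (fun q : G × G => ψ (q.1⁻¹ * q.2 * q.1)) :=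
    h1.1.comp ((contMDiff_fst.inv.mul contMDiff_snd).mul contMDiff_fst)
  refine (contMDiff_mfderiv_partial h 1 X).congr fun g => ?_
  have h3 := invDeriv_comp_hom (contMDiff_conjInv (I := I) g) (conj_mul g) h1.1 X 1
  have hc : ContMDiff I 𝓘(ℝ, ℝ) ∞ (fun x => ψ (g⁻¹ * x * g)) :=
    h1.1.comp (contMDiff_conjInv (I := I) g)
  rw [invDeriv_one_eq_mfderiv hc] at h3
  refine Eq.trans ?_ h3.symm
  have e : g⁻¹ * 1 * g = 1 := by group
  rw [e, ← h2]
  rfl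

end Bracket

end LpCohomology

/-! ### Differentiation under the integral and integration by parts. -/

namespace LpCohomology

section Integration

variable {E H : Type*} [NormedAddCommGroup E] [NormedSpace ℝ E] [FiniteDimensional ℝ E]
  [TopologicalSpace H] {I : ModelWithCorners ℝ E H} [I.Boundaryless]
  {G : Type*} [TopologicalSpace G] [ChartedSpace H G] [Group G] [LieGroup I ∞ G] [T2Space G]

section Expansion
variable {ι : Type*} [Fintype ι] (b : Module.Basis ι ℝ (GroupLieAlgebra I G))

lemma invDeriv_eq_sum (X : GroupLieAlgebra I G) (ψ : G → ℝ) (g : G) :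
    invDeriv X ψ g = ∑ i, b.repr X i * invDeriv (b i) ψ g := by
  have h : invDerivLinear ψ X = ∑ i, b.repr X i • invDerivLinear ψ (b i) := by
    conv_lhs => rw [← b.sum_repr X]
    simp only [map_sum, map_smul]
  have h2 := congrFun h g
  simpa [invDerivLinear] using h2

lemma OneForm.apply_eq_sum (X : GroupLieAlgebra I G) (θ : OneForm I G) (g : G) :
    θ.apply X g = ∑ i, b.repr X i * θ.apply (b i) g := by
  have h : θ.applyLinear X = ∑ i, b.repr X i • θ.applyLinear (b i) := by
    conv_lhs => rw [← b.sum_repr X]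
    simp only [map_sum, map_smul]
  have h2 := congrFun h g
  simpa [OneForm.applyLinear] using h2

end Expansion

variable [IsTopologicalGroup G] [MeasurableSpace G] [BorelSpace G] {ν : Measure G}

lemma integrable_mul_comp_right {F ψ : G → ℝ} (hF : LocallyIntegrable F ν)
    (hψ : IsTestFunction I ψ) (a : G) : Integrable (fun g => F g * ψ (g * a)) ν :=
  integrable_mul_test hF (hψ.comp_mul_right a).1.continuous (hψ.comp_mul_right a).2

lemma integral_mul_invDeriv_eq_sum {ι : Type*} [Fintype ι]
    (b : Module.Basis ι ℝ (GroupLieAlgebra I G)) {F ψ : G → ℝ} (hF : LocallyIntegrable F ν)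
    (hψ : IsTestFunction I ψ) (X : GroupLieAlgebra I G) (a : G) :
    ∫ g, F g * invDeriv X ψ (g * a) ∂ν =
      ∑ i, b.repr X i * ∫ g, F g * invDeriv (b i) ψ (g * a) ∂ν := by
  simp only [invDeriv_eq_sum b X, Finset.mul_sum]
  rw [integral_finsetSum]
  · refine Finset.sum_congr rfl fun i _ => ?_
    rw [← integral_const_mul]
    exact integral_congr_ae (Eventually.of_forall fun g => by simp only; ring)
  · intro i _
    exact ((integrable_mul_comp_right hF (hψ.invDeriv (b i)) a).const_mul
      (b.repr X i)).congr (Eventually.of_forall fun g => by simp only; ring)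

lemma invDeriv_sub (X Y : GroupLieAlgebra I G) (ψ : G → ℝ) :
    invDeriv (X - Y) ψ = invDeriv X ψ - invDeriv Y ψ := map_sub (invDerivLinear ψ) X Y

/-- Differentiation of right translates under the integral sign. -/
lemma hasDerivAt_integral_comp_right {F : G → ℝ} (hF : LocallyIntegrable F ν) {ψ : G → ℝ}
    (hψ : IsTestFunction I ψ) {γ : ℝ → G} {Z : GroupLieAlgebra I G} (hγ : IsOneParameter γ Z)
    (t : ℝ) : HasDerivAt (fun s => ∫ g, F g * ψ (g * γ s) ∂ν)
      (∫ g, F g * invDeriv Z ψ (g * γ t) ∂ν) t := by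
  have hZ := hψ.invDeriv Z
  obtain ⟨C, hC⟩ := hZ.2.exists_bound_of_continuous hZ.1.continuous
  -- The points that some time within 1 of `t` carries into the support form part of this compact
  -- set, so a bounded multiple of `|F|` on `K` dominates.
  let K : Set G := (fun q : G × ℝ => q.1 * (γ q.2)⁻¹) ''
    (tsupport (invDeriv Z ψ) ×ˢ Set.Icc (t - 1) (t + 1))
  have hK : IsCompact K := by
    refine (hZ.2.isCompact.prod isCompact_Icc).image ?_
    exact continuous_fst.mul (hγ.continuous.comp continuous_snd).inv
  refine (hasDerivAt_integral_of_dominated_loc_of_deriv_le (𝕜 := ℝ) (s := Metric.ball t 1)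
    (F := fun s g => F g * ψ (g * γ s)) (F' := fun s g => F g * invDeriv Z ψ (g * γ s))
    (bound := K.indicator fun g => ‖F g‖ * C)
    (Metric.ball_mem_nhds t one_pos) ?_ ?_ ?_ ?_ ?_ ?_).2
  · exact Eventually.of_forall fun s => (integrable_mul_comp_right hF hψ (γ s)).aestronglyMeasurable
  · exact integrable_mul_comp_right hF hψ (γ t)
  · exact (integrable_mul_comp_right hF hZ (γ t)).aestronglyMeasurable
  · refine Eventually.of_forall fun g s hs => ?_
    by_cases h : g * γ s ∈ tsupport (invDeriv Z ψ)
    · have hg : g ∈ K := by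
        refine ⟨(g * γ s, s), ⟨h, ?_⟩, by simp⟩
        rw [Real.ball_eq_Ioo] at hs
        exact ⟨hs.1.le, hs.2.le⟩
      rw [Set.indicator_of_mem hg, norm_mul]
      exact mul_le_mul_of_nonneg_left (hC _) (norm_nonneg _)
    · rw [image_eq_zero_of_notMem_tsupport h, mul_zero, norm_zero]
      refine Set.indicator_nonneg (fun g _ => ?_) _
      exact mul_nonneg (norm_nonneg _) ((norm_nonneg _).trans (hC 1))
  · rw [integrable_indicator_iff hK.measurableSet]
    exact ((hF.integrableOn_isCompact hK).norm).mul_const C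
  · refine Eventually.of_forall fun g s _ => ?_
    have h1 : HasVelocityAt (fun s => g * γ s) Z s := (hγ.velocity s).mul_left g
    exact (h1.hasDerivAt hψ.1).const_mul (F g)

section RightInvariant

variable [ν.IsMulRightInvariant] [IsFiniteMeasureOnCompacts ν] [LocallyCompactSpace G]

lemma locallyIntegrable_one : LocallyIntegrable (fun _ : G => (1 : ℝ)) ν :=
  continuous_const.locallyIntegrable

/-- By right invariance the integral of `ψ (g * γ s)` does not depend on `s`; its derivative at `s =
0` is the integral in question. -/
lemma integral_invDeriv_eq_zero {ψ : G → ℝ} (hψ : IsTestFunction I ψ) (X : GroupLieAlgebra I G) :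
    ∫ g, invDeriv X ψ g ∂ν = 0 := by
  obtain ⟨γ, hγ⟩ := exists_isOneParameter X
  have h := hasDerivAt_integral_comp_right (locallyIntegrable_one (ν := ν)) hψ hγ 0
  simp only [one_mul] at h
  have e : (fun s => ∫ g, ψ (g * γ s) ∂ν) = fun _ => ∫ g, ψ g ∂ν := by
    funext s
    exact integral_mul_right_eq_self _ _
  rw [e, hγ.zero] at h
  simp only [mul_one] at h
  exact h.unique (hasDerivAt_const _ _)

lemma integral_mul_invDeriv {F ψ : G → ℝ} (hF : ContMDiff I 𝓘(ℝ, ℝ) ∞ F)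
    (hψ : IsTestFunction I ψ) (X : GroupLieAlgebra I G) :
    ∫ g, F g * invDeriv X ψ g ∂ν = -∫ g, invDeriv X F g * ψ g ∂ν := by
  have h := integral_invDeriv_eq_zero (ν := ν) (hψ.mul_left hF) X
  simp only [invDeriv_mul hF hψ.1] at h
  have i1 := integrable_mul_test (hF.continuous.locallyIntegrable (μ := ν))
    (hψ.invDeriv X).1.continuous (hψ.invDeriv X).2
  have i2 := integrable_mul_test ((contMDiff_invDeriv hF X).continuous.locallyIntegrable (μ := ν))
    hψ.1.continuous hψ.2
  rw [integral_add i1 i2] at h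
  linarith

/-- `Q` is itself an admissible test function. -/
lemma eq_zero_of_integral_mul_eq_zero [ν.IsOpenPosMeasure] {Q : G → ℝ} (hQ : IsTestFunction I Q)
    (h : ∀ η : G → ℝ, IsTestFunction I η → ∫ g, η g * Q g ∂ν = 0) : Q = 0 := by
  by_contra h0
  obtain ⟨x, hx⟩ := Function.ne_iff.1 h0
  have h1 : 0 < ∫ g, Q g * Q g ∂ν :=
    (hQ.1.continuous.mul hQ.1.continuous).integral_pos_of_hasCompactSupport_nonneg_nonzero
      hQ.2.mul_left (fun g => mul_self_nonneg _) (x := x) (by simpa using hx)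
  exact h1.ne' (h Q hQ)

/-- The bracket is the derivative of the adjoint action. -/
lemma bracket_eq_of_hasDerivAt_adInv [ν.IsOpenPosMeasure] {X Z W : GroupLieAlgebra I G}
    {γ : ℝ → G} (hγ : IsOneParameter γ Z)
    {ι : Type*} [Fintype ι] (b : Module.Basis ι ℝ (GroupLieAlgebra I G))
    (h : ∀ i, HasDerivAt (fun t => b.repr (adInv I (γ t) X) i) (b.repr W i) 0) : ⁅X, Z⁆ = W := by
  rw [← sub_eq_zero]
  refine eq_of_invDeriv_one_eq fun ψ hψ => ?_
  have hz : invDeriv (0 : GroupLieAlgebra I G) ψ 1 = 0 :=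
    congrFun (map_zero (invDerivLinear ψ)) 1
  have hQ := hψ.invDeriv (⁅X, Z⁆ - W)
  rw [hz, eq_zero_of_integral_mul_eq_zero (ν := ν) hQ, Pi.zero_apply]
  intro η hη
  have hli : ∀ {η : G → ℝ}, IsTestFunction I η → LocallyIntegrable η ν :=
    fun hη => hη.1.continuous.locallyIntegrable
  -- One function of `s` is differentiated twice: as it stands, and after moving `X` from `η` to the
  -- translate of `ψ`, where it reappears as `adInv I (γ s) X`. Equating the derivatives at 0 gives
  -- the commutator of `X` and `Z` in weak form.
  have h1 : HasDerivAt (fun s => -∫ g, invDeriv X η g * ψ (g * γ s) ∂ν)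
      (-∫ g, invDeriv X η g * invDeriv Z ψ (g * γ 0) ∂ν) 0 :=
    (hasDerivAt_integral_comp_right (hli (hη.invDeriv X)) hψ hγ 0).neg
  have h2 : HasDerivAt (fun s => ∑ i, b.repr (adInv I (γ s) X) i *
        ∫ g, η g * invDeriv (b i) ψ (g * γ s) ∂ν)
      (∑ i, (b.repr W i * (∫ g, η g * invDeriv (b i) ψ (g * γ 0) ∂ν) +
        b.repr (adInv I (γ 0) X) i *
          ∫ g, η g * invDeriv Z (invDeriv (b i) ψ) (g * γ 0) ∂ν)) 0 := by
    refine HasDerivAt.fun_sum fun i _ => ?_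
    exact (h i).mul (hasDerivAt_integral_comp_right (hli hη) (hψ.invDeriv (b i)) hγ 0)
  have e : (fun s => -∫ g, invDeriv X η g * ψ (g * γ s) ∂ν) =
      fun s => ∑ i, b.repr (adInv I (γ s) X) i *
        ∫ g, η g * invDeriv (b i) ψ (g * γ s) ∂ν := by
    funext s
    rw [← integral_mul_invDeriv hη.1 (hψ.comp_mul_right (γ s)) X]
    simp only [invDeriv_comp_mul_right hψ.1]
    exact integral_mul_invDeriv_eq_sum b (hli hη) hψ _ _
  rw [e] at h1
  have h3 := h1.unique h2
  have ad1 : adInv I (1 : G) X = X := by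
    have e5 : (fun x : G => 1⁻¹ * x * 1) = id := by funext x; simp
    rw [adInv, e5, mfderiv_id]
    rfl
  simp only [hγ.zero, mul_one, ad1] at h3
  rw [← integral_mul_invDeriv hη.1 (hψ.invDeriv Z) X, Finset.sum_add_distrib] at h3
  have i1 := integral_mul_invDeriv_eq_sum (ν := ν) b (hli hη) hψ W 1
  have i2 := integral_mul_invDeriv_eq_sum (ν := ν) b (hli (hη.invDeriv Z)) hψ X 1
  simp only [mul_one] at i1 i2
  have i3 : ∑ i, b.repr X i * ∫ g, η g * invDeriv Z (invDeriv (b i) ψ) g ∂ν =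
      ∫ g, η g * invDeriv Z (invDeriv X ψ) g ∂ν := by
    simp only [integral_mul_invDeriv hη.1 (hψ.invDeriv _) Z, i2, mul_neg, Finset.sum_neg_distrib]
  rw [← i1, i3] at h3
  simp only [invDeriv_sub, Pi.sub_apply, invDeriv_bracket hψ.1, mul_sub]
  have j : ∀ ρ : G → ℝ, IsTestFunction I ρ → Integrable (fun g => η g * ρ g) ν :=
    fun ρ hρ => integrable_mul_test (hli hη) hρ.1.continuous hρ.2
  have j1 := j _ ((hψ.invDeriv Z).invDeriv X)
  have j2 := j _ ((hψ.invDeriv X).invDeriv Z)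
  have j3 : Integrable (fun g => η g * invDeriv X (invDeriv Z ψ) g -
    η g * invDeriv Z (invDeriv X ψ) g) ν := j1.sub j2
  rw [integral_sub j3 (j _ (hψ.invDeriv W)), integral_sub j1 j2, h3]
  ring

end RightInvariant

end Integration

end LpCohomology

/-! ### The modular function and comparison of the two Haar measures. -/

namespace LpCohomology

section Modular

open Measure

variable {G : Type*} [TopologicalSpace G] [Group G] [IsTopologicalGroup G] [T2Space G]
  [LocallyCompactSpace G] [SecondCountableTopology G] [MeasurableSpace G] [BorelSpace G]
  (μ : Measure G) [μ.IsHaarMeasure]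

lemma map_mul_right_eq_smul (g : G) : μ.map (· * g) = modularCharacterFun g • μ :=
  map_right_mul_eq_modularCharacterFun_smul μ g

/-- Multiplied by a nonzero constant, the modular function is the convolution of a compactly
supported continuous function with a Haar measure. -/
lemma continuous_modularCharacterFun : Continuous (modularCharacterFun : G → NNReal) := by
  borelize G
  let μ : Measure G := haar
  obtain ⟨⟨f, hf⟩, hfc, hf0, hf1⟩ : ∃ f : C(G, ℝ), HasCompactSupport f ∧ 0 ≤ f ∧ f 1 ≠ 0 :=
    exists_continuous_nonneg_pos 1
  have hpos : 0 < ∫ x, f x ∂μ :=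
    hf.integral_pos_of_hasCompactSupport_nonneg_nonzero hfc hf0 hf1
  have h1 : Continuous fun x : G => ∫ y, f (y⁻¹ * x) ∂μ.inv :=
    continuous_integral_apply_inv_mul hf hfc
  have h2 : ∀ x : G, ∫ y, f (y⁻¹ * x) ∂μ.inv = (modularCharacterFun x : ℝ) * ∫ y, f y ∂μ := by
    intro x
    have e : ∫ y, f (y⁻¹ * x) ∂μ.inv = ∫ y, f (y * x) ∂μ := by
      rw [Measure.inv, integral_map (measurable_inv.aemeasurable)]
      · simp
      · exact (hf.comp (by fun_prop)).aestronglyMeasurable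
    rw [e, ← integral_map (f := f) (measurable_mul_const x).aemeasurable hf.aestronglyMeasurable,
      map_mul_right_eq_smul, integral_smul_nnreal_measure]
    rfl
  refine NNReal.isEmbedding_coe.continuous_iff.2 ?_
  have h3 : Continuous fun x : G => (modularCharacterFun x : ℝ) * ∫ y, f y ∂μ := by
    simpa only [h2] using h1
  refine (h3.div_const (∫ y, f y ∂μ)).congr fun x => ?_
  rw [mul_div_assoc, div_self hpos.ne', mul_one]
  rfl

lemma modularCharacterFun_ne_zero (g : G) : modularCharacterFun g ≠ 0 :=
  (modularCharacterFun_pos g).ne'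

/-- The right Haar measure has a continuous density with respect to the left one. -/
lemma exists_inv_eq_withDensity : ∃ c : NNReal, c ≠ 0 ∧
    μ.inv = μ.withDensity fun g => ((c * modularCharacterFun g : NNReal) : ℝ≥0∞) := by
  have hm : Measurable (modularCharacterFun : G → NNReal) :=
    continuous_modularCharacterFun.measurable
  set δ : G → ℝ≥0∞ := fun g => (modularCharacterFun g : ℝ≥0∞) with hδ
  have hδm : Measurable δ := hm.coe_nnreal_ennreal
  -- The density `δ` is multiplicative, which compensates the factor picked up by `μ` under right
  -- translation and makes `ν₀` right invariant. Its inverse is then left invariant, so uniqueness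
  -- of Haar measure applies.
  set ν₀ := μ.withDensity δ with hν₀
  have hinv : ν₀.IsMulRightInvariant := by
    refine ⟨fun a => ?_⟩
    ext s hs
    have h1 : ∀ g, (((· * a) ⁻¹' s).indicator δ) g =
        (modularCharacterFun a : ℝ≥0∞)⁻¹ * (s.indicator δ) (g * a) := by
      intro g
      by_cases hg : g * a ∈ s
      · rw [Set.indicator_of_mem hg, Set.indicator_of_mem (by exact hg)]
        simp only [hδ, modularCharacterFun_map_mul, ENNReal.coe_mul]
        rw [mul_comm (modularCharacterFun g : ℝ≥0∞), ← mul_assoc,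
          ENNReal.inv_mul_cancel (by simpa using modularCharacterFun_ne_zero a)
          ENNReal.coe_ne_top, one_mul]
      · rw [Set.indicator_of_notMem hg, Set.indicator_of_notMem (by exact hg), mul_zero]
    rw [Measure.map_apply (measurable_mul_const a) hs, hν₀,
      withDensity_apply _ (measurable_mul_const a hs), withDensity_apply _ hs,
      ← lintegral_indicator (measurable_mul_const a hs), ← lintegral_indicator hs]
    simp only [h1]
    rw [lintegral_const_mul _ (by exact (hδm.indicator hs).comp (measurable_mul_const a)),
      ← lintegral_map (hδm.indicator hs) (measurable_mul_const a), map_mul_right_eq_smul,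
      lintegral_smul_measure, ENNReal.smul_def, smul_eq_mul, ← mul_assoc,
      ENNReal.inv_mul_cancel (by simpa using modularCharacterFun_ne_zero a)
          ENNReal.coe_ne_top, one_mul]
  have hfin : IsFiniteMeasureOnCompacts ν₀ := by
    have : IsLocallyFiniteMeasure ν₀ :=
      IsLocallyFiniteMeasure.withDensity_coe continuous_modularCharacterFun
    infer_instance
  have hfin' : IsFiniteMeasureOnCompacts ν₀.inv := by
    have : IsFiniteMeasureOnCompacts (ν₀.map (Homeomorph.inv G)) :=
      IsFiniteMeasureOnCompacts.map ν₀ (Homeomorph.inv G)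
    exact this
  have h1 : ν₀.inv = haarScalarFactor ν₀.inv μ • μ := isMulLeftInvariant_eq_smul _ _
  set c := haarScalarFactor ν₀.inv μ
  have h2 : ν₀ = c • μ.inv := by
    have h3 := congrArg Measure.inv h1
    rw [Measure.inv_inv] at h3
    rw [h3, Measure.inv, Measure.map_smul]
    rfl
  have hc : c ≠ 0 := by
    intro hc
    rw [hc, zero_smul] at h2
    have h3 : μ Set.univ = 0 := by
      have h4 := (withDensity_apply_eq_zero hδm (s := Set.univ)).1 (by rw [← hν₀, h2]; rfl)
      have h5 : {x : G | δ x ≠ 0} ∩ Set.univ = Set.univ := by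
        ext x
        simp [hδ, modularCharacterFun_ne_zero]
      rwa [h5] at h4
    exact (isOpen_univ.measure_pos μ Set.univ_nonempty).ne' h3
  refine ⟨c⁻¹, inv_ne_zero hc, ?_⟩
  have h3 : μ.inv = (c⁻¹ : NNReal) • ν₀ := by
    rw [h2, smul_smul, inv_mul_cancel₀ hc, one_smul]
  rw [h3, hν₀]
  ext s hs
  rw [Measure.smul_apply, withDensity_apply _ hs, withDensity_apply _ hs, ENNReal.smul_def,
    smul_eq_mul, ← lintegral_const_mul _ hδm]
  simp [hδ]

lemma exists_inv_restrict_le {K : Set G} (hK : IsCompact K) :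
    ∃ C : NNReal, μ.inv.restrict K ≤ C • μ := by
  obtain ⟨c, -, h⟩ := exists_inv_eq_withDensity μ
  have hcont : Continuous fun g : G => c * modularCharacterFun g :=
    continuous_const.mul continuous_modularCharacterFun
  obtain ⟨C, hC⟩ := (hK.image hcont).bddAbove
  refine ⟨C, ?_⟩
  rw [h, restrict_withDensity hK.measurableSet]
  refine Measure.le_iff.2 fun s hs => ?_
  rw [withDensity_apply _ hs, Measure.smul_apply, ENNReal.smul_def, smul_eq_mul,
    Measure.restrict_restrict hs]
  calc ∫⁻ a in s ∩ K, ((c * modularCharacterFun a : NNReal) : ℝ≥0∞) ∂μ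
      ≤ ∫⁻ _ in s ∩ K, (C : ℝ≥0∞) ∂μ := by
        refine setLIntegral_mono measurable_const fun x hx => ?_
        exact ENNReal.coe_le_coe.2 (hC ⟨x, hx.2, rfl⟩)
    _ = C * μ (s ∩ K) := setLIntegral_const _ _
    _ ≤ C * μ s := by gcongr; exact Set.inter_subset_left

lemma inv_absolutelyContinuous : μ.inv ≪ μ := by
  obtain ⟨c, -, h⟩ := exists_inv_eq_withDensity μ
  rw [h]
  exact withDensity_absolutelyContinuous _ _

variable {p : ℝ≥0∞} (hp : 1 ≤ p) (hp' : p ≠ ⊤)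

include hp' in
-- Right translation rescales `μ`, so it rescales the `L^p` norm by the `p`-th root of the same
-- factor. All exponential decay along flows comes from here.
lemma eLpNorm_comp_mul_right {F : G → ℝ} (hF : AEStronglyMeasurable F μ) (a : G) :
    eLpNorm (fun g => F (g * a)) p μ =
      (modularCharacterFun a : ℝ≥0∞) ^ (1 / p.toReal) * eLpNorm F p μ := by
  have hF' : AEStronglyMeasurable F (μ.map (· * a)) := by
    rw [map_mul_right_eq_smul]
    exact hF.mono_ac Measure.smul_absolutelyContinuous
  have h1 : eLpNorm (fun g => F (g * a)) p μ = eLpNorm F p (μ.map (· * a)) := by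
    rw [eLpNorm_map_measure hF' (measurable_mul_const a).aemeasurable]
    rfl
  rw [h1, map_mul_right_eq_smul, ← Measure.coe_nnreal_smul, eLpNorm_smul_measure_of_ne_top hp']
  simp

lemma aestronglyMeasurable_comp_mul_right {F : G → ℝ} (hF : AEStronglyMeasurable F μ) (a : G) :
    AEStronglyMeasurable (fun g => F (g * a)) μ := by
  refine AEStronglyMeasurable.comp_aemeasurable (g := F) ?_ (measurable_mul_const a).aemeasurable
  rw [map_mul_right_eq_smul]
  exact hF.mono_ac (Measure.smul_absolutelyContinuous)

include hp hp' in
-- On the compact support of `η`, right Haar measure is dominated by a multiple of `μ`, and Hölder's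
-- inequality on a finite measure space passes from `L^1` to `L^p`. Keeping the indicator records
-- that only the restriction of `F` to that support matters.
lemma exists_lintegral_mul_le {η : G → ℝ} (hη : Continuous η) (hη' : HasCompactSupport η) :
    ∃ C : NNReal, ∀ F : G → ℝ, AEStronglyMeasurable F μ →
      ∫⁻ g, ‖F g * η g‖ₑ ∂μ.inv ≤ C * eLpNorm ((tsupport η).indicator F) p μ := by
  set K := tsupport η with hK
  have hKc : IsCompact K := hη'.isCompact
  obtain ⟨C, hC⟩ := exists_inv_restrict_le μ hKc
  obtain ⟨B, hB⟩ := hη'.exists_bound_of_continuous hη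
  have hfin : μ.inv.restrict K Set.univ ≠ ⊤ := by
    have h1 : μ.inv.restrict K K ≤ C * μ K := by simpa using hC K
    rw [Measure.restrict_apply_self] at h1
    rw [Measure.restrict_apply_univ]
    exact (h1.trans_lt (ENNReal.mul_lt_top ENNReal.coe_lt_top hKc.measure_lt_top)).ne
  set D : ℝ≥0∞ := ‖B‖ₑ * ((C : ℝ≥0∞) ^ (1 / p.toReal) *
    (μ.inv.restrict K Set.univ) ^ (1 / (1 : ℝ≥0∞).toReal - 1 / p.toReal)) with hD
  have hp1 : 1 ≤ p.toReal := by
    simpa using (ENNReal.toReal_le_toReal ENNReal.one_ne_top hp').2 hp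
  have hexp : 0 ≤ 1 / (1 : ℝ≥0∞).toReal - 1 / p.toReal := by
    rw [ENNReal.toReal_one, div_one, sub_nonneg]
    exact (div_le_one (by linarith)).2 hp1
  have hDt : D ≠ ⊤ := by
    refine ENNReal.mul_ne_top enorm_ne_top (ENNReal.mul_ne_top ?_ ?_)
    · exact ENNReal.rpow_ne_top_of_nonneg (by positivity) ENNReal.coe_ne_top
    · exact ENNReal.rpow_ne_top_of_nonneg hexp hfin
  refine ⟨D.toNNReal, fun F hF => ?_⟩
  rw [ENNReal.coe_toNNReal hDt]
  have hFK : AEStronglyMeasurable F (μ.inv.restrict K) :=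
    (hF.mono_ac (inv_absolutelyContinuous μ)).restrict
  have h1 : ∫⁻ g, ‖F g * η g‖ₑ ∂μ.inv ≤ ‖B‖ₑ * ∫⁻ g in K, ‖F g‖ₑ ∂μ.inv := by
    rw [← lintegral_const_mul' _ _ enorm_ne_top, ← lintegral_indicator hKc.measurableSet]
    refine lintegral_mono fun g => ?_
    by_cases hg : g ∈ K
    · rw [Set.indicator_of_mem hg, enorm_mul, mul_comm]
      gcongr
      exact enorm_le_iff_norm_le.2 ((hB g).trans (le_abs_self B))
    · rw [image_eq_zero_of_notMem_tsupport hg]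
      simp
  have h2 : ∫⁻ g in K, ‖F g‖ₑ ∂μ.inv ≤ eLpNorm F p (μ.inv.restrict K) *
      (μ.inv.restrict K Set.univ) ^ (1 / (1 : ℝ≥0∞).toReal - 1 / p.toReal) := by
    rw [← eLpNorm_one_eq_lintegral_enorm]
    exact eLpNorm_le_eLpNorm_mul_rpow_measure_univ hp hFK
  have h3 : eLpNorm F p (μ.inv.restrict K) ≤
      (C : ℝ≥0∞) ^ (1 / p.toReal) * eLpNorm (K.indicator F) p μ := by
    have h4 : μ.inv.restrict K ≤ (C : ℝ≥0∞) • μ.restrict K := by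
      have h5 := Measure.restrict_mono_measure hC K
      rw [Measure.restrict_restrict hKc.measurableSet, Set.inter_self, Measure.restrict_smul] at h5
      exact h5
    refine (eLpNorm_mono_measure F h4).trans ?_
    rw [eLpNorm_smul_measure_of_ne_top hp', eLpNorm_indicator_eq_eLpNorm_restrict hKc.measurableSet]
    simp
  calc ∫⁻ g, ‖F g * η g‖ₑ ∂μ.inv ≤ ‖B‖ₑ * ∫⁻ g in K, ‖F g‖ₑ ∂μ.inv := h1
    _ ≤ ‖B‖ₑ * (((C : ℝ≥0∞) ^ (1 / p.toReal) * eLpNorm (K.indicator F) p μ) *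
      (μ.inv.restrict K Set.univ) ^ (1 / (1 : ℝ≥0∞).toReal - 1 / p.toReal)) := by
        gcongr
        exact h2.trans (by gcongr)
    _ = D * eLpNorm (K.indicator F) p μ := by rw [hD]; ring

include hp hp' in
/-- Pairing an `L^p` function with a right translate of a test function. -/
lemma exists_lintegral_mul_comp_right_le {η : G → ℝ} (hη : Continuous η)
    (hη' : HasCompactSupport η) :
    ∃ C : NNReal, ∀ (F : G → ℝ) (a : G), AEStronglyMeasurable F μ →
      ∫⁻ g, ‖F g * η (g * a)‖ₑ ∂μ.inv ≤ C * ((modularCharacterFun a⁻¹ : ℝ≥0∞) ^ (1 / p.toReal) *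
        eLpNorm (((· * a) ⁻¹' tsupport η).indicator F) p μ) := by
  obtain ⟨C, hC⟩ := exists_lintegral_mul_le μ hp hp' hη hη'
  refine ⟨C, fun F a hF => ?_⟩
  have hK : MeasurableSet ((· * a) ⁻¹' tsupport η) :=
    measurable_mul_const a (isClosed_tsupport η).measurableSet
  have h1 : ∫⁻ g, ‖F g * η (g * a)‖ₑ ∂μ.inv = ∫⁻ g, ‖F (g * a⁻¹) * η g‖ₑ ∂μ.inv := by
    rw [← lintegral_mul_right_eq_self (fun g => ‖F (g * a⁻¹) * η g‖ₑ) a]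
    simp
  have h2 : (tsupport η).indicator (fun g => F (g * a⁻¹)) =
      fun g => (((· * a) ⁻¹' tsupport η).indicator F) (g * a⁻¹) := by
    funext g
    by_cases hg : g ∈ tsupport η
    · rw [Set.indicator_of_mem hg, Set.indicator_of_mem (by simpa using hg)]
    · rw [Set.indicator_of_notMem hg, Set.indicator_of_notMem (by simpa using hg)]
  rw [h1]
  refine (hC _ (aestronglyMeasurable_comp_mul_right μ hF a⁻¹)).trans ?_
  rw [h2, eLpNorm_comp_mul_right μ hp' (hF.indicator hK)]

include hp hp' in
lemma exists_norm_integral_mul_comp_right_le {η : G → ℝ} (hη : Continuous η)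
    (hη' : HasCompactSupport η) :
    ∃ C : NNReal, ∀ (F : G → ℝ) (a : G), MemLp F p μ →
      ‖∫ g, F g * η (g * a) ∂μ.inv‖ ≤ C * ((modularCharacterFun a⁻¹ : ℝ) ^ (1 / p.toReal) *
        (eLpNorm (((· * a) ⁻¹' tsupport η).indicator F) p μ).toReal) := by
  obtain ⟨C, hC⟩ := exists_lintegral_mul_comp_right_le μ hp hp' hη hη'
  refine ⟨C, fun F a hF => ?_⟩
  have hK : MeasurableSet ((· * a) ⁻¹' tsupport η) :=
    measurable_mul_const a (isClosed_tsupport η).measurableSet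
  have h1 := (enorm_integral_le_lintegral_enorm _).trans (hC F a hF.aestronglyMeasurable)
  have h2 : eLpNorm (((· * a) ⁻¹' tsupport η).indicator F) p μ ≠ ⊤ :=
    (hF.indicator hK).eLpNorm_ne_top
  have h3 : (modularCharacterFun a⁻¹ : ℝ≥0∞) ^ (1 / p.toReal) ≠ ⊤ :=
    ENNReal.rpow_ne_top_of_nonneg (by positivity) ENNReal.coe_ne_top
  have h4 := ENNReal.toReal_mono (ENNReal.mul_ne_top ENNReal.coe_ne_top
    (ENNReal.mul_ne_top h3 h2)) h1
  simpa [ENNReal.toReal_mul, ← ENNReal.toReal_rpow] using h4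

include hp' in
-- Each point leaves the sets `K (b k)⁻¹` eventually because `b k` escapes every compact set;
-- dominated convergence with dominating function `|F|^p` concludes.
lemma tendsto_eLpNorm_indicator_comp_right {F : G → ℝ} (hF : MemLp F p μ) (hp0 : p ≠ 0) {K : Set G}
    (hK : IsCompact K) {b : ℕ → G} (hb : Tendsto b atTop (cocompact G)) :
    Tendsto (fun k => eLpNorm (((· * b k) ⁻¹' K).indicator F) p μ) atTop (𝓝 0) := by
  have hKm : ∀ k, MeasurableSet ((· * b k) ⁻¹' K) := fun k =>
    measurable_mul_const (b k) hK.isClosed.measurableSet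
  have hpos : 0 < p.toReal := ENNReal.toReal_pos hp0 hp'
  have h1 : Tendsto (fun k => ∫⁻ g, ((· * b k) ⁻¹' K).indicator (fun g => ‖F g‖ₑ ^ p.toReal) g ∂μ)
      atTop (𝓝 (∫⁻ _, 0 ∂μ)) := by
    refine tendsto_lintegral_of_dominated_convergence' (fun g => ‖F g‖ₑ ^ p.toReal)
      (fun k => ?_) (fun k => ?_) ?_ ?_
    · exact ((hF.1.enorm).pow_const _).indicator (hKm k)
    · exact Eventually.of_forall fun g => Set.indicator_le_self _ _ _
    · exact (lintegral_rpow_enorm_lt_top_of_eLpNorm_lt_top hp0 hp' hF.2).ne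
    · refine Eventually.of_forall fun g => ?_
      have h2 : IsCompact ((fun x => g⁻¹ * x) '' K) := hK.image (by fun_prop)
      refine tendsto_const_nhds.congr' ?_
      filter_upwards [hb h2.compl_mem_cocompact] with k hk
      rw [Set.indicator_of_notMem]
      exact fun hgk => hk ⟨g * b k, hgk, by simp⟩
  rw [lintegral_zero] at h1
  have h2 := (ENNReal.continuous_rpow_const (y := 1 / p.toReal)).continuousAt.tendsto.comp h1
  rw [ENNReal.zero_rpow_of_pos (by positivity)] at h2
  refine h2.congr fun k => ?_
  rw [eLpNorm_eq_lintegral_rpow_enorm_toReal hp0 hp']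
  simp only [Function.comp_apply]
  congr 1
  refine lintegral_congr fun g => ?_
  by_cases hg : g ∈ (· * b k) ⁻¹' K
  · rw [Set.indicator_of_mem hg, Set.indicator_of_mem hg]
  · rw [Set.indicator_of_notMem hg, Set.indicator_of_notMem hg]
    simp [hpos]

include hp hp' in
/-- Pairings with right translates that escape to infinity tend to zero. -/
lemma tendsto_integral_mul_comp_right {F : G → ℝ} (hF : MemLp F p μ) {η : G → ℝ}
    (hη : Continuous η) (hη' : HasCompactSupport η) {b : ℕ → G}
    (hb : Tendsto b atTop (cocompact G)) {r : ℕ → ℝ} {D : ℝ}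
    (hr : ∀ k, |r k| * (modularCharacterFun (b k)⁻¹ : ℝ) ^ (1 / p.toReal) ≤ D) :
    Tendsto (fun k => r k * ∫ g, F g * η (g * b k) ∂μ.inv) atTop (𝓝 0) := by
  obtain ⟨C, hC⟩ := exists_norm_integral_mul_comp_right_le μ hp hp' hη hη'
  have h1 := tendsto_eLpNorm_indicator_comp_right μ hp' hF (zero_lt_one.trans_le hp).ne'
    hη'.isCompact hb
  have h2 := (ENNReal.continuousAt_toReal ENNReal.zero_ne_top).tendsto.comp h1
  have h3 := h2.const_mul (D * C)
  simp only [ENNReal.toReal_zero, mul_zero] at h3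
  refine squeeze_zero_norm (fun k => ?_) h3
  rw [norm_mul]
  -- Only the product of coefficient and modular factor has to be bounded: the localised norm
  -- already tends to zero.
  calc ‖r k‖ * ‖∫ g, F g * η (g * b k) ∂μ.inv‖
      ≤ |r k| * (C * ((modularCharacterFun (b k)⁻¹ : ℝ) ^ (1 / p.toReal) *
        (eLpNorm (((· * b k) ⁻¹' tsupport η).indicator F) p μ).toReal)) := by
        rw [Real.norm_eq_abs]
        exact mul_le_mul_of_nonneg_left (hC F (b k) hF) (abs_nonneg _)
    _ = (|r k| * (modularCharacterFun (b k)⁻¹ : ℝ) ^ (1 / p.toReal)) * C *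
        (eLpNorm (((· * b k) ⁻¹' tsupport η).indicator F) p μ).toReal := by ring
    _ ≤ D * C * (eLpNorm (((· * b k) ⁻¹' tsupport η).indicator F) p μ).toReal := by
        gcongr
        exact hr k

include hp in
lemma MemLp.locallyIntegrable_inv {F : G → ℝ} (hF : MemLp F p μ) : LocallyIntegrable F μ.inv := by
  rw [locallyIntegrable_iff]
  intro K hK
  obtain ⟨C, hC⟩ := exists_inv_restrict_le μ hK
  have h1 : IntegrableOn F K μ := (hF.locallyIntegrable hp).integrableOn_isCompact hK
  have h2 : μ.inv.restrict K ≤ (C : ℝ≥0∞) • μ.restrict K := by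
    have h5 := Measure.restrict_mono_measure hC K
    rw [Measure.restrict_restrict hK.measurableSet, Set.inter_self, Measure.restrict_smul] at h5
    exact h5
  exact (Integrable.smul_measure h1 ENNReal.coe_ne_top).mono_measure h2

end Modular

end LpCohomology

/-! ### Primitives along an expanding one-parameter subgroup. -/

namespace LpCohomology

section Flow

open Measure

variable {E H : Type*} [NormedAddCommGroup E] [NormedSpace ℝ E] [FiniteDimensional ℝ E]
  [TopologicalSpace H] {I : ModelWithCorners ℝ E H} [I.Boundaryless]
  {G : Type*} [TopologicalSpace G] [ChartedSpace H G] [Group G] [LieGroup I ∞ G] [T2Space G]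
  [IsTopologicalGroup G] [LocallyCompactSpace G] [SecondCountableTopology G]
  [MeasurableSpace G] [BorelSpace G]
  {a : ℝ → G} {ξ : GroupLieAlgebra I G} (ha : IsOneParameter a ξ)
  {h : ℝ} (hh : 0 < h) (hmod : ∀ s, (modularCharacterFun (a s) : ℝ) = Real.exp (h * s))
  {μ : Measure G} [μ.IsHaarMeasure] {p : ℝ≥0∞} (hp : 1 ≤ p) (hp' : p ≠ ⊤)

include hh hmod in
-- A continuous function is bounded on compact sets, whereas the modular function is unbounded along
-- the sequence.
lemma tendsto_flow_cocompact : Tendsto (fun k : ℕ => a k) atTop (cocompact G) := by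
  rw [tendsto_def]
  intro s hs
  obtain ⟨K, hK, hKs⟩ := mem_cocompact.1 hs
  obtain ⟨C, hC⟩ := (hK.image continuous_modularCharacterFun).bddAbove
  have h1 : Tendsto (fun k : ℕ => Real.exp (h * k)) atTop atTop :=
    Real.tendsto_exp_atTop.comp (tendsto_natCast_atTop_atTop.const_mul_atTop hh)
  filter_upwards [h1.eventually_gt_atTop (C : ℝ)] with k hk
  refine hKs fun hak => ?_
  have h2 : modularCharacterFun (a k) ≤ C := hC ⟨_, hak, rfl⟩
  rw [← hmod] at hk
  exact absurd (NNReal.coe_le_coe.2 h2) (not_le.2 hk)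

include ha hmod in
lemma modularCharacterFun_flow_inv_rpow (s : ℝ) :
    (modularCharacterFun (a s)⁻¹ : ℝ) ^ (1 / p.toReal) = Real.exp (-(h / p.toReal) * s) := by
  rw [← ha.neg, hmod, ← Real.exp_mul]
  congr 1
  ring

include ha hmod hp hp' in
lemma exists_norm_integral_flow_le {η : G → ℝ} (hη : IsTestFunction I η) :
    ∃ C : NNReal, ∀ (F : G → ℝ) (s : ℝ), MemLp F p μ →
      ‖∫ g, F g * η (g * a s) ∂μ.inv‖ ≤
        C * (eLpNorm F p μ).toReal * Real.exp (-(h / p.toReal) * s) := by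
  obtain ⟨C, hC⟩ := exists_norm_integral_mul_comp_right_le μ hp hp' hη.1.continuous hη.2
  refine ⟨C, fun F s hF => (hC F (a s) hF).trans ?_⟩
  rw [modularCharacterFun_flow_inv_rpow ha hmod, mul_assoc (C : ℝ), mul_comm (Real.exp _)]
  gcongr
  · exact hF.eLpNorm_ne_top
  · exact eLpNorm_indicator_le F

/-- The pairing of a test function with the primitive of `F` along the flow of right
translations by `a`. -/
def flowPairing (a : ℝ → G) (μ : Measure G) (F η : G → ℝ) : ℝ :=
  ∫ s in Set.Ioi (0 : ℝ), ∫ g, F g * η (g * a s) ∂μ.inv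

include hh hp hp' in
lemma rate_pos : 0 < h / p.toReal :=
  div_pos hh (ENNReal.toReal_pos (zero_lt_one.trans_le hp).ne' hp')

include ha hh hmod hp hp'

lemma integrableOn_flow {F η : G → ℝ} (hF : MemLp F p μ) (hη : IsTestFunction I η) :
    IntegrableOn (fun s => ∫ g, F g * η (g * a s) ∂μ.inv) (Set.Ioi 0) := by
  obtain ⟨C, hC⟩ := exists_norm_integral_flow_le ha hmod (μ := μ) hp hp' hη
  have hr := rate_pos hh hp hp'
  have h1 : IntegrableOn (fun s => C * (eLpNorm F p μ).toReal * Real.exp (-(h / p.toReal) * s))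
      (Set.Ioi 0) := (integrableOn_exp_mul_Ioi (neg_lt_zero.2 hr) 0).const_mul _
  refine h1.mono' ?_ (Eventually.of_forall fun s => hC F s hF)
  have h2 : Continuous fun s => ∫ g, F g * η (g * a s) ∂μ.inv :=
    continuous_iff_continuousAt.2 fun s =>
      (hasDerivAt_integral_comp_right (MemLp.locallyIntegrable_inv μ hp hF) hη ha s).continuousAt
  exact h2.aestronglyMeasurable

lemma tendsto_flow {F η : G → ℝ} (hF : MemLp F p μ) (hη : IsTestFunction I η) :
    Tendsto (fun s => ∫ g, F g * η (g * a s) ∂μ.inv) atTop (𝓝 0) := by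
  obtain ⟨C, hC⟩ := exists_norm_integral_flow_le ha hmod (μ := μ) hp hp' hη
  have hr := rate_pos hh hp hp'
  refine squeeze_zero_norm (fun s => hC F s hF) ?_
  have h1 : Tendsto (fun s : ℝ => Real.exp (-(h / p.toReal) * s)) atTop (𝓝 0) :=
    Real.tendsto_exp_atBot.comp (tendsto_id.const_mul_atTop_of_neg (neg_lt_zero.2 hr))
  simpa using h1.const_mul (C * (eLpNorm F p μ).toReal)

/-- The pairing at time `s` is bounded by the `L^p` norm times `exp (-h s / p)`, which is
integrable, so `flowPairing` is a continuous functional of `F`. -/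
lemma tendsto_flowPairing {F : G → ℝ} {Fk : ℕ → G → ℝ} (hF : MemLp F p μ)
    (hFk : ∀ k, MemLp (Fk k) p μ)
    (hlim : Tendsto (fun k => eLpNorm (F - Fk k) p μ) atTop (𝓝 0)) {η : G → ℝ}
    (hη : IsTestFunction I η) :
    Tendsto (fun k => flowPairing a μ (Fk k) η) atTop (𝓝 (flowPairing a μ F η)) := by
  obtain ⟨C, hC⟩ := exists_norm_integral_flow_le ha hmod (μ := μ) hp hp' hη
  have hr := rate_pos hh hp hp'
  have h1 : ∀ k, ‖flowPairing a μ F η - flowPairing a μ (Fk k) η‖ ≤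
      (∫ s in Set.Ioi (0 : ℝ), C * Real.exp (-(h / p.toReal) * s)) *
        (eLpNorm (F - Fk k) p μ).toReal := fun k => by
    rw [flowPairing, flowPairing, ← integral_sub (integrableOn_flow ha hh hmod hp hp' hF hη)
      (integrableOn_flow ha hh hmod hp hp' (hFk k) hη), ← integral_mul_const]
    refine norm_integral_le_of_norm_le
      (((integrableOn_exp_mul_Ioi (neg_lt_zero.2 hr) 0).const_mul _).mul_const _)
      (Eventually.of_forall fun s => ?_)
    have h2 := hC _ s (hF.sub (hFk k))
    have h3 : ∫ g, (F - Fk k) g * η (g * a s) ∂μ.inv =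
        ∫ g, F g * η (g * a s) ∂μ.inv - ∫ g, Fk k g * η (g * a s) ∂μ.inv := by
      simp only [Pi.sub_apply, sub_mul]
      exact integral_sub
        (integrable_mul_comp_right (MemLp.locallyIntegrable_inv μ hp hF) hη _)
        (integrable_mul_comp_right (MemLp.locallyIntegrable_inv μ hp (hFk k)) hη _)
    rw [h3] at h2
    refine h2.trans (le_of_eq ?_)
    ring
  have h2 := (ENNReal.continuousAt_toReal ENNReal.zero_ne_top).tendsto.comp hlim
  have h3 := h2.const_mul (∫ s in Set.Ioi (0 : ℝ), C * Real.exp (-(h / p.toReal) * s))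
  rw [ENNReal.toReal_zero, mul_zero] at h3
  have h4 := squeeze_zero_norm h1 h3
  have h5 := h4.const_sub (flowPairing a μ F η)
  simpa using h5

omit hh in
lemma invDeriv_flow {η : G → ℝ} (hη : IsTestFunction I η) (s : ℝ) (g : G) :
    invDeriv ξ (fun x => η (x * a s)) g = invDeriv ξ η (g * a s) := by
  rw [invDeriv_comp_mul_right hη.1, ha.adInv_self]

/-- The integrand in `s` is the derivative of the pairing with the translate of `η`, which vanishes
at infinity; only the boundary term at `s = 0` remains. -/
lemma flowPairing_invDeriv {F η : G → ℝ} (hF : MemLp F p μ) (hη : IsTestFunction I η) :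
    flowPairing a μ F (invDeriv ξ η) = -∫ g, F g * η g ∂μ.inv := by
  have h1 := integral_Ioi_of_hasDerivAt_of_tendsto
    (f := fun s => ∫ g, F g * η (g * a s) ∂μ.inv) (a := 0)
    (hasDerivAt_integral_comp_right (MemLp.locallyIntegrable_inv μ hp hF) hη ha
      0).continuousAt.continuousWithinAt
    (fun s _ => hasDerivAt_integral_comp_right (MemLp.locallyIntegrable_inv μ hp hF) hη ha s)
    (integrableOn_flow ha hh hmod hp hp' hF (hη.invDeriv ξ))
    (tendsto_flow ha hh hmod hp hp' hF hη)
  rw [flowPairing, h1, ha.zero]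
  simp

/-- A function in `L^p` is determined by its derivative along the flow. -/
lemma integral_eq_flowPairing {u F : G → ℝ} (hu : MemLp u p μ)
    (hd : ∀ η : G → ℝ, IsTestFunction I η →
      ∫ g, u g * invDeriv ξ η g ∂μ.inv = -∫ g, F g * η g ∂μ.inv)
    {η : G → ℝ} (hη : IsTestFunction I η) :
    ∫ g, u g * η g ∂μ.inv = flowPairing a μ F η := by
  -- `flowPairing` of `u` with `ξ η` is computed in two ways: by the fundamental theorem of
  -- calculus, and by integrating by parts on each translate. The latter works because `ξ` commutes
  -- with its own flow.
  have h0 := flowPairing_invDeriv ha hh hmod hp hp' hu hη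
  have h1 : flowPairing a μ u (invDeriv ξ η) = -flowPairing a μ F η := by
    rw [flowPairing, flowPairing, ← integral_neg]
    congr 1
    funext s
    rw [← hd _ (hη.comp_mul_right (a s))]
    simp only [invDeriv_flow ha hmod hp hp' hη]
  linarith

omit [IsTopologicalGroup G] [LocallyCompactSpace G] [SecondCountableTopology G] ha hh hmod hp hp' in
/-- Jensen's inequality on the half line with an exponential weight. -/
lemma rpow_lintegral_Ioi_le {q c : ℝ} (hq : 1 ≤ q) (hc : 0 < c) {f : ℝ → ℝ≥0∞}
    (hf : Measurable f) :
    (∫⁻ s in Set.Ioi (0 : ℝ), f s) ^ q ≤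
      ∫⁻ s in Set.Ioi (0 : ℝ), ENNReal.ofReal (c * Real.exp (-c * s)) *
        (ENNReal.ofReal (c⁻¹ * Real.exp (c * s)) * f s) ^ q := by
  set w : ℝ → ℝ≥0∞ := fun s => ENNReal.ofReal (c * Real.exp (-c * s)) with hw
  have hwm : Measurable w := by fun_prop
  set ρ : Measure ℝ := (volume.restrict (Set.Ioi (0 : ℝ))).withDensity w with hρ
  have hprob : IsProbabilityMeasure ρ := by
    refine ⟨?_⟩
    rw [hρ, withDensity_apply _ MeasurableSet.univ, Measure.restrict_univ,
      ← ofReal_integral_eq_lintegral_ofReal]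
    · rw [integral_const_mul, integral_exp_mul_Ioi (neg_lt_zero.2 hc)]
      simp [hc.ne']
    · exact (integrableOn_exp_mul_Ioi (neg_lt_zero.2 hc) 0).const_mul c
    · exact Eventually.of_forall fun s => by positivity
  have hgm : Measurable fun s => ENNReal.ofReal (c⁻¹ * Real.exp (c * s)) * f s := by fun_prop
  have h1 : ∫⁻ s in Set.Ioi (0 : ℝ), f s =
      ∫⁻ s, ENNReal.ofReal (c⁻¹ * Real.exp (c * s)) * f s ∂ρ := by
    rw [hρ, lintegral_withDensity_eq_lintegral_mul _ hwm hgm]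
    refine lintegral_congr fun s => ?_
    simp only [hw, Pi.mul_apply]
    rw [← mul_assoc, ← ENNReal.ofReal_mul (by positivity)]
    have : c * Real.exp (-c * s) * (c⁻¹ * Real.exp (c * s)) = 1 := by
      rw [mul_mul_mul_comm, mul_inv_cancel₀ hc.ne', ← Real.exp_add]
      simp
    rw [this, ENNReal.ofReal_one, one_mul]
  have h2 : ∫⁻ s in Set.Ioi (0 : ℝ), w s * (ENNReal.ofReal (c⁻¹ * Real.exp (c * s)) * f s) ^ q =
      ∫⁻ s, (ENNReal.ofReal (c⁻¹ * Real.exp (c * s)) * f s) ^ q ∂ρ := by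
    rw [hρ, lintegral_withDensity_eq_lintegral_mul _ hwm (hgm.pow_const q)]
    rfl
  rw [h1, h2]
  have h3 := eLpNorm'_le_eLpNorm'_of_exponent_le (μ := ρ) zero_lt_one hq
    (f := fun s => ENNReal.ofReal (c⁻¹ * Real.exp (c * s)) * f s) hgm.aestronglyMeasurable
  simp only [eLpNorm', enorm_eq_self, ENNReal.rpow_one, div_one] at h3
  have h4 := ENNReal.rpow_le_rpow h3 (zero_le_one.trans hq)
  rwa [← ENNReal.rpow_mul, one_div_mul_cancel (by linarith), ENNReal.rpow_one] at h4

/-- The primitive is the integral over `s > 0` of `F (g * a (-s))`, each translate having norm `exp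
(-h s / p)` times that of `F`. Jensen's inequality plays the part of Minkowski's integral
inequality, and right invariance of `μ.inv` moves the translation onto the test function. -/
lemma exists_flowPrimitive {F : G → ℝ} (hF : MemLp F p μ) :
    ∃ u : G → ℝ, MemLp u p μ ∧ ∀ η : G → ℝ, IsTestFunction I η →
      ∫ g, u g * η g ∂μ.inv = flowPairing a μ F η := by
  have hr := rate_pos hh hp hp'
  have hq1 : 1 ≤ p.toReal := by
    simpa using (ENNReal.toReal_le_toReal ENNReal.one_ne_top hp').2 hp
  have hq0 : 0 < p.toReal := zero_lt_one.trans_le hq1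
  have hp0 : p ≠ 0 := (zero_lt_one.trans_le hp).ne'
  set c := h / p.toReal with hc
  have hmE : ∀ s, (modularCharacterFun (a (-s)) : ℝ≥0∞) ^ (1 / p.toReal) =
      ENNReal.ofReal (Real.exp (-c * s)) := fun s => by
    rw [← modularCharacterFun_flow_inv_rpow ha hmod, ← ha.neg,
      ← ENNReal.ofReal_rpow_of_pos (NNReal.coe_pos.2 (modularCharacterFun_pos _)),
      ENNReal.ofReal_coe_nnreal]
  -- A strongly measurable representative gives joint measurability in `(g, s)`, as Fubini requires.
  set F' := hF.1.mk F with hF'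
  have hF'm : StronglyMeasurable F' := hF.1.stronglyMeasurable_mk
  have hFF' : F =ᵐ[μ] F' := hF.1.ae_eq_mk
  have hF'p : MemLp F' p μ := hF.ae_eq hFF'
  have hFν : F =ᵐ[μ.inv] F' := (inv_absolutelyContinuous μ).ae_le hFF'
  have hmap : Measurable fun q : G × ℝ => q.1 * a (-q.2) :=
    (continuous_fst.mul (ha.continuous.comp continuous_snd.neg)).measurable
  have hΦ : StronglyMeasurable fun q : G × ℝ => F' (q.1 * a (-q.2)) :=
    hF'm.comp_measurable hmap
  set U : G → ℝ≥0∞ := fun g => ∫⁻ s in Set.Ioi (0 : ℝ), ‖F' (g * a (-s))‖ₑ with hU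
  have hUm : Measurable U := hΦ.enorm.lintegral_prod_right'
  have hUp : ∫⁻ g, U g ^ p.toReal ∂μ < ⊤ := by
    have h1 : ∫⁻ g, U g ^ p.toReal ∂μ ≤ ∫⁻ g, (∫⁻ s in Set.Ioi (0 : ℝ),
        ENNReal.ofReal (c * Real.exp (-c * s)) *
        (ENNReal.ofReal (c⁻¹ * Real.exp (c * s)) * ‖F' (g * a (-s))‖ₑ) ^ p.toReal) ∂μ := by
      refine lintegral_mono fun g => ?_
      refine rpow_lintegral_Ioi_le hq1 hr ?_
      exact (hΦ.comp_measurable (measurable_const.prodMk measurable_id)).enorm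
    refine h1.trans_lt ?_
    rw [lintegral_lintegral_swap]
    swap
    · refine Measurable.aemeasurable ?_
      have : Measurable fun q : G × ℝ => ‖F' (q.1 * a (-q.2))‖ₑ := hΦ.enorm
      fun_prop
    -- With `c = h / p` the weight `exp (c s)` cancels exactly the decay of the translate, so what
    -- remains is a constant times a probability density in `s`.
    have h2 : ∀ s, ∫⁻ g, ENNReal.ofReal (c * Real.exp (-c * s)) *
        (ENNReal.ofReal (c⁻¹ * Real.exp (c * s)) * ‖F' (g * a (-s))‖ₑ) ^ p.toReal ∂μ =
        ENNReal.ofReal (c * Real.exp (-c * s)) * (ENNReal.ofReal (c⁻¹) * eLpNorm F' p μ) ^ p.toReal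
        := fun s => by
      have h3 : Measurable fun g => ‖F' (g * a (-s))‖ₑ :=
        (hΦ.comp_measurable (measurable_id.prodMk measurable_const)).enorm
      have h4 : (ENNReal.ofReal (Real.exp (-c * s)) * eLpNorm F' p μ) ^ p.toReal =
          ∫⁻ g, ‖F' (g * a (-s))‖ₑ ^ p.toReal ∂μ := by
        rw [← hmE, ← eLpNorm_comp_mul_right μ hp' hF'p.1 (a (-s)),
          eLpNorm_eq_lintegral_rpow_enorm_toReal hp0 hp', ← ENNReal.rpow_mul,
          one_div_mul_cancel hq0.ne', ENNReal.rpow_one]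
      rw [lintegral_const_mul _ (by fun_prop)]
      simp only [ENNReal.mul_rpow_of_nonneg _ _ hq0.le]
      rw [lintegral_const_mul _ (by fun_prop), ← h4, ENNReal.mul_rpow_of_nonneg _ _ hq0.le,
        ← mul_assoc (ENNReal.ofReal _ ^ _), ← ENNReal.mul_rpow_of_nonneg _ _ hq0.le,
        ← ENNReal.ofReal_mul (by positivity)]
      have h5 : c⁻¹ * Real.exp (c * s) * Real.exp (-c * s) = c⁻¹ := by
        rw [mul_assoc, ← Real.exp_add]
        simp
      rw [h5]
    simp only [h2]
    rw [lintegral_mul_const _ (by fun_prop)]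
    refine ENNReal.mul_lt_top ?_ ?_
    · exact ((integrableOn_exp_mul_Ioi (neg_lt_zero.2 hr) 0).const_mul c).lintegral_lt_top
    · exact ENNReal.rpow_lt_top_of_nonneg hq0.le
        (ENNReal.mul_ne_top ENNReal.ofReal_ne_top hF'p.eLpNorm_ne_top)
  have hum : StronglyMeasurable fun g => ∫ s in Set.Ioi (0 : ℝ), F' (g * a (-s)) :=
    hΦ.integral_prod_right'
  refine ⟨fun g => ∫ s in Set.Ioi (0 : ℝ), F' (g * a (-s)), ⟨hum.aestronglyMeasurable, ?_⟩,
    fun η hη => ?_⟩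
  · rw [eLpNorm_lt_top_iff_lintegral_rpow_enorm_lt_top hp0 hp']
    refine (lintegral_mono fun g => ?_).trans_lt hUp
    exact ENNReal.rpow_le_rpow (enorm_integral_le_lintegral_enorm _) hq0.le
  · obtain ⟨C, hC⟩ := exists_lintegral_mul_comp_right_le μ hp hp' hη.1.continuous hη.2
    have hint : Integrable (fun q : G × ℝ => F' (q.1 * a (-q.2)) * η q.1)
        (μ.inv.prod (volume.restrict (Set.Ioi (0 : ℝ)))) := by
      have hm : StronglyMeasurable (fun q : G × ℝ => F' (q.1 * a (-q.2)) * η q.1) :=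
        hΦ.mul (hη.1.continuous.comp continuous_fst).stronglyMeasurable
      refine ⟨hm.aestronglyMeasurable, ?_⟩
      rw [HasFiniteIntegral, lintegral_prod_symm' _ hm.enorm]
      have h1 : ∀ s, ∫⁻ g, ‖F' (g * a (-s)) * η g‖ₑ ∂μ.inv ≤
          C * eLpNorm F' p μ * ENNReal.ofReal (Real.exp (-c * s)) := fun s => by
        have h2 := hC F' (a s) hF'p.1
        rw [← lintegral_mul_right_eq_self (fun g => ‖F' (g * a (-s)) * η g‖ₑ) (a s)]
        simp only [mul_assoc, ← ha.add, add_neg_cancel, ha.zero, mul_one]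
        refine h2.trans ?_
        rw [← ha.neg, hmE, mul_comm (ENNReal.ofReal _)]
        gcongr
        exact eLpNorm_indicator_le F'
      refine (lintegral_mono fun s => h1 s).trans_lt ?_
      rw [lintegral_const_mul _ (by fun_prop)]
      refine ENNReal.mul_lt_top (ENNReal.mul_lt_top ENNReal.coe_lt_top hF'p.2) ?_
      exact (integrableOn_exp_mul_Ioi (neg_lt_zero.2 hr) 0).lintegral_lt_top
    have h1 : ∀ g, (∫ s in Set.Ioi (0 : ℝ), F' (g * a (-s))) * η g =
        ∫ s in Set.Ioi (0 : ℝ), F' (g * a (-s)) * η g := fun g => (integral_mul_const _ _).symm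
    simp only [h1]
    rw [integral_integral_swap hint, flowPairing]
    congr 1
    funext s
    rw [← integral_mul_right_eq_self _ (a s)]
    refine integral_congr_ae ?_
    filter_upwards [hFν] with g hg
    rw [mul_assoc, ← ha.add, add_neg_cancel, ha.zero, mul_one, hg]

end Flow

end LpCohomology

/-! ### Defects, quotients and vanishing of the torsion. -/

namespace LpCohomology

section Cohomology

open Measure

variable {E H : Type*} [NormedAddCommGroup E] [NormedSpace ℝ E] [FiniteDimensional ℝ E]
  [TopologicalSpace H] {I : ModelWithCorners ℝ E H} [I.Boundaryless]
  {G : Type*} [TopologicalSpace G] [ChartedSpace H G] [Group G] [LieGroup I ∞ G] [T2Space G]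
  [MeasurableSpace G] [BorelSpace G]
  {ι : Type*} [Fintype ι] {b : Module.Basis ι ℝ (GroupLieAlgebra I G)}
  {μ : Measure G} {p : ℝ≥0∞}

lemma OneForm.aestronglyMeasurable_apply {θ : OneForm I G}
    (hθ : AEStronglyMeasurable (θ.coeff b) μ) (i : ι) :
    AEStronglyMeasurable (θ.apply (b i)) μ :=
  (PiLp.continuous_apply 2 (fun _ : ι => ℝ) i).comp_aestronglyMeasurable hθ

lemma OneForm.memLp_apply {θ : OneForm I G} (hθ : MemLp (θ.coeff b) p μ)
    (X : GroupLieAlgebra I G) : MemLp (θ.apply X) p μ := by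
  have h1 : ∀ i, MemLp (θ.apply (b i)) p μ := fun i =>
    MemLp.of_le hθ (OneForm.aestronglyMeasurable_apply hθ.1 i)
      (Eventually.of_forall fun g => PiLp.norm_apply_le (θ.coeff b g) i)
  have h2 : θ.apply X = fun g => ∑ i, b.repr X i * θ.apply (b i) g :=
    funext fun g => OneForm.apply_eq_sum b X θ g
  rw [h2]
  exact memLp_finsetSum _ fun i _ => (h1 i).const_mul _

lemma OneForm.memLp_coeff {θ : OneForm I G} (hθ : ∀ i, MemLp (θ.apply (b i)) p μ) :
    MemLp (θ.coeff b) p μ := by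
  have h1 : AEStronglyMeasurable (θ.coeff b) μ := by
    have : AEMeasurable (fun g i => θ.apply (b i) g) μ :=
      aemeasurable_pi_lambda _ fun i => (hθ i).1.aemeasurable
    exact ((PiLp.continuous_toLp 2 (fun _ : ι => ℝ)).measurable.comp_aemeasurable
      this).aestronglyMeasurable
  have h2 : MemLp (fun g => ∑ i, ‖θ.apply (b i) g‖) p μ :=
    memLp_finsetSum _ fun i _ => (hθ i).norm
  refine MemLp.of_le h2 h1 (Eventually.of_forall fun g => ?_)
  rw [Real.norm_of_nonneg (Finset.sum_nonneg fun i _ => norm_nonneg _)]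
  rw [EuclideanSpace.norm_eq]
  exact Real.sqrt_le_iff.2 ⟨Finset.sum_nonneg fun i _ => norm_nonneg _,
    Finset.sum_sq_le_sq_sum_of_nonneg fun i _ => norm_nonneg _⟩

lemma tendsto_eLpNorm_apply {θ : OneForm I G} {η : ℕ → OneForm I G}
    (hm : ∀ k, MemLp ((θ - η k).coeff b) p μ) (hp : 1 ≤ p)
    (hlim : Tendsto (fun k => eLpNorm ((θ - η k).coeff b) p μ) atTop (𝓝 0))
    (X : GroupLieAlgebra I G) :
    Tendsto (fun k => eLpNorm (θ.apply X - (η k).apply X) p μ) atTop (𝓝 0) := by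
  have h1 : ∀ k, eLpNorm (θ.apply X - (η k).apply X) p μ ≤
      (∑ i, ‖b.repr X i‖ₑ) * eLpNorm ((θ - η k).coeff b) p μ := fun k => by
    have e : θ.apply X - (η k).apply X = ∑ i, b.repr X i • (θ - η k).apply (b i) := by
      funext g
      have := OneForm.apply_eq_sum b X (θ - η k) g
      simp only [Finset.sum_apply, Pi.smul_apply, smul_eq_mul]
      rw [← this]
      rfl
    rw [e, Finset.sum_mul]
    refine (eLpNorm_sum_le (fun i _ =>
      ((OneForm.memLp_apply (hm k) (b i)).const_smul _).1) hp).trans ?_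
    refine Finset.sum_le_sum fun i _ => ?_
    rw [eLpNorm_const_smul]
    gcongr
    exact eLpNorm_mono fun g => PiLp.norm_apply_le ((θ - η k).coeff b g) i
  have h2 := ENNReal.Tendsto.const_mul (a := ∑ i, ‖b.repr X i‖ₑ) hlim
    (Or.inr (ENNReal.sum_ne_top.2 fun i _ => enorm_ne_top))
  rw [mul_zero] at h2
  exact tendsto_of_tendsto_of_tendsto_of_le_of_le tendsto_const_nhds h2 (fun _ => zero_le) h1

/-- The failure of `θ = du`, tested against `X` and `ψ`. -/
def defect (μ : Measure G) (u : G → ℝ) (θ : OneForm I G) (X : GroupLieAlgebra I G)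
    (ψ : G → ℝ) : ℝ :=
  ∫ g, u g * invDeriv X ψ g ∂μ.inv + ∫ g, θ.apply X g * ψ g ∂μ.inv

lemma subsingleton_R1 (h : closedForms b μ p ≤ exactForms b μ p) : Subsingleton (R1 b μ p) := by
  have : Subsingleton (H1 b μ p) :=
    Submodule.Quotient.subsingleton_iff.2 (Submodule.submoduleOf_eq_top.2 h)
  exact (Submodule.Quotient.mk_surjective _).subsingleton

lemma torsion_eq_bot (h : limitForms b μ p ≤ exactForms b μ p) : torsion b μ p = ⊥ := by
  rw [eq_bot_iff]
  rintro _ ⟨x, hx, rfl⟩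
  exact (Submodule.Quotient.mk_eq_zero _).2 (h hx)

/-- Since the torsion is zero, a nonzero class in `H1` survives in the reduced quotient. -/
lemma nontrivial_R1 (h : limitForms b μ p ≤ exactForms b μ p) {θ : OneForm I G}
    (hθ : θ ∈ closedForms b μ p) (hθ' : θ ∉ exactForms b μ p) : Nontrivial (R1 b μ p) := by
  refine ⟨⟨Submodule.Quotient.mk (Submodule.Quotient.mk ⟨θ, hθ⟩), 0, fun h0 => hθ' ?_⟩⟩
  rw [Submodule.Quotient.mk_eq_zero, torsion_eq_bot h, Submodule.mem_bot,
    Submodule.Quotient.mk_eq_zero] at h0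
  exact h0

variable [IsTopologicalGroup G] [LocallyCompactSpace G] [SecondCountableTopology G]
  [μ.IsHaarMeasure]

lemma tendsto_integral_mul (hp : 1 ≤ p) (hp' : p ≠ ⊤) {F : G → ℝ} {Fk : ℕ → G → ℝ}
    (hF : MemLp F p μ) (hFk : ∀ k, MemLp (Fk k) p μ)
    (hlim : Tendsto (fun k => eLpNorm (F - Fk k) p μ) atTop (𝓝 0)) {η : G → ℝ}
    (hη : IsTestFunction I η) :
    Tendsto (fun k => ∫ g, Fk k g * η g ∂μ.inv) atTop (𝓝 (∫ g, F g * η g ∂μ.inv)) := by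
  obtain ⟨C, hC⟩ := exists_norm_integral_mul_comp_right_le μ hp hp' hη.1.continuous hη.2
  have h1 : ∀ k, ‖∫ g, F g * η g ∂μ.inv - ∫ g, Fk k g * η g ∂μ.inv‖ ≤
      C * (eLpNorm (F - Fk k) p μ).toReal := fun k => by
    have h2 := hC _ 1 (hF.sub (hFk k))
    simp only [mul_one, inv_one, modularCharacterFun_map_one, NNReal.coe_one, Real.one_rpow,
      one_mul] at h2
    have h3 : ∫ g, (F - Fk k) g * η g ∂μ.inv =
        ∫ g, F g * η g ∂μ.inv - ∫ g, Fk k g * η g ∂μ.inv := by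
      simp only [Pi.sub_apply, sub_mul]
      exact integral_sub
        (integrable_mul_test (MemLp.locallyIntegrable_inv μ hp hF) hη.1.continuous hη.2)
        (integrable_mul_test (MemLp.locallyIntegrable_inv μ hp (hFk k)) hη.1.continuous hη.2)
    rw [h3] at h2
    refine h2.trans ?_
    gcongr
    · exact (hF.sub (hFk k)).eLpNorm_ne_top
    · exact eLpNorm_indicator_le _
  have h2 := (ENNReal.continuousAt_toReal ENNReal.zero_ne_top).tendsto.comp hlim
  have h3 := h2.const_mul (C : ℝ)
  rw [ENNReal.toReal_zero, mul_zero] at h3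
  have h5 := (squeeze_zero_norm h1 h3).const_sub (∫ g, F g * η g ∂μ.inv)
  simpa using h5

lemma isWeakDifferential_of_defect_eq_zero (hp : 1 ≤ p) {u : G → ℝ} {θ : OneForm I G}
    (hu : MemLp u p μ) (hθ : MemLp (θ.coeff b) p μ)
    (h : ∀ X ψ, IsTestFunction I ψ → defect μ u θ X ψ = 0) : IsWeakDifferential μ u θ :=
  ⟨MemLp.locallyIntegrable_inv μ hp hu,
    fun X => MemLp.locallyIntegrable_inv μ hp (OneForm.memLp_apply hθ X),
    fun X ψ hψ => eq_neg_of_add_eq_zero_left (h X ψ hψ)⟩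

variable {a : ℝ → G} {ξ : GroupLieAlgebra I G} (ha : IsOneParameter a ξ)
  {h : ℝ} (hh : 0 < h) (hmod : ∀ s, (modularCharacterFun (a s) : ℝ) = Real.exp (h * s))
  (hp : 1 ≤ p) (hp' : p ≠ ⊤)

include ha hh hmod hp hp'

/-- Uniqueness of the primitive eliminates `u`: exactness becomes a family of linear equations in
`θ`, continuous for the `L^p` norm. -/
lemma flowPairing_add_eq_zero_of_mem_exactForms {θ : OneForm I G} (hθ : θ ∈ exactForms b μ p)
    (X : GroupLieAlgebra I G) {ψ : G → ℝ} (hψ : IsTestFunction I ψ) :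
    flowPairing a μ (θ.apply ξ) (invDeriv X ψ) + ∫ g, θ.apply X g * ψ g ∂μ.inv = 0 := by
  obtain ⟨_, u, hu, hd⟩ := hθ
  rw [← integral_eq_flowPairing ha hh hmod hp hp' hu (hd.2.2 ξ) (hψ.invDeriv X), hd.2.2 X ψ hψ]
  ring

/-- The equations of `flowPairing_add_eq_zero_of_mem_exactForms` pass to the limit, and the flow
primitive of `θ.apply ξ` turns them back into `θ = du`. -/
lemma limitForms_le_exactForms : limitForms b μ p ≤ exactForms b μ p := by
  rintro θ ⟨⟨hθ, -⟩, η, hη, hlim⟩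
  obtain ⟨u, hu, hu'⟩ := exists_flowPrimitive ha hh hmod hp hp' (OneForm.memLp_apply hθ ξ)
  refine ⟨hθ, u, hu, isWeakDifferential_of_defect_eq_zero hp hu hθ fun X ψ hψ => ?_⟩
  have hm : ∀ X k, MemLp ((η k).apply X) p μ := fun X k => OneForm.memLp_apply (hη k).1 X
  have h1 := tendsto_eLpNorm_apply (fun k => hθ.sub (hη k).1) hp hlim
  have h2 := (tendsto_flowPairing ha hh hmod hp hp' (OneForm.memLp_apply hθ ξ) (hm ξ) (h1 ξ)
    (hψ.invDeriv X)).add (tendsto_integral_mul hp hp' (OneForm.memLp_apply hθ X) (hm X) (h1 X) hψ)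
  simp only [flowPairing_add_eq_zero_of_mem_exactForms ha hh hmod hp hp' (hη _) X hψ] at h2
  rw [defect, hu' _ (hψ.invDeriv X)]
  exact tendsto_nhds_unique h2 tendsto_const_nhds

/-- A form is not exact as soon as the defect of a primitive along the flow does not vanish. -/
lemma notMem_exactForms {θ : OneForm I G} {u : G → ℝ}
    (hu : ∀ η : G → ℝ, IsTestFunction I η →
      ∫ g, u g * η g ∂μ.inv = flowPairing a μ (θ.apply ξ) η)
    {X : GroupLieAlgebra I G} {ψ : G → ℝ} (hψ : IsTestFunction I ψ) (hd : defect μ u θ X ψ ≠ 0) :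
    θ ∉ exactForms b μ p := fun hθ => hd <| by
  rw [defect, hu _ (hψ.invDeriv X)]
  exact flowPairing_add_eq_zero_of_mem_exactForms ha hh hmod hp hp' hθ X hψ

end Cohomology

end LpCohomology

/-! ### The modular function as a trace. -/

namespace LpCohomology

section ModularFlow

open Measure

variable {E H : Type*} [NormedAddCommGroup E] [NormedSpace ℝ E] [FiniteDimensional ℝ E]
  [TopologicalSpace H] {I : ModelWithCorners ℝ E H} [I.Boundaryless]
  {G : Type*} [TopologicalSpace G] [ChartedSpace H G] [Group G] [LieGroup I ∞ G] [T2Space G]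

lemma IsTestFunction.comp_inv {ψ : G → ℝ} (hψ : IsTestFunction I ψ) :
    IsTestFunction I (fun x => ψ x⁻¹) := by
  have : IsTopologicalGroup G := topologicalGroup_of_lieGroup I ∞
  exact ⟨hψ.1.comp (contMDiff_inv I ∞), hψ.2.comp_homeomorph (Homeomorph.inv G)⟩

/-- Inversion turns a left-invariant field into minus the right-invariant one, and at a point `x`
the latter is the left-invariant field of `adInv I x X`. -/
lemma invDeriv_comp_inv {ψ : G → ℝ} (hψ : ContMDiff I 𝓘(ℝ, ℝ) ∞ ψ) (X : GroupLieAlgebra I G)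
    (g : G) : invDeriv X (fun x => ψ x⁻¹) g = -invDeriv (adInv I g⁻¹ X) ψ g⁻¹ := by
  obtain ⟨γ, hγ⟩ := exists_isOneParameter X
  have hψ' : ContMDiff I 𝓘(ℝ, ℝ) ∞ (fun x => ψ x⁻¹) := hψ.comp (contMDiff_inv I ∞)
  have h1 := ((hγ.velocity 0).mul_left g).hasDerivAt hψ'
  have hc := hγ.map (contMDiff_conjInv (I := I) g⁻¹) (conj_mul g⁻¹)
  have h2 := ((hc.velocity (-0)).mul_left g⁻¹).hasDerivAt hψ
  have h3 := h2.scomp (0 : ℝ) (hasDerivAt_neg (0 : ℝ))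
  simp only [hγ.zero, mul_one, neg_zero, inv_inv, mul_inv_cancel] at h1 h3
  have e : (fun s => ψ (g * γ s)⁻¹) =
      (fun s => ψ (g⁻¹ * (g * γ s * g⁻¹))) ∘ Neg.neg := by
    funext s
    simp only [Function.comp, hγ.neg]
    congr 1
    group
  rw [e] at h1
  have h4 := h1.unique h3
  rw [h4, smul_eq_mul, neg_one_mul, adInv_eq_homDeriv]
  simp only [inv_inv]

lemma adInv_one (X : GroupLieAlgebra I G) : adInv I (1 : G) X = X := by
  have e5 : (fun x : G => 1⁻¹ * x * 1) = id := by funext x; simp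
  rw [adInv, e5, mfderiv_id]
  rfl

lemma contMDiff_repr_adInv {ι : Type*} (b : Module.Basis ι ℝ (GroupLieAlgebra I G))
    (X : GroupLieAlgebra I G) (i : ι) :
    ContMDiff I 𝓘(ℝ, ℝ) ∞ (fun g : G => b.repr (adInv I g X) i) :=
  contMDiff_adInv (LinearMap.toContinuousLinearMap (E := E) (F' := ℝ) (b.coord i)) X

variable [IsTopologicalGroup G] [LocallyCompactSpace G] [SecondCountableTopology G]
  [MeasurableSpace G] [BorelSpace G] 

lemma integral_inv_measure (μ : Measure G) (f : G → ℝ) : ∫ g, f g ∂μ.inv = ∫ g, f g⁻¹ ∂μ := by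
  rw [Measure.inv]
  exact integral_map_equiv (MeasurableEquiv.inv G) f

lemma integral_comp_mul_right_eq (μ : Measure G) [μ.IsHaarMeasure] (f : G → ℝ) (a : G) :
    ∫ g, f (g * a) ∂μ = modularCharacterFun a * ∫ g, f g ∂μ := by
  have h1 : ∫ g, f g ∂(μ.map (· * a)) = ∫ g, f (g * a) ∂μ :=
    integral_map_equiv (MeasurableEquiv.mulRight a) f
  rw [← h1, map_mul_right_eq_smul, integral_smul_nnreal_measure]
  rfl

/-- The divergence with respect to the right Haar measure of the right-invariant vector field with
value `X` at the identity. -/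
lemma integral_invDeriv_left (μ : Measure G) [μ.IsHaarMeasure] {ι : Type*} [Fintype ι]
    (b : Module.Basis ι ℝ (GroupLieAlgebra I G)) (X : GroupLieAlgebra I G) {ψ : G → ℝ}
    (hψ : IsTestFunction I ψ) :
    ∫ g, invDeriv X (fun x => ψ x⁻¹) g ∂μ =
      ∫ g, ψ g * ∑ i, invDeriv (b i) (fun g => b.repr (adInv I g X) i) g ∂μ.inv := by
  have hF := contMDiff_repr_adInv b X
  have h1 : (fun g => invDeriv X (fun x => ψ x⁻¹) g) =
      fun g => (fun x => -∑ i, b.repr (adInv I x X) i * invDeriv (b i) ψ x) g⁻¹ := by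
    funext g
    simp only [invDeriv_comp_inv hψ.1 X g, invDeriv_eq_sum b (adInv I g⁻¹ X) ψ]
  rw [h1, ← integral_inv_measure μ
    (fun x => -∑ i, b.repr (adInv I x X) i * invDeriv (b i) ψ x), integral_neg, integral_finsetSum]
  · simp only [Finset.mul_sum]
    rw [integral_finsetSum]
    · simp only [integral_mul_invDeriv (hF _) hψ, Finset.sum_neg_distrib, neg_neg, mul_comm (ψ _)]
    · intro i _
      simpa only [mul_comm] using integrable_mul_test
        ((contMDiff_invDeriv (hF i) (b i)).continuous.locallyIntegrable (μ := μ.inv))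
        hψ.1.continuous hψ.2
  · intro i _
    exact integrable_mul_test ((hF i).continuous.locallyIntegrable (μ := μ.inv))
      (hψ.invDeriv (b i)).1.continuous (hψ.invDeriv (b i)).2

lemma sum_invDeriv_repr_adInv_one (μ : Measure G) [μ.IsHaarMeasure] {ι : Type*} [Fintype ι]
    (b : Module.Basis ι ℝ (GroupLieAlgebra I G)) (X : GroupLieAlgebra I G) (Y : GroupLieAlgebra I G) :
    ⁅X, Y⁆ = ∑ i, invDeriv Y (fun g => b.repr (adInv I g X) i) 1 • b i := by
  obtain ⟨γ, hγ⟩ := exists_isOneParameter Y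
  refine bracket_eq_of_hasDerivAt_adInv (ν := μ.inv) hγ b fun i => ?_
  have h1 := (hγ.velocity 0).hasDerivAt (contMDiff_repr_adInv b X i)
  rw [hγ.zero] at h1
  rw [b.repr_sum_self]
  exact h1

omit [IsTopologicalGroup G] [LocallyCompactSpace G] [SecondCountableTopology G]
  [MeasurableSpace G] [BorelSpace G] in
lemma exists_testFunction_apply_one :
    ∃ ψ : G → ℝ, IsTestFunction I ψ ∧ (∀ g, 0 ≤ ψ g) ∧ ψ 1 = 1 := by
  obtain ⟨f⟩ : Nonempty (SmoothBumpFunction I (1 : G)) := inferInstance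
  exact ⟨f, ⟨f.contMDiff, f.hasCompactSupport⟩, fun g => f.nonneg, f.eq_one⟩

/-- The modular function along a one-parameter subgroup. -/
lemma modularCharacterFun_isOneParameter {ι : Type*} [Fintype ι]
    (b : Module.Basis ι ℝ (GroupLieAlgebra I G)) {a : ℝ → G} {ξ : GroupLieAlgebra I G}
    (ha : IsOneParameter a ξ) (s : ℝ) :
    (modularCharacterFun (a s) : ℝ) = Real.exp ((∑ i, b.repr ⁅ξ, b i⁆ i) * s) := by
  set μ : Measure G := haar
  obtain ⟨ψ₀, hψ₀, hnonneg, hone⟩ := exists_testFunction_apply_one (I := I) (G := G)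
  have hpos : 0 < ∫ g, ψ₀ g ∂μ :=
    hψ₀.1.continuous.integral_pos_of_hasCompactSupport_nonneg_nonzero hψ₀.2 hnonneg (x := 1)
      (by simp [hone])
  set D : G → ℝ := fun g => ∑ i, invDeriv (b i) (fun g => b.repr (adInv I g ξ) i) g with hD
  have hDs : ContMDiff I 𝓘(ℝ, ℝ) ∞ D := 
    contMDiff_finsetSum fun i _ => contMDiff_invDeriv (contMDiff_repr_adInv b ξ i) (b i)
  set m : ℝ → ℝ := fun s => modularCharacterFun (a s) with hm
  have hderiv : ∀ ψ : G → ℝ, IsTestFunction I ψ → ∀ t, 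
      HasDerivAt (fun s => m s * ∫ g, ψ g ∂μ) (m t * ∫ g, invDeriv ξ ψ g ∂μ) t := by
    intro ψ hψ t
    have h1 := hasDerivAt_integral_comp_right (continuous_const.locallyIntegrable :
      LocallyIntegrable (fun _ : G => (1 : ℝ)) μ) hψ ha t
    simp only [one_mul, integral_comp_mul_right_eq] at h1
    exact h1
  -- The rate is read off from one test function; the resulting equation `m' = h m` then shows that
  -- every test function gives the same rate.
  set h : ℝ := (∫ g, invDeriv ξ ψ₀ g ∂μ) / ∫ g, ψ₀ g ∂μ with hh
  have hm' : ∀ t, HasDerivAt m (m t * h) t := fun t => by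
    have h1 := (hderiv ψ₀ hψ₀ t).div_const (∫ g, ψ₀ g ∂μ)
    simp only [mul_div_assoc, div_self hpos.ne', mul_one] at h1
    exact h1
  have hm0 : m 0 = 1 := by simp [hm, ha.zero, modularCharacterFun_map_one]
  have hint : ∀ ψ : G → ℝ, IsTestFunction I ψ → 
      ∫ g, invDeriv ξ ψ g ∂μ = h * ∫ g, ψ g ∂μ := fun ψ hψ => by
    have h1 := (hderiv ψ hψ 0).unique ((hm' 0).mul_const _)
    simpa [hm0] using h1
  -- After inversion, `h` is the divergence of a right-invariant field for right Haar measure. In a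
  -- left-invariant frame that divergence is `D`, so the smooth function `D` is weakly equal to `h`,
  -- and its value at the identity is the trace of `ad ξ`.
  have hDh : ∀ ψ : G → ℝ, IsTestFunction I ψ → ∫ g, ψ g * (D g - h) ∂μ.inv = 0 := by
    intro ψ hψ
    have h1 := hint _ hψ.comp_inv
    rw [integral_invDeriv_left μ b ξ hψ, ← integral_inv_measure μ ψ] at h1
    simp only [mul_sub]
    rw [integral_sub, integral_mul_const, h1]
    · ring
    · simpa only [mul_comm] using integrable_mul_test
        (hDs.continuous.locallyIntegrable (μ := μ.inv)) hψ.1.continuous hψ.2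
    · exact (hψ.1.continuous.integrable_of_hasCompactSupport hψ.2).mul_const h
  have hD1 : D 1 = h := by
    have hDh' : ContMDiff I 𝓘(ℝ, ℝ) ∞ (fun g => D g - h) := hDs.sub contMDiff_const
    have h1 := eq_zero_of_integral_mul_eq_zero (ν := μ.inv) (hψ₀.mul_left hDh') fun η hη => by
      rw [← hDh _ (hψ₀.mul_left hη.1)]
      exact integral_congr_ae (Eventually.of_forall fun g => by simp only; ring)
    have h2 := congrFun h1 1
    simp only [hone, mul_one, Pi.zero_apply] at h2
    linarith
  have hsum : ∑ i, b.repr ⁅ξ, b i⁆ i = h := by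
    rw [← hD1, hD]
    refine Finset.sum_congr rfl fun i _ => ?_
    rw [sum_invDeriv_repr_adInv_one μ b ξ (b i), b.repr_sum_self]
  rw [hsum]
  have hconst : ∀ t, m t * Real.exp (-(h * t)) = 1 := fun t => by
    have h2 : ∀ t, HasDerivAt (fun t => m t * Real.exp (-(h * t))) 0 t := fun t => by
      have := (hm' t).mul (((hasDerivAt_id t).const_mul h).neg.exp)
      refine this.congr_deriv ?_
      simp only [id]
      ring
    have h3 := is_const_of_deriv_eq_zero (fun t => (h2 t).differentiableAt)
      (fun t => (h2 t).deriv) t 0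
    simpa [hm0] using h3
  have h4 := hconst s
  rw [Real.exp_neg] at h4
  field_simp at h4
  exact h4

end ModularFlow

end LpCohomology

/-! ### Invariance of the defect under a flow. -/

namespace LpCohomology

section FlowInvariance

open Measure

variable {E H : Type*} [NormedAddCommGroup E] [NormedSpace ℝ E] [FiniteDimensional ℝ E]
  [TopologicalSpace H] {I : ModelWithCorners ℝ E H} [I.Boundaryless]
  {G : Type*} [TopologicalSpace G] [ChartedSpace H G] [Group G] [LieGroup I ∞ G] [T2Space G]
  [IsTopologicalGroup G] [LocallyCompactSpace G] [SecondCountableTopology G]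
  [MeasurableSpace G] [BorelSpace G]
  {ι : Type*} [Fintype ι] (b : Module.Basis ι ℝ (GroupLieAlgebra I G))
  {γ : ℝ → G} {Z : GroupLieAlgebra I G} (hγ : IsOneParameter γ Z)

include hγ

lemma adInv_flow_add (X : GroupLieAlgebra I G) (s t : ℝ) :
    adInv I (γ (-(s + t))) X = adInv I (γ (-t)) (adInv I (γ (-s)) X) := by
  rw [← adInv_mul, ← hγ.add, neg_add]

lemma adInv_neg_adInv (X : GroupLieAlgebra I G) (s : ℝ) :
    adInv I (γ s) (adInv I (γ (-s)) X) = X := by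
  rw [← adInv_mul, ← hγ.add, neg_add_cancel, hγ.zero, adInv_one]

/-- The cocycle identity `adInv_flow_add` reduces the derivative at time `s` to time 0, where the
derivative of the adjoint action is the bracket. -/
lemma hasDerivAt_repr_adInv_neg (X : GroupLieAlgebra I G) (s : ℝ) (i : ι) :
    HasDerivAt (fun s => b.repr (adInv I (γ (-s)) X) i)
      (b.repr ⁅Z, adInv I (γ (-s)) X⁆ i) s := by
  set Y := adInv I (γ (-s)) X with hY
  have h1 := (hγ.velocity 0).hasDerivAt (contMDiff_repr_adInv b Y i)
  have h2 : invDeriv Z (fun g => b.repr (adInv I g Y) i) (γ 0) = -b.repr ⁅Z, Y⁆ i := by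
    rw [← lie_skew, sum_invDeriv_repr_adInv_one (haar : Measure G) b Y Z, map_neg,
      Finsupp.neg_apply, b.repr_sum_self, neg_neg, hγ.zero]
  rw [h2] at h1
  have h3 : HasDerivAt (fun r : ℝ => s - r) (-1) s := (hasDerivAt_id s).const_sub s
  rw [← sub_self s] at h1
  have h4 := h1.scomp s h3
  simp only [smul_eq_mul, neg_mul_neg, one_mul] at h4
  refine h4.congr_of_eventuallyEq (Eventually.of_forall fun r => ?_)
  have e : -r = -(s + (r - s)) := by ring
  simp only [Function.comp, hY]
  rw [e, adInv_flow_add hγ, neg_sub]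

lemma invDeriv_adInv_neg_comp_mul_right {ψ : G → ℝ} (hψ : ContMDiff I 𝓘(ℝ, ℝ) ∞ ψ)
    (X : GroupLieAlgebra I G) (s : ℝ) (g : G) :
    invDeriv (adInv I (γ (-s)) X) (fun x => ψ (x * γ s)) g = invDeriv X ψ (g * γ s) := by
  rw [invDeriv_comp_mul_right hψ, adInv_neg_adInv hγ]

lemma invDeriv_self_comp_mul_right {ψ : G → ℝ} (hψ : ContMDiff I 𝓘(ℝ, ℝ) ∞ ψ) (s : ℝ) (g : G) :
    invDeriv Z (fun x => ψ (x * γ s)) g = invDeriv Z ψ (g * γ s) := by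
  rw [invDeriv_comp_mul_right hψ, hγ.adInv_self]

variable {μ : Measure G} [μ.IsHaarMeasure] {u : G → ℝ} (hu : LocallyIntegrable u μ.inv)
  {θ : OneForm I G} (hθ : IsWeaklyClosed μ θ)

omit hγ hu hθ in
lemma integral_apply_mul_eq_sum {ν : Measure G} {θ : OneForm I G}
    (hθ : ∀ X, LocallyIntegrable (θ.apply X) ν) (Y : GroupLieAlgebra I G) {η : G → ℝ}
    (hη : IsTestFunction I η) :
    ∫ g, θ.apply Y g * η g ∂ν = ∑ i, b.repr Y i * ∫ g, θ.apply (b i) g * η g ∂ν := by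
  simp only [OneForm.apply_eq_sum b Y, Finset.sum_mul, mul_assoc]
  rw [integral_finsetSum]
  · simp only [integral_const_mul]
  · exact fun i _ =>
      (integrable_mul_test (hθ (b i)) hη.1.continuous hη.2).const_mul (b.repr Y i)

omit hγ hθ in
include hu in
lemma defect_eq_sum (hθ : ∀ X, LocallyIntegrable (θ.apply X) μ.inv) (X : GroupLieAlgebra I G)
    {ψ : G → ℝ} (hψ : IsTestFunction I ψ) :
    defect μ u θ X ψ = ∑ i, b.repr X i * defect μ u θ (b i) ψ := by
  have h1 := integral_mul_invDeriv_eq_sum b hu hψ X 1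
  simp only [mul_one] at h1
  rw [defect, h1, integral_apply_mul_eq_sum b hθ X hψ, ← Finset.sum_add_distrib]
  simp only [defect, mul_add]

include b hu hθ

/-- The defect of a primitive of a closed form along the flow `γ` is invariant under that flow. -/
lemma defect_eq_flow (hZ : ∀ ψ, IsTestFunction I ψ → defect μ u θ Z ψ = 0)
    (X : GroupLieAlgebra I G) {ψ : G → ℝ} (hψ : IsTestFunction I ψ) (s : ℝ) :
    defect μ u θ X ψ = ∫ g, u g * invDeriv X ψ (g * γ s) ∂μ.inv +
      ∑ i, b.repr (adInv I (γ (-s)) X) i * ∫ g, θ.apply (b i) g * ψ (g * γ s) ∂μ.inv := by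
  have hsum := fun Y η (hη : IsTestFunction I η) => integral_apply_mul_eq_sum b hθ.1 Y hη
  set F : ℝ → ℝ := fun s => ∫ g, u g * invDeriv X ψ (g * γ s) ∂μ.inv +
      ∑ i, b.repr (adInv I (γ (-s)) X) i * ∫ g, θ.apply (b i) g * ψ (g * γ s) ∂μ.inv with hF
  -- This is Cartan's formula in weak form: closedness of `θ` on the pair `Z`, `adInv I (γ (-t)) X`,
  -- tested on the translate of `ψ`, combined with the vanishing of the `Z`-defect on the translate
  -- of `X ψ`.
  have hd : ∀ t, HasDerivAt F 0 t := fun t => by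
    have h1 := hasDerivAt_integral_comp_right hu (hψ.invDeriv X) hγ t
    have h2 := HasDerivAt.fun_sum (u := Finset.univ) fun i _ =>
      (hasDerivAt_repr_adInv_neg b hγ X t i).mul
        (hasDerivAt_integral_comp_right (hθ.1 (b i)) hψ hγ t)
    refine (h1.add h2).congr_deriv ?_
    have hψt := hψ.comp_mul_right (γ t)
    have c := hθ.2 Z (adInv I (γ (-t)) X) _ hψt
    have hz := hZ _ ((hψ.invDeriv X).comp_mul_right (γ t))
    simp only [defect, invDeriv_self_comp_mul_right hγ (hψ.invDeriv X).1] at hz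
    simp only [invDeriv_adInv_neg_comp_mul_right hγ hψ.1] at c
    rw [hsum _ _ (hψt.invDeriv Z), hsum _ _ hψt] at c
    simp only [invDeriv_self_comp_mul_right hγ hψ.1] at c
    rw [Finset.sum_add_distrib]
    linarith
  have h3 := is_const_of_deriv_eq_zero (fun t => (hd t).differentiableAt)
    (fun t => (hd t).deriv) 0 s
  change _ = F s
  rw [← h3, hF, defect, hsum _ _ hψ]
  simp only [hγ.zero, mul_one, neg_zero, adInv_one]

variable {p : ℝ≥0∞} (hp : 1 ≤ p) (hp' : p ≠ ⊤)

omit hγ hu hθ in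
include hp hp' in
-- The defect does not depend on `k`, while each pairing on the right tends to zero because its
-- support escapes to infinity. Bounded, rather than decaying, weights `D` and `D'` suffice, and
-- this is what reaches the critical exponent.
lemma defect_eq_zero_of_tendsto {X : GroupLieAlgebra I G} {ψ : G → ℝ} (hψ : IsTestFunction I ψ)
    (hu : MemLp u p μ) (hθ : MemLp (θ.coeff b) p μ) {gk : ℕ → G} {Xk : ℕ → GroupLieAlgebra I G}
    (hg : Tendsto gk atTop (cocompact G)) {D D' : ℝ}
    (hD : ∀ k, (modularCharacterFun (gk k)⁻¹ : ℝ) ^ (1 / p.toReal) ≤ D)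
    (hD' : ∀ i k, |b.repr (Xk k) i| * (modularCharacterFun (gk k)⁻¹ : ℝ) ^ (1 / p.toReal) ≤ D')
    (h : ∀ k, defect μ u θ X ψ = ∫ g, u g * invDeriv X ψ (g * gk k) ∂μ.inv +
      ∑ i, b.repr (Xk k) i * ∫ g, θ.apply (b i) g * ψ (g * gk k) ∂μ.inv) :
    defect μ u θ X ψ = 0 := by
  have hX := hψ.invDeriv X
  have h1 := tendsto_integral_mul_comp_right μ hp hp' hu hX.1.continuous hX.2 hg
    (r := fun _ => 1) (D := D) (by simpa using hD)
  have h2 : ∀ i, Tendsto (fun k => b.repr (Xk k) i * ∫ g, θ.apply (b i) g * ψ (g * gk k) ∂μ.inv)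
      atTop (𝓝 0) := fun i =>
    tendsto_integral_mul_comp_right μ hp hp' (OneForm.memLp_apply hθ (b i)) hψ.1.continuous hψ.2
      hg (hD' i)
  have h3 := h1.add (tendsto_finsetSum Finset.univ fun i _ => h2 i)
  simp only [one_mul, Finset.sum_const_zero, add_zero, ← h] at h3
  exact tendsto_nhds_unique tendsto_const_nhds h3

end FlowInvariance

end LpCohomology

/-! ### Exponentials of complex endomorphisms. -/

section LinearAlgebra

variable {V : Type*} [NormedAddCommGroup V] [NormedSpace ℂ V] [FiniteDimensional ℂ V]

lemma hasSum_exp_apply (T : V →L[ℂ] V) (t : ℝ) (w : V) :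
    HasSum (fun k : ℕ => (t ^ k / k ! : ℝ) • (T ^ k) w) (NormedSpace.exp (t • T) w) := by
  have : CompleteSpace V := FiniteDimensional.complete ℂ V
  have h1 := NormedSpace.exp_series_hasSum_exp' (𝕂 := ℝ) (t • T)
  have h2 := h1.mapL ((ContinuousLinearMap.apply ℂ V w).restrictScalars ℝ)
  have e : (fun k : ℕ => (t ^ k / k ! : ℝ) • (T ^ k) w) = fun k : ℕ =>
      ((ContinuousLinearMap.apply ℂ V w).restrictScalars ℝ) ((k !⁻¹ : ℝ) • (t • T) ^ k) := by
    funext k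
    rw [smul_pow, smul_smul, map_smul, div_eq_inv_mul]
    rfl
  rw [e]
  exact h2

lemma exp_apply_of_eigenvector {T : V →L[ℂ] V} {w : V} {z : ℂ} (h : T w = z • w) (t : ℝ) :
    NormedSpace.exp (t • T) w = Complex.exp (t * z) • w := by
  have hk : ∀ k : ℕ, (T ^ k) w = z ^ k • w := fun k => by
    induction k with
    | zero => simp
    | succ k ih => rw [pow_succ, mul_apply_eq_comp, h, map_smul, ih, smul_smul, pow_succ,
        mul_comm]
  refine (hasSum_exp_apply T t w).unique ?_
  have h1 := NormedSpace.expSeries_div_hasSum_exp (t * z : ℂ)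
  rw [← Complex.exp_eq_exp_ℂ] at h1
  have h2 := h1.smul_const w
  have e : (fun k : ℕ => (t ^ k / k ! : ℝ) • (T ^ k) w) =
      fun k : ℕ => (((t : ℂ) * z) ^ k / k !) • w := by
    funext k
    rw [hk, ← Complex.coe_smul, smul_smul]
    congr 1
    push_cast
    ring
  rw [e]
  exact h2

/-- `T` commutes with its exponential, so it preserves the eigenspace and has an eigenvector there,
on which the exponential can be computed. -/
lemma exists_eigenvalue_of_mem_spectrum_exp (T : V →L[ℂ] V) {z : ℂ}
    (hz : z ∈ spectrum ℂ (NormedSpace.exp T)) :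
    ∃ y : ℂ, Module.End.HasEigenvalue (T : Module.End ℂ V) y ∧ z = Complex.exp y := by
  have : CompleteSpace V := FiniteDimensional.complete ℂ V
  set c := NormedSpace.exp T with hc
  have h1 : Module.End.HasEigenvalue (c : Module.End ℂ V) z := by
    rw [Module.End.hasEigenvalue_iff_mem_spectrum]
    have h2 := AlgEquiv.spectrum_eq (Module.End.toContinuousLinearMap (𝕜 := ℂ) V) 
      (c : Module.End ℂ V)
    rw [← h2]
    exact hz
  have hcomm : Commute T c := (Commute.refl T).exp_right
  set W := Module.End.eigenspace (c : Module.End ℂ V) z with hW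
  have hinv : ∀ w ∈ W, (T : Module.End ℂ V) w ∈ W := fun w hw => by
    rw [hW, Module.End.mem_eigenspace_iff] at hw ⊢
    have h3 : c (T w) = T (c w) := congrArg (fun S : V →L[ℂ] V => S w) hcomm.eq.symm
    change c w = z • w at hw
    change c (T w) = z • T w
    rw [h3, hw, map_smul]
  have : Nontrivial W := Submodule.nontrivial_iff_ne_bot.2 h1
  obtain ⟨y, hy⟩ := Module.End.exists_eigenvalue ((T : Module.End ℂ V).restrict hinv)
  obtain ⟨w, hw⟩ := hy.exists_hasEigenvector
  have hw0 : (w : V) ≠ 0 := fun h => hw.2 (Subtype.ext h)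
  have hTw : T (w : V) = y • (w : V) := congrArg Subtype.val hw.apply_eq_smul
  refine ⟨y, Module.End.hasEigenvalue_of_hasEigenvector (x := (w : V)) 
    ⟨Module.End.mem_eigenspace_iff.2 hTw, hw0⟩, ?_⟩
  have h4 := exp_apply_of_eigenvector hTw 1
  rw [one_smul, Complex.ofReal_one, one_mul] at h4
  have h5 : c (w : V) = z • (w : V) := Module.End.mem_eigenspace_iff.1 w.2
  rw [← hc, h5] at h4
  exact smul_left_injective ℂ hw0 h4

/-- Exponential decay when the spectrum lies in a half plane. -/
lemma exists_norm_exp_le [Nontrivial V] (T : V →L[ℂ] V) {r : ℝ}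
    (h : ∀ y : ℂ, Module.End.HasEigenvalue (T : Module.End ℂ V) y → r < y.re) :
    ∃ C : ℝ, ∀ n : ℕ, ‖NormedSpace.exp ((-n : ℝ) • T)‖ ≤ C * Real.exp (-r * n) := by
  have : CompleteSpace V := FiniteDimensional.complete ℂ V
  set c := NormedSpace.exp (-T) with hc
  have hpow : ∀ n : ℕ, NormedSpace.exp ((-n : ℝ) • T) = c ^ n := fun n => by
    let := NormedAlgebra.restrictScalars ℚ ℂ (V →L[ℂ] V)
    rw [hc, ← NormedSpace.exp_nsmul, neg_smul, smul_neg, Nat.cast_smul_eq_nsmul]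
  -- The eigenvalues of `exp (-T)` have modulus `exp (-Re y)` with `y` an eigenvalue of `T`.
  -- Gelfand's formula then bounds the norms of large powers, and the finitely many others are
  -- absorbed in `C`.
  have hrad : spectralRadius ℂ c < (Real.toNNReal (Real.exp (-r)) : ℝ≥0∞) := by
    refine spectrum.spectralRadius_lt_of_forall_lt c fun z hz => ?_
    obtain ⟨y, hy, rfl⟩ := exists_eigenvalue_of_mem_spectrum_exp (-T) hz
    obtain ⟨w, hw⟩ := hy.exists_hasEigenvector
    have hw1 : T w = (-y) • w := by
      have := hw.apply_eq_smul
      change -(T w) = y • w at this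
      rw [neg_smul, ← this, neg_neg]
    have h1 := h (-y) (Module.End.hasEigenvalue_of_hasEigenvector (x := w)
      ⟨Module.End.mem_eigenspace_iff.2 hw1, hw.2⟩)
    rw [← NNReal.coe_lt_coe, coe_nnnorm, Complex.norm_exp, Real.coe_toNNReal _ (Real.exp_pos _).le]
    rw [Complex.neg_re] at h1
    exact Real.exp_lt_exp.2 (by linarith)
  have h2 := (spectrum.pow_norm_pow_one_div_tendsto_nhds_spectralRadius c).eventually_lt_const hrad
  have h3 : ∀ᶠ n : ℕ in atTop, ‖c ^ n‖ * Real.exp (r * n) ≤ 1 := by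
    filter_upwards [h2, eventually_gt_atTop 0] with n hn hn0
    have h4 : ‖c ^ n‖ ^ (1 / n : ℝ) < Real.exp (-r) :=
      (ENNReal.ofReal_lt_ofReal_iff (Real.exp_pos _)).1 hn
    have h5 := Real.rpow_le_rpow (by positivity) h4.le (Nat.cast_nonneg n)
    rw [← Real.rpow_mul (norm_nonneg _), one_div_mul_cancel (by positivity), Real.rpow_one,
      ← Real.exp_mul] at h5
    calc ‖c ^ n‖ * Real.exp (r * n) ≤ Real.exp (-r * n) * Real.exp (r * n) := by gcongr
      _ = 1 := by rw [← Real.exp_add]; simp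
  obtain ⟨C, hC⟩ := (isBoundedUnder_of_eventually_le h3).bddAbove_range
  refine ⟨C, fun n => ?_⟩
  rw [hpow]
  have h6 : ‖c ^ n‖ * Real.exp (r * n) ≤ C := hC ⟨n, rfl⟩
  rwa [neg_mul, Real.exp_neg, ← div_eq_mul_inv, le_div_iff₀ (Real.exp_pos _)]

end LinearAlgebra

/-! ### Growth of real exponentials through complexified coordinates. -/

section Complexification

variable {W : Type*} [AddCommGroup W] [Module ℝ W] [TopologicalSpace W] [IsTopologicalAddGroup W]
  [ContinuousSMul ℝ W] [T2Space W] [FiniteDimensional ℝ W] {d : ℕ} (e : Module.Basis (Fin d) ℝ W) (α : W →ₗ[ℝ] W)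

/-- The complexification of a real endomorphism, in coordinates. -/
def complexify : (Fin d → ℂ) →L[ℂ] (Fin d → ℂ) :=
  LinearMap.toContinuousLinearMap
    (Matrix.toLin' ((LinearMap.toMatrix e e α).map (algebraMap ℝ ℂ)))

lemma complexify_re (w : Fin d → ℂ) :
    e.equivFun.symm (fun i => (complexify e α w i).re) = α (e.equivFun.symm fun i => (w i).re) := by
  refine e.equivFun.injective ?_
  rw [LinearEquiv.apply_symm_apply]
  have h1 : e.equivFun (α (e.equivFun.symm fun i => (w i).re)) =
      (LinearMap.toMatrix e e α).mulVec fun i => (w i).re := by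
    have := LinearMap.toMatrix_mulVec_repr e e α (e.equivFun.symm fun i => (w i).re)
    have h2 : (e.repr (e.equivFun.symm fun i => (w i).re) : Fin d → ℝ) = fun i => (w i).re :=
      e.equivFun.apply_symm_apply _
    rw [h2] at this
    exact this.symm
  rw [h1]
  funext i
  simp [complexify, Matrix.mulVec, dotProduct, Complex.re_sum]

lemma complexify_pow_re (w : Fin d → ℂ) (k : ℕ) :
    e.equivFun.symm (fun i => ((complexify e α ^ k) w i).re) =
      (α ^ k) (e.equivFun.symm fun i => (w i).re) := by
  induction k with
  | zero => simp
  | succ k ih =>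
    have h1 : (complexify e α ^ (k + 1)) w = complexify e α ((complexify e α ^ k) w) := by
      rw [pow_succ', mul_apply_eq_comp]
    rw [h1, complexify_re, ih, pow_succ', Module.End.mul_apply]

/-- The exponential of a real endomorphism in complexified coordinates. -/
lemma repr_eq_exp_complexify_re {w : Fin d → ℂ} {t : ℝ} {M : W}
    (h : HasSum (fun k : ℕ => (t ^ k / k ! : ℝ) • (α ^ k) (e.equivFun.symm fun i => (w i).re)) M)
    (i : Fin d) : e.repr M i = (NormedSpace.exp (t • complexify e α) w i).re := by
  have h1 : HasSum (fun k : ℕ => (t ^ k / k ! : ℝ) * ((complexify e α ^ k) w i).re)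
      (e.repr M i) := by
    have h2 := h.map (e.coord i) (LinearMap.continuous_of_finiteDimensional (e.coord i))
    convert! h2 using 1
    funext k
    rw [Function.comp, map_smul, ← complexify_pow_re, smul_eq_mul]
    congr 1
    exact (congrFun (e.equivFun.apply_symm_apply fun i => ((complexify e α ^ k) w i).re) i).symm
  have h3 := (hasSum_exp_apply (complexify e α) t w).map
    (Complex.reLm ∘ₗ (LinearMap.proj i : (Fin d → ℂ) →ₗ[ℝ] ℂ))
    (LinearMap.continuous_of_finiteDimensional _)
  refine h1.unique ?_
  convert! h3 using 1
  funext k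
  change _ = (((t ^ k / k ! : ℝ) • (complexify e α ^ k) w) i).re
  rw [Pi.smul_apply, Complex.real_smul, Complex.re_ofReal_mul]

variable {e α} {lam : Fin d → ℝ}
  (heig : ((α.charpoly.map (algebraMap ℝ ℂ)).roots.map Complex.re) = Finset.univ.val.map lam)

lemma charpoly_complexify :
    ((complexify e α : Module.End ℂ (Fin d → ℂ))).charpoly = α.charpoly.map (algebraMap ℝ ℂ) := by
  change (Matrix.toLin' ((LinearMap.toMatrix e e α).map (algebraMap ℝ ℂ))).charpoly = _
  rw [Matrix.charpoly_toLin', Matrix.charpoly_map, LinearMap.charpoly_toMatrix]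

include heig

lemma exists_re_eq_of_hasEigenvalue {y : ℂ}
    (h : Module.End.HasEigenvalue (complexify e α : Module.End ℂ (Fin d → ℂ)) y) :
    ∃ i, y.re = lam i := by
  rw [Module.End.hasEigenvalue_iff_isRoot_charpoly, charpoly_complexify] at h
  have h1 : y.re ∈ (α.charpoly.map (algebraMap ℝ ℂ)).roots.map Complex.re :=
    Multiset.mem_map_of_mem _ ((Polynomial.mem_roots
      (Polynomial.map_ne_zero α.charpoly_monic.ne_zero)).2 h)
  rw [heig] at h1
  obtain ⟨i, -, hi⟩ := Multiset.mem_map.1 h1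
  exact ⟨i, hi.symm⟩

lemma exists_hasEigenvalue_re_eq (i : Fin d) :
    ∃ y : ℂ, Module.End.HasEigenvalue (complexify e α : Module.End ℂ (Fin d → ℂ)) y ∧
      y.re = lam i := by
  have h1 : lam i ∈ Finset.univ.val.map lam := Multiset.mem_map_of_mem _ (Finset.mem_univ i)
  rw [← heig] at h1
  obtain ⟨y, hy, hi⟩ := Multiset.mem_map.1 h1
  refine ⟨y, ?_, hi⟩
  rw [Module.End.hasEigenvalue_iff_isRoot_charpoly, charpoly_complexify]
  exact Polynomial.isRoot_of_mem_roots hy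

lemma trace_eq_sum : ∑ i, e.repr (α (e i)) i = ∑ i, lam i := by
  have h1 := Matrix.trace_eq_sum_roots_charpoly ((LinearMap.toMatrix e e α).map (algebraMap ℝ ℂ))
  rw [Matrix.charpoly_map, LinearMap.charpoly_toMatrix] at h1
  have h2 := congrArg Complex.re h1
  have h3 : (α.charpoly.map (algebraMap ℝ ℂ)).roots.sum.re =
      ((α.charpoly.map (algebraMap ℝ ℂ)).roots.map Complex.re).sum :=
    map_multiset_sum Complex.reAddGroupHom _
  rw [h3, heig] at h2
  change _ = ∑ i, lam i at h2
  simpa [Matrix.trace, LinearMap.toMatrix_apply, Complex.re_sum] using h2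

/-- Contraction in negative time. -/
lemma exists_abs_repr_le_of_lt [NeZero d] (hmono : Monotone lam) {r : ℝ} (hr : r < lam 0) :
    ∃ C : ℝ, ∀ (n : ℕ) (X M : W), HasSum (fun k : ℕ => ((-n : ℝ) ^ k / k ! : ℝ) • (α ^ k) X) M →
      ∀ i, |e.repr M i| ≤ C * Real.exp (-r * n) * ∑ j, |e.repr X j| := by
  obtain ⟨C, hC⟩ := exists_norm_exp_le (complexify e α) (r := r) fun y hy => by
    obtain ⟨i, hi⟩ := exists_re_eq_of_hasEigenvalue heig hy
    rw [hi]
    exact hr.trans_le (hmono (Fin.zero_le i))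
  refine ⟨C, fun n X M h i => ?_⟩
  set w : Fin d → ℂ := fun i => (e.repr X i : ℂ) with hw
  have hX : X = e.equivFun.symm fun i => (w i).re := by
    simp only [hw, Complex.ofReal_re]
    exact (e.equivFun.symm_apply_apply X).symm
  rw [hX] at h
  rw [repr_eq_exp_complexify_re e α h i]
  have hwn : ‖w‖ ≤ ∑ j, |e.repr X j| := by
    refine (pi_norm_le_iff_of_nonneg (Finset.sum_nonneg fun _ _ => abs_nonneg _)).2 fun j => ?_
    rw [hw, Complex.norm_real, Real.norm_eq_abs]
    exact Finset.single_le_sum (f := fun j => |e.repr X j|) (fun _ _ => abs_nonneg _)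
      (Finset.mem_univ j)
  calc |(NormedSpace.exp ((-n : ℝ) • complexify e α) w i).re|
      ≤ ‖NormedSpace.exp ((-n : ℝ) • complexify e α) w i‖ := Complex.abs_re_le_norm _
    _ ≤ ‖NormedSpace.exp ((-n : ℝ) • complexify e α) w‖ := norm_le_pi_norm _ i
    _ ≤ ‖NormedSpace.exp ((-n : ℝ) • complexify e α)‖ * ‖w‖ := ContinuousLinearMap.le_opNorm _ _
    _ ≤ (C * Real.exp (-r * n)) * ∑ j, |e.repr X j| := by
        refine mul_le_mul (hC n) hwn (norm_nonneg _) ((norm_nonneg _).trans (hC n))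

/-- There is a vector of slowest growth. -/
lemma exists_ne_zero_abs_repr_le (i₀ : Fin d) :
    ∃ (Y : W) (C : ℝ), Y ≠ 0 ∧ ∀ (t : ℝ) (M : W),
      HasSum (fun k : ℕ => (t ^ k / k ! : ℝ) • (α ^ k) Y) M →
      ∀ i, |e.repr M i| ≤ C * Real.exp (lam i₀ * t) := by
  obtain ⟨y, hy, hyi⟩ := exists_hasEigenvalue_re_eq (e := e) heig i₀
  obtain ⟨w, hw⟩ := hy.exists_hasEigenvector
  -- A genuine eigenvector is used, not a generalised one, so the bound has no polynomial factor and
  -- holds for positive and negative `t`.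
  have key : ∀ w' : Fin d → ℂ, complexify e α w' = y • w' → (fun i => (w' i).re) ≠ 0 →
      ∃ (Y : W) (C : ℝ), Y ≠ 0 ∧ ∀ (t : ℝ) (M : W),
      HasSum (fun k : ℕ => (t ^ k / k ! : ℝ) • (α ^ k) Y) M →
      ∀ i, |e.repr M i| ≤ C * Real.exp (lam i₀ * t) := by
    intro w' hw' h0
    refine ⟨e.equivFun.symm fun i => (w' i).re, ‖w'‖, fun h => h0 ?_, fun t M hM i => ?_⟩
    · exact e.equivFun.symm.map_eq_zero_iff.1 h
    · rw [repr_eq_exp_complexify_re e α hM i, exp_apply_of_eigenvector hw']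
      refine (Complex.abs_re_le_norm _).trans ?_
      rw [Pi.smul_apply, norm_smul, Complex.norm_exp, Complex.re_ofReal_mul, hyi, mul_comm t,
        mul_comm ‖w'‖]
      gcongr
      exact norm_le_pi_norm w' i
  have hwy : complexify e α w = y • w := hw.apply_eq_smul
  -- If the real part of the eigenvector vanishes, that of `i w` does not, and `i w` has the same
  -- eigenvalue.
  by_cases h0 : (fun i => (w i).re) = 0
  · refine key (Complex.I • w) (by rw [map_smul, hwy, smul_comm]) fun h1 => hw.2 ?_
    funext i
    have h2 := congrFun h0 i
    have h3 := congrFun h1 i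
    simp at h2 h3
    exact Complex.ext h2 h3
  · exact key w hwy h0

end Complexification

/-! ### Recognising one-parameter subgroups by their velocity at time 0. -/

namespace LpCohomology

section Velocity

variable {E H : Type*} [NormedAddCommGroup E] [NormedSpace ℝ E] [FiniteDimensional ℝ E]
  [TopologicalSpace H] {I : ModelWithCorners ℝ E H} [I.Boundaryless]
  {G : Type*} [TopologicalSpace G] [ChartedSpace H G] [Group G] [LieGroup I ∞ G] [T2Space G]

lemma mulInvariantVectorField_of_eq_one (X : GroupLieAlgebra I G) {g : G} (hg : g = 1) :
    (mulInvariantVectorField X g : E) = X := by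
  subst hg
  have e : (fun x : G => 1 * x) = id := by funext x; simp
  change (mfderiv I I (fun x : G => 1 * x) 1 X : E) = X
  rw [e, mfderiv_id]
  rfl

lemma hasVelocityAt_of_hasMFDerivAt {c : ℝ → G} (h0 : c 0 = 1) {L : ℝ →L[ℝ] E}
    (h : HasMFDerivAt 𝓘(ℝ, ℝ) I c 0 L) : HasVelocityAt (I := I) c (L 1 : E) 0 := by
  refine h.congr_mfderiv ?_
  ext
  have h1 := mulInvariantVectorField_of_eq_one (I := I) (L 1 : E) h0
  have h5 : ((1 : ℝ →L[ℝ] ℝ).smulRight (mulInvariantVectorField (L 1 : E) (c 0))) 1 =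
    mulInvariantVectorField (I := I) (L 1 : E) (c 0) := one_smul ℝ _
  exact (h5.trans h1).symm

lemma exists_hasVelocityAt {c : ℝ → G} (hc : ContMDiff 𝓘(ℝ, ℝ) I ∞ c) (h0 : c 0 = 1) :
    ∃ X : GroupLieAlgebra I G, HasVelocityAt c X 0 :=
  ⟨_, hasVelocityAt_of_hasMFDerivAt h0 (hc.mdifferentiableAt (by simp)).hasMFDerivAt⟩

lemma HasVelocityAt.comp_sub {c : ℝ → G} {X : GroupLieAlgebra I G} (h : HasVelocityAt c X 0)
    (t : ℝ) : HasVelocityAt (fun s => c (s - t)) X t := by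
  have h1 : HasMFDerivAt 𝓘(ℝ, ℝ) 𝓘(ℝ, ℝ) (fun s : ℝ => s - t) t (ContinuousLinearMap.id ℝ ℝ) :=
    hasMFDerivAt_iff_hasFDerivAt.2 ((hasFDerivAt_id t).sub_const t)
  have h' : ∀ r, r = 0 → HasVelocityAt c X r := fun r hr => hr ▸ h
  have h2 := HasMFDerivAt.comp (I' := 𝓘(ℝ, ℝ)) (f := fun s : ℝ => s - t) t (h' _ (sub_self t)) h1
  refine h2.congr_mfderiv ?_
  ext
  rfl

lemma isOneParameter_of_hasVelocityAt_zero {γ : ℝ → G} {X : GroupLieAlgebra I G}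
    (h0 : γ 0 = 1) (hadd : ∀ s t, γ (s + t) = γ s * γ t) (h : HasVelocityAt γ X 0) :
    IsOneParameter γ X := by
  refine ⟨h0, hadd, fun t => ?_⟩
  have h1 := (HasVelocityAt.comp_sub h t).mul_left (γ t)
  have e : (fun s => γ t * γ (s - t)) = γ := by
    funext s
    rw [← hadd, add_sub_cancel]
  rwa [e] at h1

lemma IsOneParameter.unique {γ : ℝ → G} {X Y : GroupLieAlgebra I G} (hX : IsOneParameter γ X)
    (hY : IsOneParameter γ Y) : X = Y :=
  (hX.velocity 0).unique hX.zero (hY.velocity 0)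

end Velocity

end LpCohomology

/-! ### The two factors of the semidirect product and their adjoint actions. -/

namespace SemidirectLine

open LpCohomology

variable {E H : Type*} [NormedAddCommGroup E] [NormedSpace ℝ E] [FiniteDimensional ℝ E]
  [TopologicalSpace H] {I : ModelWithCorners ℝ E H} [I.Boundaryless]
  {N : Type*} [TopologicalSpace N] [ChartedSpace H N] [Group N] [LieGroup I ∞ N] [T2Space N]
  {α : GroupLieAlgebra I N →ₗ[ℝ] GroupLieAlgebra I N} (A : IntegratedAction α)

instance [SecondCountableTopology N] : SecondCountableTopology (SemidirectLine A) :=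
  inferInstanceAs (SecondCountableTopology (N × ℝ))

/-- The automorphism of `N` at time `t`. -/
def act (t : ℝ) (x : N) : N := A.hom (Multiplicative.ofAdd t) x

lemma contMDiff_act (t : ℝ) : ContMDiff I I ∞ (act A t) :=
  A.smooth.comp (contMDiff_const.prodMk contMDiff_id)

lemma contMDiff_act_flip (x : N) : ContMDiff 𝓘(ℝ, ℝ) I ∞ (fun t => act A t x) :=
  A.smooth.comp (contMDiff_id.prodMk contMDiff_const)

lemma act_mul (t : ℝ) (x y : N) : act A t (x * y) = act A t x * act A t y := map_mul _ x y

lemma act_one (t : ℝ) : act A t 1 = 1 := map_one _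

lemma act_inv (t : ℝ) (x : N) : act A t x⁻¹ = (act A t x)⁻¹ := map_inv _ x

lemma act_zero (x : N) : act A 0 x = x := by simp [act]

lemma act_add (s t : ℝ) (x : N) : act A (s + t) x = act A s (act A t x) := by
  simp [act, ofAdd_add]

/-- The inclusion of the normal factor. -/
def incl (x : N) : SemidirectLine A := (x, (0 : ℝ))

/-- The one-parameter subgroup of the second factor. -/
def line (s : ℝ) : SemidirectLine A := ((1 : N), s)

lemma contMDiff_incl : ContMDiff I (I.prod 𝓘(ℝ, ℝ)) ∞ (incl A) :=
  contMDiff_id.prodMk contMDiff_const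

lemma incl_mul (x y : N) : incl A (x * y) = incl A x * incl A y := by
  rw [mul_def]
  simp [incl]
  rfl

lemma incl_one : incl A 1 = 1 := rfl

lemma line_add (s t : ℝ) : line A (s + t) = line A s * line A t := by
  rw [mul_def]
  simp [line]
  rfl

lemma line_neg (s : ℝ) : line A (-s) = (line A s)⁻¹ := by
  rw [eq_inv_iff_mul_eq_one, ← line_add, neg_add_cancel]
  rfl

/-- This fixes the sign: `adInv` conjugates by the inverse, so time `-s` on the line acts on `N` by
`φ_s`. -/
lemma line_conj (s : ℝ) (x : N) : (line A (-s))⁻¹ * incl A x * line A (-s) = incl A (act A s x) := by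
  rw [← line_neg, neg_neg, mul_def, mul_def]
  simp [line, incl, act]
  rfl

/-- The direction of the second factor. -/
def lineVec : GroupLieAlgebra (I.prod 𝓘(ℝ, ℝ)) (SemidirectLine A) := ((0, 1) : E × ℝ)

lemma isOneParameter_line : IsOneParameter (line A) (lineVec A) := by
  refine isOneParameter_of_hasVelocityAt_zero rfl (line_add A) ?_
  have h1 : HasMFDerivAt 𝓘(ℝ, ℝ) (I.prod 𝓘(ℝ, ℝ)) (fun s : ℝ => ((1 : N), s)) 0
      ((0 : ℝ →L[ℝ] E).prod (ContinuousLinearMap.id ℝ ℝ)) :=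
    (hasMFDerivAt_const (1 : N) (0 : ℝ)).prodMk (hasMFDerivAt_id (0 : ℝ))
  exact hasVelocityAt_of_hasMFDerivAt (I := I.prod 𝓘(ℝ, ℝ)) (G := SemidirectLine A)
    (c := line A) (L := (0 : ℝ →L[ℝ] E).prod (ContinuousLinearMap.id ℝ ℝ)) rfl h1

/-- The inclusion of the Lie algebra of the normal factor. -/
def inclVec : GroupLieAlgebra I N →ₗ[ℝ] GroupLieAlgebra (I.prod 𝓘(ℝ, ℝ)) (SemidirectLine A) :=
  homDeriv I (I.prod 𝓘(ℝ, ℝ)) (incl A)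

lemma inclVec_apply (X : GroupLieAlgebra I N) : (inclVec A X : E × ℝ) = ((X : E), (0 : ℝ)) := by
  have h1 : HasMFDerivAt I (I.prod 𝓘(ℝ, ℝ)) (fun x : N => (x, (0 : ℝ))) 1
      ((ContinuousLinearMap.id ℝ E).prod (0 : E →L[ℝ] ℝ)) :=
    (hasMFDerivAt_id (1 : N)).prodMk (hasMFDerivAt_const (0 : ℝ) (1 : N))
  exact congrArg (fun L => L X) h1.mfderiv

lemma isOneParameter_incl {γ : ℝ → N} {X : GroupLieAlgebra I N} (hγ : IsOneParameter γ X) :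
    IsOneParameter (fun t => incl A (γ t)) (inclVec A X) :=
  hγ.map (contMDiff_incl A) (incl_mul A)

/-- The differential of the action. -/
def actVec (t : ℝ) : GroupLieAlgebra I N →ₗ[ℝ] GroupLieAlgebra I N := homDeriv I I (act A t)

lemma hasSum_actVec (t : ℝ) (X : GroupLieAlgebra I N) :
    HasSum (fun k : ℕ => (t ^ k / k ! : ℝ) • (α ^ k) X) (actVec A t X) := A.hasSum_exp t X

lemma isOneParameter_act {γ : ℝ → N} {X : GroupLieAlgebra I N} (hγ : IsOneParameter γ X) (t : ℝ) :
    IsOneParameter (fun s => act A t (γ s)) (actVec A t X) :=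
  hγ.map (contMDiff_act A t) (act_mul A t)

/-- Both sides generate the same one-parameter subgroup. -/
lemma actVec_add (s t : ℝ) (X : GroupLieAlgebra I N) :
    actVec A (s + t) X = actVec A s (actVec A t X) := by
  obtain ⟨γ, hγ⟩ := exists_isOneParameter X
  have h1 := isOneParameter_act A hγ (s + t)
  have h2 := isOneParameter_act A (isOneParameter_act A hγ t) s
  simp only [act_add] at h1
  exact h1.unique h2

/-- The adjoint action of the second factor. -/
lemma adInv_line_neg (s : ℝ) (X : GroupLieAlgebra I N) :
    adInv (I.prod 𝓘(ℝ, ℝ)) (line A (-s)) (inclVec A X) = inclVec A (actVec A s X) := by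
  obtain ⟨γ, hγ⟩ := exists_isOneParameter X
  have h1 := (isOneParameter_incl A hγ).map (contMDiff_conjInv (I := I.prod 𝓘(ℝ, ℝ))
    (line A (-s))) (conj_mul (line A (-s)))
  have h2 := isOneParameter_incl A (isOneParameter_act A hγ s)
  simp only [line_conj] at h1
  exact h1.unique h2

lemma adInv_incl (x : N) (X : GroupLieAlgebra I N) :
    adInv (I.prod 𝓘(ℝ, ℝ)) (incl A x) (inclVec A X) = inclVec A (adInv I x X) := by
  obtain ⟨γ, hγ⟩ := exists_isOneParameter X
  have h1 := (isOneParameter_incl A hγ).map (contMDiff_conjInv (I := I.prod 𝓘(ℝ, ℝ))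
    (incl A x)) (conj_mul (incl A x))
  have h2 := isOneParameter_incl A (hγ.map (contMDiff_conjInv (I := I) x) (conj_mul x))
  have hinv : (incl A x)⁻¹ = incl A x⁻¹ := by
    rw [inv_eq_iff_mul_eq_one, ← incl_mul, mul_inv_cancel, incl_one]
  rw [← adInv_eq_homDeriv] at h1
  simp only [hinv, ← incl_mul] at h1
  rw [← adInv_eq_homDeriv] at h2
  exact h1.unique h2

section Basis

variable {d : ℕ} (e : Module.Basis (Fin d) ℝ (GroupLieAlgebra I N))

/-- The basis of the Lie algebra of the semidirect product adapted to the factors. -/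
def basis : Module.Basis (Fin d ⊕ Unit) ℝ
    (GroupLieAlgebra (I.prod 𝓘(ℝ, ℝ)) (SemidirectLine A)) :=
  (Module.Basis.prod e (Module.Basis.singleton Unit ℝ) :
    Module.Basis (Fin d ⊕ Unit) ℝ (GroupLieAlgebra I N × ℝ))

lemma basis_inl (i : Fin d) : basis A e (Sum.inl i) = inclVec A (e i) := by
  refine Eq.trans ?_ (inclVec_apply A (e i)).symm
  change (Module.Basis.prod e (Module.Basis.singleton Unit ℝ)) (Sum.inl i) = (e i, (0 : ℝ))
  ext <;> simp

lemma basis_inr : basis A e (Sum.inr ()) = lineVec A := by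
  change (Module.Basis.prod e (Module.Basis.singleton Unit ℝ)) (Sum.inr ()) =
    ((0 : GroupLieAlgebra I N), (1 : ℝ))
  ext <;> simp

lemma basis_repr_inclVec_inl (X : GroupLieAlgebra I N) (i : Fin d) :
    (basis A e).repr (inclVec A X) (Sum.inl i) = e.repr X i := by
  have h : inclVec A X = ∑ j, e.repr X j • basis A e (Sum.inl j) := by
    conv_lhs => rw [← e.sum_repr X, map_sum]
    simp only [map_smul, basis_inl]
  rw [h, map_sum]
  simp [Finsupp.single_apply]

lemma basis_repr_inclVec_inr (X : GroupLieAlgebra I N) :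
    (basis A e).repr (inclVec A X) (Sum.inr ()) = 0 := by
  have h : inclVec A X = ∑ j, e.repr X j • basis A e (Sum.inl j) := by
    conv_lhs => rw [← e.sum_repr X, map_sum]
    simp only [map_smul, basis_inl]
  rw [h, map_sum]
  simp

end Basis

end SemidirectLine

section Complexification

variable {W : Type*} [AddCommGroup W] [Module ℝ W] [TopologicalSpace W] [IsTopologicalAddGroup W]
  [ContinuousSMul ℝ W] [T2Space W] [FiniteDimensional ℝ W] {d : ℕ} (e : Module.Basis (Fin d) ℝ W)
  (α : W →ₗ[ℝ] W)

lemma exists_complexification (X : W) : ∃ w : Fin d → ℂ, X = e.equivFun.symm fun i => (w i).re := by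
  refine ⟨fun i => (e.repr X i : ℂ), ?_⟩
  simp only [Complex.ofReal_re]
  exact (e.equivFun.symm_apply_apply X).symm

/-- The sum of the series is the real part of an operator exponential in complexified coordinates,
whose derivative at 0 is the operator itself. -/
lemma hasDerivAt_repr_of_hasSum {M : ℝ → W} {X : W}
    (h : ∀ t, HasSum (fun k : ℕ => (t ^ k / k ! : ℝ) • (α ^ k) X) (M t)) (i : Fin d) :
    HasDerivAt (fun t => e.repr (M t) i) (e.repr (α X) i) 0 := by
  obtain ⟨w, rfl⟩ := exists_complexification e X
  simp only [fun t => repr_eq_exp_complexify_re e α (h t) i]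
  have h1 := hasDerivAt_exp_smul_const (𝕂 := ℝ) (complexify e α) (0 : ℝ)
  rw [zero_smul, NormedSpace.exp_zero, one_mul] at h1
  have h2 : HasDerivAt (fun t : ℝ => NormedSpace.exp (t • complexify e α) w)
      (complexify e α w) 0 := by
    let L : ((Fin d → ℂ) →L[ℂ] (Fin d → ℂ)) →L[ℝ] (Fin d → ℂ) :=
      (ContinuousLinearMap.apply ℂ (Fin d → ℂ) w).restrictScalars ℝ
    exact L.hasFDerivAt.comp_hasDerivAt (0 : ℝ) h1
  have h3 := Complex.reCLM.hasFDerivAt.comp_hasDerivAt (0 : ℝ) (hasDerivAt_pi.1 h2 i)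
  have h4 := complexify_re e α w
  rw [← h4]
  have h5 : e.repr (e.equivFun.symm fun i => (complexify e α w i).re) i =
      (complexify e α w i).re := congrFun (e.equivFun.apply_symm_apply _) i
  rw [h5]
  exact h3

end Complexification

/-! ### The modular function along the second factor. -/

namespace SemidirectLine

open LpCohomology

variable {E H : Type*} [NormedAddCommGroup E] [NormedSpace ℝ E] [FiniteDimensional ℝ E]
  [TopologicalSpace H] {I : ModelWithCorners ℝ E H} [I.Boundaryless]
  {N : Type*} [TopologicalSpace N] [ChartedSpace H N] [Group N] [LieGroup I ∞ N] [T2Space N]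
  {α : GroupLieAlgebra I N →ₗ[ℝ] GroupLieAlgebra I N} (A : IntegratedAction α)

instance : IsTopologicalGroup (SemidirectLine A) :=
  topologicalGroup_of_lieGroup (I.prod 𝓘(ℝ, ℝ)) ∞

instance : LocallyCompactSpace (SemidirectLine A) :=
  Manifold.locallyCompact_of_finiteDimensional (I.prod 𝓘(ℝ, ℝ))

instance : T2Space (GroupLieAlgebra I N) := inferInstanceAs (T2Space E)

instance : ContinuousSMul ℝ (GroupLieAlgebra I N) := inferInstanceAs (ContinuousSMul ℝ E)

lemma actVec_zero (X : GroupLieAlgebra I N) : actVec A 0 X = X := by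
  obtain ⟨γ, hγ⟩ := exists_isOneParameter X
  have h1 := isOneParameter_act A hγ 0
  simp only [act_zero] at h1
  exact h1.unique hγ

variable {d : ℕ} (e : Module.Basis (Fin d) ℝ (GroupLieAlgebra I N))

lemma hasDerivAt_repr_actVec (X : GroupLieAlgebra I N) (i : Fin d) :
    HasDerivAt (fun s => e.repr (actVec A s X) i) (e.repr (α X) i) 0 :=
  hasDerivAt_repr_of_hasSum e α (fun t => hasSum_actVec A t X) i

variable [SecondCountableTopology N] {lam : Fin d → ℝ}
  (heig : ((α.charpoly.map (algebraMap ℝ ℂ)).roots.map Complex.re) = Finset.univ.val.map lam)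

include e heig in
/-- The modular function along the second factor. -/
lemma modularCharacterFun_line (s : ℝ) :
    (Measure.modularCharacterFun (line A s) : ℝ) = Real.exp ((∑ i, lam i) * s) := by
  rw [modularCharacterFun_isOneParameter (basis A e) (isOneParameter_line A) s]
  congr 2
  -- In the adapted basis, `ad` of the line direction is `α` on the first block and zero on the line
  -- itself, so its trace is that of `α`.
  rw [← trace_eq_sum (e := e) heig, Fintype.sum_sum_type]
  have h1 : (basis A e).repr ⁅lineVec A, basis A e (Sum.inr ())⁆ (Sum.inr ()) = 0 := by
    rw [basis_inr, lie_self]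
    simp
  rw [Fintype.sum_unique (ι := Unit), h1, add_zero]
  refine Finset.sum_congr rfl fun i _ => ?_
  have h2 := hasDerivAt_repr_adInv_neg (basis A e) (isOneParameter_line A) (inclVec A (e i)) 0
    (Sum.inl i)
  simp only [adInv_line_neg, basis_repr_inclVec_inl] at h2
  rw [actVec_zero] at h2
  rw [basis_inl]
  exact h2.unique (hasDerivAt_repr_actVec A e (e i) i)

end SemidirectLine

/-! ### Contractions near a fixed point and their basin of attraction. -/

section Contraction

variable {E H : Type*} [NormedAddCommGroup E] [NormedSpace ℝ E]
  [TopologicalSpace H] {I : ModelWithCorners ℝ E H} [I.Boundaryless]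
  {M : Type*} [TopologicalSpace M] [ChartedSpace H M]

/-- A map whose differential at a fixed point is a contraction contracts a neighbourhood of the
fixed point. -/
lemma exists_isOpen_iterate_image_subset {f : M → M} {x₀ : M} (hf : f x₀ = x₀)
    {L : E →L[ℝ] E} (hL : ‖L‖ ≤ 1 / 2) (hd : HasMFDerivAt I I f x₀ L) :
    ∃ B : Set M, IsOpen B ∧ x₀ ∈ B ∧ Set.MapsTo f B B ∧
      ∀ V ∈ 𝓝 x₀, ∀ᶠ k : ℕ in atTop, Set.MapsTo f^[k] B V := by
  set ch := extChartAt I x₀ with hch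
  set F : E → E := fun y => ch (f (ch.symm y)) with hF
  have h1 : HasFDerivAt F L (ch x₀) := by
    have h2 : HasFDerivWithinAt (E := E) (F := E) (writtenInExtChartAt I I x₀ f) L (Set.range I)
      (extChartAt I x₀ x₀) := hd.2
    rw [I.range_eq_univ, hasFDerivWithinAt_univ] at h2
    have e : writtenInExtChartAt I I x₀ f = F := by
      funext y
      simp only [writtenInExtChartAt, hF, hf, Function.comp_apply, hch]
    rwa [e] at h2
  have hF0 : F (ch x₀) = ch x₀ := by
    simp only [hF, hch, extChartAt_to_inv, hf]
  -- The linear part contributes `1/2` and the remainder is at most `1/4` close to the fixed point.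
  have h3 : ∀ᶠ y in 𝓝 (ch x₀), ‖F y - ch x₀‖ ≤ 3 / 4 * ‖y - ch x₀‖ := by
    filter_upwards [(h1.isLittleO).def (show (0 : ℝ) < 1 / 4 by norm_num)] with y hy
    rw [hF0] at hy
    have h4 : ‖L (y - ch x₀)‖ ≤ 1 / 2 * ‖y - ch x₀‖ := L.le_of_opNorm_le hL _
    have h5 : F y - ch x₀ = (F y - ch x₀ - L (y - ch x₀)) + L (y - ch x₀) := by abel
    rw [h5]
    refine (norm_add_le _ _).trans ?_
    linarith
  have hsymm : ContinuousAt ch.symm (ch x₀) := continuousAt_extChartAt_symm x₀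
  have hx₀ : ch.symm (ch x₀) = x₀ := extChartAt_to_inv x₀
  have h6 : ∀ᶠ y in 𝓝 (ch x₀), f (ch.symm y) ∈ ch.source := by
    have h7 : ContinuousAt f (ch.symm (ch x₀)) := hx₀.symm ▸ hd.1
    have h8 := (ContinuousAt.comp h7 hsymm).preimage_mem_nhds (t := ch.source)
    refine h8 ?_
    rw [Function.comp, hx₀, hf]
    exact extChartAt_source_mem_nhds x₀
  obtain ⟨r, hr, hball⟩ := Metric.eventually_nhds_iff_ball.1 (h3.and h6)
  set B : Set M := ch.source ∩ ch ⁻¹' Metric.ball (ch x₀) r with hB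
  have hstep : ∀ x ∈ B, f x ∈ ch.source ∧ ‖ch (f x) - ch x₀‖ ≤ 3 / 4 * ‖ch x - ch x₀‖ := by
    intro x hx
    have h9 := hball _ hx.2
    rw [hF] at h9
    simp only [ch.left_inv hx.1] at h9
    exact ⟨h9.2, h9.1⟩
  have hmaps : Set.MapsTo f B B := fun x hx => by
    obtain ⟨h10, h11⟩ := hstep x hx
    refine ⟨h10, ?_⟩
    have h12 : ‖ch x - ch x₀‖ < r := mem_ball_iff_norm.1 hx.2
    exact mem_ball_iff_norm.2 (by nlinarith [norm_nonneg (ch x - ch x₀)])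
  have hpow : ∀ k : ℕ, ∀ x ∈ B, ‖ch (f^[k] x) - ch x₀‖ ≤ (3 / 4) ^ k * r := by
    intro k x hx
    induction k with
    | zero => simpa using (mem_ball_iff_norm.1 hx.2).le
    | succ k ih =>
      rw [Function.iterate_succ_apply', pow_succ']
      have := (hstep _ (hmaps.iterate k hx)).2
      linarith
  refine ⟨B, (continuousOn_extChartAt x₀).isOpen_inter_preimage (isOpen_extChartAt_source x₀)
    Metric.isOpen_ball, ⟨mem_extChartAt_source x₀, Metric.mem_ball_self hr⟩, hmaps,
    fun V hV => ?_⟩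
  have h13 : ch.symm ⁻¹' V ∈ 𝓝 (ch x₀) := hsymm.preimage_mem_nhds (by rwa [hx₀])
  obtain ⟨ε, hε, hεV⟩ := Metric.mem_nhds_iff.1 h13
  have h14 : Tendsto (fun k : ℕ => (3 / 4 : ℝ) ^ k * r) atTop (𝓝 0) := by
    simpa using (tendsto_pow_atTop_nhds_zero_of_lt_one (by norm_num) (by norm_num :
      (3 / 4 : ℝ) < 1)).mul_const r
  filter_upwards [h14.eventually_lt_const hε] with k hk x hx
  have h15 : ch (f^[k] x) ∈ Metric.ball (ch x₀) ε :=
    mem_ball_iff_norm.2 ((hpow k x hx).trans_lt hk)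
  have h16 := hεV h15
  rwa [Set.mem_preimage, ch.left_inv (hmaps.iterate k hx).1] at h16

end Contraction

section Basin

variable {N : Type*} [TopologicalSpace N] [Group N] [IsTopologicalGroup N] [ConnectedSpace N]
  {f : N →* N} (hf : Continuous f) {B : Set N} (hB : IsOpen B) (h1 : 1 ∈ B)
  (hmaps : Set.MapsTo f B B) (hV : ∀ V ∈ 𝓝 (1 : N), ∀ᶠ k : ℕ in atTop, Set.MapsTo f^[k] B V)

include hB h1 hV

/-- The points attracted to 1 form a subgroup. It contains the neighbourhood `B`, so it is open,
hence closed, hence everything by connectedness. -/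
lemma tendsto_iterate_one (x : N) : Tendsto (fun k : ℕ => f^[k] x) atTop (𝓝 1) := by
  let U : Subgroup N :=
    { carrier := {x | Tendsto (fun k : ℕ => f^[k] x) atTop (𝓝 1)}
      one_mem' := by
        simp only [Set.mem_ofPred_eq, iterate_map_one]
        exact tendsto_const_nhds
      mul_mem' := fun {x y} hx hy => by
        simp only [Set.mem_ofPred_eq, iterate_map_mul] at hx hy ⊢
        simpa using hx.mul hy
      inv_mem' := fun {x} hx => by
        simp only [Set.mem_ofPred_eq, iterate_map_inv] at hx ⊢
        simpa using hx.inv }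
  have hBU : B ⊆ U := fun x hx => tendsto_def.2 fun V hV' =>
    (hV V hV').mono fun k hk => hk hx
  have hU : IsOpen (U : Set N) :=
    Subgroup.isOpen_of_mem_nhds U (g := 1) (mem_of_superset (hB.mem_nhds h1) hBU)
  have htop : (U : Set N) = Set.univ :=
    IsClopen.eq_univ ⟨U.isClosed_of_isOpen hU, hU⟩ ⟨1, U.one_mem⟩
  exact (htop ▸ Set.mem_univ x : x ∈ (U : Set N))

include hf hmaps

/-- The preimages of `B` under the iterates increase and cover `N`, so a compact `K` is carried into
`B` by some fixed iterate. Further iterates of `B` shrink to 1 and miss `y`, hence `g k` cannot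
remain in `K`. -/
lemma tendsto_cocompact_of_iterate_eq [T1Space N] {y : N} (hy : y ≠ 1) {g : ℕ → N}
    (hg : ∀ k, f^[k] (g k) = y) : Tendsto g atTop (cocompact N) := by
  rw [tendsto_def]
  intro s hs
  obtain ⟨K, hK, hKs⟩ := mem_cocompact.1 hs
  have hmono : Monotone fun m : ℕ => (f^[m]) ⁻¹' B :=
    monotone_nat_of_le_succ fun m x hx => by
      rw [Set.mem_preimage, Function.iterate_succ_apply']
      exact hmaps hx
  obtain ⟨m, hm⟩ := hK.elim_directed_cover (fun m : ℕ => (f^[m]) ⁻¹' B)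
    (fun m => hB.preimage (hf.iterate m))
    (fun x _ => by
      obtain ⟨m, hm⟩ := ((tendsto_iterate_one hB h1 hV x).eventually (hB.mem_nhds h1)).exists
      exact Set.mem_iUnion.2 ⟨m, hm⟩)
    hmono.directed_le
  have h2 : {y}ᶜ ∈ 𝓝 (1 : N) := isOpen_compl_singleton.mem_nhds fun h => hy h.symm
  obtain ⟨k₀, hk₀⟩ := eventually_atTop.1 (hV _ h2)
  filter_upwards [eventually_ge_atTop (m + k₀)] with k hk
  refine hKs fun hgK => ?_
  have h3 : f^[k - m] (f^[m] (g k)) = y := by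
    rw [← Function.iterate_add_apply, Nat.sub_add_cancel (by lia), hg]
  exact hk₀ (k - m) (by lia) (hm hgK) h3

end Basin

namespace LpCohomology

variable {E H : Type*} [NormedAddCommGroup E] [NormedSpace ℝ E] [FiniteDimensional ℝ E]
  [TopologicalSpace H] {I : ModelWithCorners ℝ E H} [I.Boundaryless]
  {G : Type*} [TopologicalSpace G] [ChartedSpace H G] [Group G] [LieGroup I ∞ G] [T2Space G]

lemma hasVelocityAt_const (g : G) (t : ℝ) :
    HasVelocityAt (fun _ : ℝ => g) (0 : GroupLieAlgebra I G) t := by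
  have h1 : HasMFDerivAt 𝓘(ℝ, ℝ) I (fun _ : ℝ => g) t (0 : ℝ →L[ℝ] E) :=
    hasMFDerivAt_const g t
  refine h1.congr_mfderiv ?_
  ext
  have h2 : (mulInvariantVectorField (0 : GroupLieAlgebra I G) g : E) = 0 :=
    map_zero (mfderiv I I (fun x : G => g * x) 1)
  have h5 : ((1 : ℝ →L[ℝ] ℝ).smulRight (mulInvariantVectorField (0 : GroupLieAlgebra I G) g)) 1 =
    mulInvariantVectorField (I := I) (0 : GroupLieAlgebra I G) g := one_smul ℝ _
  exact (h5.trans h2).symm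

lemma IsOneParameter.ne_one {γ : ℝ → G} {X : GroupLieAlgebra I G} (hγ : IsOneParameter γ X)
    (hX : X ≠ 0) : ∃ t, γ t ≠ 1 := by
  by_contra! h
  have e : γ = fun _ => 1 := funext h
  have h1 := hγ.velocity 0
  rw [e] at h1
  exact hX (h1.unique rfl (hasVelocityAt_const 1 0))

end LpCohomology

/-! ### Contraction of `N` in negative time, and a central direction. -/

namespace SemidirectLine

open LpCohomology

variable {E H : Type*} [NormedAddCommGroup E] [NormedSpace ℝ E] [FiniteDimensional ℝ E]
  [TopologicalSpace H] {I : ModelWithCorners ℝ E H} [I.Boundaryless]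
  {N : Type*} [TopologicalSpace N] [ChartedSpace H N] [Group N] [LieGroup I ∞ N] [T2Space N]
  {α : GroupLieAlgebra I N →ₗ[ℝ] GroupLieAlgebra I N} (A : IntegratedAction α)

/-- The action as a homomorphism. -/
def actHom (t : ℝ) : N →* N where
  toFun := act A t
  map_one' := act_one A t
  map_mul' := act_mul A t

lemma actHom_apply (t : ℝ) (x : N) : actHom A t x = act A t x := rfl

lemma iterate_actHom (t : ℝ) (k : ℕ) (x : N) : (actHom A t)^[k] x = act A (k * t) x := by
  induction k with
  | zero => simp [act_zero]
  | succ k ih =>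
    rw [Function.iterate_succ_apply', ih, actHom_apply, ← act_add]
    congr 1
    push_cast
    ring

variable {d : ℕ} (e : Module.Basis (Fin d) ℝ (GroupLieAlgebra I N)) {lam : Fin d → ℝ}
  (heig : ((α.charpoly.map (algebraMap ℝ ℂ)).roots.map Complex.re) = Finset.univ.val.map lam)
  [NeZero d] (hmono : Monotone lam) (hpos : 0 < lam 0)

include e heig hmono

lemma exists_abs_repr_actVec_le {r : ℝ} (hr : r < lam 0) :
    ∃ C : ℝ, ∀ (n : ℕ) (X : GroupLieAlgebra I N) (i : Fin d),
      |e.repr (actVec A (-n) X) i| ≤ C * Real.exp (-r * n) * ∑ j, |e.repr X j| := by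
  obtain ⟨C, hC⟩ := exists_abs_repr_le_of_lt (e := e) heig hmono hr
  exact ⟨C, fun n X i => hC n X _ (hasSum_actVec A (-n) X) i⟩

include hpos

/-- The differential of the action at time `-n` decays like `exp (-(lam 0 / 2) * n)`, the rate `lam
0 / 2` being one admissible value below `lam 0`. -/
lemma exists_norm_mfderiv_act_le :
    ∃ (n : ℕ) (L : E →L[ℝ] E), ‖L‖ ≤ 1 / 2 ∧ HasMFDerivAt I I (act A (-n)) 1 L := by
  obtain ⟨C, hC⟩ := exists_abs_repr_actVec_le A e heig hmono (half_lt_self hpos)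
  let e' : Module.Basis (Fin d) ℝ E := e
  obtain ⟨D, hD, hD'⟩ := e'.exists_opNorm_le (F := E)
  let L : ℕ → E →L[ℝ] E := fun n => mfderiv I I (act A (-n)) 1
  have h1 : ∀ n : ℕ, ‖L n‖ ≤ D * ∑ i, |C| * Real.exp (-(lam 0 / 2) * n) * ‖e' i‖ := fun n => by
    refine hD' (Finset.sum_nonneg fun _ _ => by positivity) fun j => ?_
    set Y : E := L n (e' j) with hY
    rw [← e'.sum_repr Y]
    refine (norm_sum_le _ _).trans (Finset.sum_le_sum fun i _ => ?_)
    rw [norm_smul]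
    gcongr
    refine (hC n (e j) i).trans ?_
    have h2 : ∑ j', |e.repr (e j) j'| = 1 := by
      rw [Finset.sum_eq_single j]
      · simp
      · intro i _ hi
        simp [hi.symm]
      · simp
    rw [h2, mul_one]
    gcongr
    exact le_abs_self C
  have h3 : Tendsto (fun n : ℕ => D * ∑ i, |C| * Real.exp (-(lam 0 / 2) * n) * ‖e' i‖) atTop
      (𝓝 (D * ∑ i, |C| * 0 * ‖e' i‖)) := by
    refine (tendsto_finsetSum _ fun i _ => Tendsto.mul_const _ (Tendsto.const_mul _ ?_)).const_mul D
    exact Real.tendsto_exp_atBot.comp (tendsto_natCast_atTop_atTop.const_mul_atTop_of_neg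
      (by linarith))
  simp only [mul_zero, zero_mul, Finset.sum_const_zero] at h3
  obtain ⟨n, hn⟩ := (h3.eventually_lt_const (show (0 : ℝ) < 1 / 2 by norm_num)).exists
  exact ⟨n, L n, (h1 n).trans hn.le,
    ((contMDiff_act A (-n)).mdifferentiableAt (by simp)).hasMFDerivAt⟩

variable [ConnectedSpace N]

/-- The action in negative time contracts the group to the identity. -/
lemma exists_tendsto_act : ∃ T : ℕ, (∀ x : N, Tendsto (fun k : ℕ => act A (-(k * T)) x) atTop (𝓝 1)) ∧
    ∀ y : N, y ≠ 1 → Tendsto (fun k : ℕ => act A (k * T) y) atTop (cocompact N) := by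
  have : IsTopologicalGroup N := topologicalGroup_of_lieGroup I ∞
  obtain ⟨T, L, hT, hL⟩ := exists_norm_mfderiv_act_le A e heig hmono hpos
  obtain ⟨B, hB, h1, hmaps, hV⟩ := exists_isOpen_iterate_image_subset (I := I) (f := act A (-T))
    (act_one A _) hT hL
  refine ⟨T, fun x => ?_, fun y hy => ?_⟩
  · have h2 := tendsto_iterate_one (f := actHom A (-T)) hB h1 hV x
    simp only [iterate_actHom, mul_neg] at h2
    exact h2
  · refine tendsto_cocompact_of_iterate_eq (f := actHom A (-T)) (contMDiff_act A (-T)).continuous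
      hB h1 hmaps hV hy fun k => ?_
    rw [iterate_actHom, ← act_add]
    have : (k * -T + k * T : ℝ) = 0 := by ring
    rw [this, act_zero]

include A in
/-- There is a nonzero central direction. -/
lemma exists_ne_zero_adInv_eq [Group.IsNilpotent N] :
    ∃ X : GroupLieAlgebra I N, X ≠ 0 ∧ ∀ x : N, adInv I x X = X := by
  obtain ⟨T, hT, -⟩ := exists_tendsto_act A e heig hmono hpos
  have hnt : Nontrivial N := by
    obtain ⟨γ, hγ⟩ := exists_isOneParameter (e 0)
    obtain ⟨t, ht⟩ := hγ.ne_one (e.ne_zero 0)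
    exact ⟨⟨_, _, ht⟩⟩
  obtain ⟨⟨z, hz⟩, hz1⟩ := Subgroup.ne_bot_iff_exists_ne_one.1
    (Group.IsNilpotent.center_ne_bot (G := N))
  have hz1' : z ≠ 1 := fun h => hz1 (Subtype.ext h)
  have hcomm : ∀ t x, x * act A t z = act A t z * x := fun t x => by
    have h1 := congrArg (act A t) (Subgroup.mem_center_iff.1 hz (act A (-t) x))
    rwa [act_mul, act_mul, ← act_add, add_neg_cancel, act_zero] at h1
  -- The curve stays in the centre because the action preserves the centre; its velocity at time 0
  -- is the required vector.
  set c : ℝ → N := fun t => act A t z * z⁻¹ with hc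
  have hc0 : c 0 = 1 := by simp only [hc, act_zero, mul_inv_cancel]
  have hcs : ContMDiff 𝓘(ℝ, ℝ) I ∞ c := (contMDiff_act_flip A z).mul contMDiff_const
  obtain ⟨X, hX⟩ := exists_hasVelocityAt hcs hc0
  refine ⟨X, ?_, fun x => ?_⟩
  · rintro rfl
    refine hz1' ?_
    -- If the velocity vanished at time 0, the group law of the action would make it vanish at all
    -- times, so `z` would be fixed, contrary to contraction to 1.
    have h2 : ∀ t, HasVelocityAt (fun s => act A s z) (0 : GroupLieAlgebra I N) t := fun t => by
      have h3 := ((HasVelocityAt.comp_sub hX t).map (contMDiff_act A t) (act_mul A t)).mul_left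
        (act A t z)
      rw [map_zero] at h3
      have e3 : (fun s => act A t z * act A t (act A (s - t) z * z⁻¹)) = fun s => act A s z := by
        funext s
        rw [act_mul, ← act_add, add_sub_cancel, act_inv, ← mul_assoc, hcomm, mul_inv_cancel_right]
      rwa [e3] at h3
    have h4 := eq_of_hasVelocityAt h2 (hasVelocityAt_const z) (act_zero A z)
    refine tendsto_nhds_unique (tendsto_const_nhds (x := z) (f := (atTop : Filter ℕ))) ?_
    refine (hT z).congr fun k => congrFun h4 _
  · have h5 := hX.map (contMDiff_conjInv (I := I) x) (conj_mul x)
    have e5 : (fun s => x⁻¹ * (act A s z * z⁻¹) * x) = fun s => act A s z * z⁻¹ := by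
      funext s
      have h6 : z⁻¹ * x = x * z⁻¹ := by
        rw [inv_mul_eq_iff_eq_mul, ← mul_assoc, ← Subgroup.mem_center_iff.1 hz x,
          mul_inv_cancel_right]
      rw [mul_assoc, mul_assoc, h6, ← mul_assoc (act A s z), ← hcomm, mul_assoc,
        inv_mul_cancel_left]
    rw [e5] at h5
    exact h5.unique hc0 hX

end SemidirectLine

/-! ### Vanishing of the defect up to the critical exponent. -/

namespace LpCohomology

variable {E H : Type*} [NormedAddCommGroup E] [NormedSpace ℝ E] [FiniteDimensional ℝ E]
  [TopologicalSpace H] {I : ModelWithCorners ℝ E H} [I.Boundaryless]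
  {G : Type*} [TopologicalSpace G] [ChartedSpace H G] [Group G] [LieGroup I ∞ G] [T2Space G]
  [IsTopologicalGroup G] [LocallyCompactSpace G] [SecondCountableTopology G]
  [MeasurableSpace G] [BorelSpace G]
  {ι : Type*} [Fintype ι] (b : Module.Basis ι ℝ (GroupLieAlgebra I G))
  {μ : Measure G} [μ.IsHaarMeasure] {p : ℝ≥0∞} (hp : 1 ≤ p) (hp' : p ≠ ⊤)

include b hp hp' in
/-- The defect vanishes in a direction commuting with a family of good directions that moves to
infinity with bounded modular function. -/
lemma defect_eq_zero_of_adInv_eq {u : G → ℝ} (hu : MemLp u p μ) {θ : OneForm I G}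
    (hθ : MemLp (θ.coeff b) p μ) (hθc : IsWeaklyClosed μ θ) {X : GroupLieAlgebra I G}
    {γ : ℕ → ℝ → G} {Z : ℕ → GroupLieAlgebra I G} (hγ : ∀ k, IsOneParameter (γ k) (Z k))
    (hZ : ∀ k ψ, IsTestFunction I ψ → defect μ u θ (Z k) ψ = 0)
    (hX : ∀ k t, adInv I (γ k t) X = X) {s : ℝ}
    (hs : Tendsto (fun k => γ k s) atTop (cocompact G))
    {m : NNReal} (hm : ∀ k, Measure.modularCharacterFun (γ k s)⁻¹ = m)
    {ψ : G → ℝ} (hψ : IsTestFunction I ψ) : defect μ u θ X ψ = 0 := by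
  refine defect_eq_zero_of_tendsto b hp hp' hψ hu hθ (Xk := fun _ => X) hs
    (D := (m : ℝ) ^ (1 / p.toReal)) (D' := (∑ i, |b.repr X i|) * (m : ℝ) ^ (1 / p.toReal))
    (fun k => by rw [hm]) (fun i k => ?_) fun k => ?_
  · rw [hm]
    gcongr
    exact Finset.single_le_sum (f := fun i => |b.repr X i|) (fun _ _ => abs_nonneg _)
      (Finset.mem_univ i)
  · have h1 := defect_eq_flow b (hγ k) (MemLp.locallyIntegrable_inv μ hp hu) hθc (hZ k) X hψ s
    simpa only [hX] using h1

end LpCohomology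

namespace SemidirectLine

open LpCohomology

variable {E H : Type*} [NormedAddCommGroup E] [NormedSpace ℝ E] [FiniteDimensional ℝ E]
  [TopologicalSpace H] {I : ModelWithCorners ℝ E H} [I.Boundaryless]
  {N : Type*} [TopologicalSpace N] [ChartedSpace H N] [Group N] [LieGroup I ∞ N] [T2Space N]
  [SecondCountableTopology N]
  {α : GroupLieAlgebra I N →ₗ[ℝ] GroupLieAlgebra I N} (A : IntegratedAction α)

lemma tendsto_incl_cocompact :
    Tendsto (incl A) (cocompact N) (cocompact (SemidirectLine A)) := by
  have h : Topology.IsClosedEmbedding (fun x : N => (x, (0 : ℝ))) :=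
    Function.LeftInverse.isClosedEmbedding (f := Prod.fst) (fun _ => rfl) continuous_fst
      (by fun_prop)
  exact h.tendsto_cocompact

/-- The points `incl A (act A s x)` are conjugate in `G`, and the modular function is a homomorphism
to a commutative group. They may thus escape to infinity at no cost in norm. -/
lemma modularCharacterFun_incl_act (s : ℝ) (x : N) :
    Measure.modularCharacterFun (incl A (act A s x))⁻¹ =
      Measure.modularCharacterFun (incl A x)⁻¹ := by
  rw [← line_conj, mul_inv_rev, mul_inv_rev, inv_inv]
  simp only [Measure.modularCharacterFun_map_mul]
  have h : Measure.modularCharacterFun (line A (-s))⁻¹ * 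
      Measure.modularCharacterFun (line A (-s)) = 1 := by
    rw [← Measure.modularCharacterFun_map_mul, inv_mul_cancel, Measure.modularCharacterFun_map_one]
  rw [mul_left_comm, h, mul_one]

lemma act_comm_of_central {t : ℝ} {z : N} (hz : ∀ x : N, x⁻¹ * z * x = z) (x : N) :
    x⁻¹ * act A t z * x = act A t z := by
  have h1 := congrArg (act A t) (hz (act A (-t) x))
  rwa [act_mul, act_mul, act_inv, ← act_add, add_neg_cancel, act_zero] at h1

lemma adInv_actVec_eq {X : GroupLieAlgebra I N} (hX : ∀ x : N, adInv I x X = X) (t : ℝ) (x : N) :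
    adInv I x (actVec A t X) = actVec A t X := by
  obtain ⟨γ, hγ⟩ := exists_isOneParameter X
  exact adInv_eq_self (isOneParameter_act A hγ t) fun s =>
    act_comm_of_central A (fun x => hγ.conj_eq (hX x) s) x

variable {d : ℕ} (e : Module.Basis (Fin d) ℝ (GroupLieAlgebra I N)) {lam : Fin d → ℝ}
  (heig : ((α.charpoly.map (algebraMap ℝ ℂ)).roots.map Complex.re) = Finset.univ.val.map lam)
  [NeZero d] (hmono : Monotone lam) (hpos : 0 < lam 0)

omit [SecondCountableTopology N] in
include hmono hpos in
lemma sum_pos_of_monotone : 0 < ∑ i, lam i :=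
  Finset.sum_pos (fun i _ => hpos.trans_le (hmono (Fin.zero_le i))) ⟨0, Finset.mem_univ 0⟩

variable {μ : Measure (SemidirectLine A)} [μ.IsHaarMeasure] {p : ℝ≥0∞} (hp : 1 ≤ p) (hp' : p ≠ ⊤)
  {u : SemidirectLine A → ℝ} (hu : MemLp u p μ)
  {θ : OneForm (I.prod 𝓘(ℝ, ℝ)) (SemidirectLine A)}
  (hθ : MemLp (θ.coeff (basis A e)) p μ) (hθc : IsWeaklyClosed μ θ)

include e heig hmono hpos hp hp' hu hθ hθc

/-- Along `line A k` the adjoint coefficients grow at most like `exp (lam 0 * k)` and the modular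
factor is `exp (-(∑ i, lam i) / p * k)`; `hpp` says that their product stays bounded. -/
lemma defect_inclVec_eq_zero_of_growth
    (hξ : ∀ ψ, IsTestFunction (I.prod 𝓘(ℝ, ℝ)) ψ → defect μ u θ (lineVec A) ψ = 0)
    (hpp : p.toReal * lam 0 ≤ ∑ i, lam i) {Y : GroupLieAlgebra I N} {C : ℝ}
    (hY : ∀ t i, |e.repr (actVec A t Y) i| ≤ C * Real.exp (lam 0 * t))
    {ψ : SemidirectLine A → ℝ} (hψ : IsTestFunction (I.prod 𝓘(ℝ, ℝ)) ψ) :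
    defect μ u θ (inclVec A Y) ψ = 0 := by
  have hh := sum_pos_of_monotone hmono hpos
  have hmod := modularCharacterFun_line A e heig
  have ha := isOneParameter_line A
  have hC : 0 ≤ C := by
    have := (abs_nonneg _).trans (hY 0 0)
    simpa using this
  have hp0 : 0 < p.toReal := ENNReal.toReal_pos (zero_lt_one.trans_le hp).ne' hp'
  have hrate : lam 0 ≤ (∑ i, lam i) / p.toReal := by
    rw [le_div_iff₀ hp0]
    linarith
  refine defect_eq_zero_of_tendsto (basis A e) hp hp' hψ hu hθ
    (gk := fun k : ℕ => line A k) (Xk := fun k => inclVec A (actVec A k Y))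
    (tendsto_flow_cocompact hh hmod) (D := 1) (D' := C) (fun k => ?_) (fun i k => ?_) fun k => ?_
  · rw [modularCharacterFun_flow_inv_rpow ha hmod, Real.exp_le_one_iff]
    have := rate_pos hh hp hp'
    nlinarith [(Nat.cast_nonneg k : (0 : ℝ) ≤ k)]
  · rw [modularCharacterFun_flow_inv_rpow ha hmod]
    rcases i with i | ⟨⟩
    · rw [basis_repr_inclVec_inl]
      calc _ ≤ C * Real.exp (lam 0 * k) * Real.exp (-((∑ i, lam i) / p.toReal) * k) := by
            gcongr
            exact hY k i
        _ = C * Real.exp ((lam 0 - (∑ i, lam i) / p.toReal) * k) := by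
            rw [mul_assoc, ← Real.exp_add]
            ring_nf
        _ ≤ C * 1 := by
            gcongr
            rw [Real.exp_le_one_iff]
            exact mul_nonpos_of_nonpos_of_nonneg (by linarith) (Nat.cast_nonneg k)
        _ = C := mul_one C
    · rw [basis_repr_inclVec_inr, abs_zero, zero_mul]
      exact hC
  · have h1 := defect_eq_flow (basis A e) ha (MemLp.locallyIntegrable_inv μ hp hu) hθc hξ
      (inclVec A Y) hψ k
    simpa only [adInv_line_neg] using h1

variable [ConnectedSpace N] 

/-- For a point `γ s ≠ 1`, the images `act A (k * T) (γ s)` escape to infinity with constant modular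
function. Each lies on a subgroup along which the defect is invariant, and these subgroups leave `X`
unchanged, so no growth condition on `X` is needed. -/
lemma defect_inclVec_eq_zero_of_commute {X Y : GroupLieAlgebra I N} (hY0 : Y ≠ 0)
    (hY : ∀ t ψ, IsTestFunction (I.prod 𝓘(ℝ, ℝ)) ψ → defect μ u θ (inclVec A (actVec A t Y)) ψ = 0)
    (hX : ∀ γ : ℝ → N, IsOneParameter γ Y → ∀ s t, adInv I (act A s (γ t)) X = X)
    {ψ : SemidirectLine A → ℝ} (hψ : IsTestFunction (I.prod 𝓘(ℝ, ℝ)) ψ) :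
    defect μ u θ (inclVec A X) ψ = 0 := by
  obtain ⟨T, -, hT⟩ := exists_tendsto_act A e heig hmono hpos
  obtain ⟨γ, hγ⟩ := exists_isOneParameter Y
  obtain ⟨s, hs⟩ := hγ.ne_one hY0
  refine defect_eq_zero_of_adInv_eq (basis A e) hp hp' hu hθ hθc 
    (γ := fun k t => incl A (act A (k * T) (γ t))) (Z := fun k => inclVec A (actVec A (k * T) Y))
    (fun k => isOneParameter_incl A (isOneParameter_act A hγ _)) (fun k => hY _) (fun k t => ?_)
    ((tendsto_incl_cocompact A).comp (hT _ hs)) (fun k => modularCharacterFun_incl_act A _ _) hψ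
  rw [adInv_incl, hX γ hγ]

variable [Group.IsNilpotent N]

/-- Vanishing spreads from the slowest direction `Y` to a central direction `Z`, which commutes with
`Y`, and then from `Z` to every direction of `N`, since all of them commute with `Z`. -/
lemma defect_eq_zero
    (hξ : ∀ ψ, IsTestFunction (I.prod 𝓘(ℝ, ℝ)) ψ → defect μ u θ (lineVec A) ψ = 0)
    (hpp : p.toReal * lam 0 ≤ ∑ i, lam i)
    (X : GroupLieAlgebra (I.prod 𝓘(ℝ, ℝ)) (SemidirectLine A))
    {ψ : SemidirectLine A → ℝ} (hψ : IsTestFunction (I.prod 𝓘(ℝ, ℝ)) ψ) :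
    defect μ u θ X ψ = 0 := by
  obtain ⟨Y, C, hY0, hY⟩ := exists_ne_zero_abs_repr_le (e := e) heig 0
  obtain ⟨Z, hZ0, hZ⟩ := exists_ne_zero_adInv_eq A e heig hmono hpos
  have h1 : ∀ t ψ, IsTestFunction (I.prod 𝓘(ℝ, ℝ)) ψ →
      defect μ u θ (inclVec A (actVec A t Y)) ψ = 0 := fun t ψ hψ => by
    -- The vector `actVec A t Y` obeys the growth bound of `Y` with its constant multiplied by `exp
    -- (lam 0 * t)`.
    refine defect_inclVec_eq_zero_of_growth A e heig hmono hpos hp hp' hu hθ hθc hξ hpp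
      (C := C * Real.exp (lam 0 * t)) (fun s i => ?_) hψ
    have h2 := hY (s + t) _ (hasSum_actVec A (s + t) Y) i
    rw [actVec_add, mul_add, add_comm, Real.exp_add, ← mul_assoc] at h2
    exact h2
  have h2 : ∀ t ψ, IsTestFunction (I.prod 𝓘(ℝ, ℝ)) ψ →
      defect μ u θ (inclVec A (actVec A t Z)) ψ = 0 := fun t ψ hψ =>
    defect_inclVec_eq_zero_of_commute A e heig hmono hpos hp hp' hu hθ hθc hY0 h1
      (fun γ hγ s r => adInv_actVec_eq A hZ t _) hψ
  have h3 : ∀ X' ψ, IsTestFunction (I.prod 𝓘(ℝ, ℝ)) ψ → defect μ u θ (inclVec A X') ψ = 0 :=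
    fun X' ψ hψ => defect_inclVec_eq_zero_of_commute A e heig hmono hpos hp hp' hu hθ hθc hZ0 h2
      (fun γ hγ s r => by
        obtain ⟨γ', hγ'⟩ := exists_isOneParameter X'
        refine adInv_eq_self hγ' fun t => ?_
        have h4 := act_comm_of_central A (t := s) (fun x => hγ.conj_eq (hZ x) r) (γ' t)
        rw [mul_assoc, inv_mul_eq_iff_eq_mul] at h4
        rw [mul_assoc, inv_mul_eq_iff_eq_mul, h4]) hψ
  rw [defect_eq_sum (basis A e) (MemLp.locallyIntegrable_inv μ hp hu) hθc.1 X hψ]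
  refine Finset.sum_eq_zero fun i _ => ?_
  rcases i with i | ⟨⟩
  · rw [basis_inl, h3 _ _ hψ, mul_zero]
  · rw [basis_inr, hξ _ hψ, mul_zero]

omit hu hθ hθc in
/-- Below the critical exponent all closed forms are exact. -/
lemma closedForms_le_exactForms (hpp : p.toReal * lam 0 ≤ ∑ i, lam i) {ι : Type*} [Fintype ι]
    (b : Module.Basis ι ℝ (GroupLieAlgebra (I.prod 𝓘(ℝ, ℝ)) (SemidirectLine A))) :
    closedForms b μ p ≤ exactForms b μ p := by
  rintro θ ⟨hθ, hθc⟩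
  have hh := sum_pos_of_monotone hmono hpos
  have hmod := modularCharacterFun_line A e heig
  have ha := isOneParameter_line A
  have hξ := OneForm.memLp_apply hθ (lineVec A)
  obtain ⟨u, hu, hu'⟩ := exists_flowPrimitive ha hh hmod hp hp' hξ
  refine ⟨hθ, u, hu, isWeakDifferential_of_defect_eq_zero hp hu hθ fun X ψ hψ => ?_⟩
  refine defect_eq_zero A e heig hmono hpos hp hp' hu
    -- Integrability does not depend on the frame, so the argument may switch from `b` to the
    -- adapted basis.
    (OneForm.memLp_coeff fun i => OneForm.memLp_apply hθ _) hθc (fun ψ hψ => ?_) hpp X hψ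
  rw [defect, hu' _ (hψ.invDeriv _), flowPairing_invDeriv ha hh hmod hp hp' hξ hψ, neg_add_cancel]

end SemidirectLine

/-! ### Differentials of smooth functions and integrability by translates. -/

namespace LpCohomology

section Differential

variable {E H : Type*} [NormedAddCommGroup E] [NormedSpace ℝ E] [FiniteDimensional ℝ E]
  [TopologicalSpace H] {I : ModelWithCorners ℝ E H} [I.Boundaryless]
  {G : Type*} [TopologicalSpace G] [ChartedSpace H G] [Group G] [LieGroup I ∞ G] [T2Space G]
  [IsTopologicalGroup G] [LocallyCompactSpace G] [SecondCountableTopology G]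
  [MeasurableSpace G] [BorelSpace G] {μ : Measure G} [μ.IsHaarMeasure]

variable (I) in
/-- The differential of a function, as a `1`-form. -/
def differential (v : G → ℝ) : OneForm I G := fun g => mfderiv I 𝓘(ℝ, ℝ) v g

lemma differential_apply (v : G → ℝ) (X : GroupLieAlgebra I G) :
    (differential I v).apply X = invDeriv X v := rfl

/-- Integration by parts reduces closedness to the commutator formula `invDeriv_bracket`. -/
lemma isWeaklyClosed_differential {v : G → ℝ} (hv : ContMDiff I 𝓘(ℝ, ℝ) ∞ v) :
    IsWeaklyClosed μ (differential I v) := by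
  have hli : ∀ F : G → ℝ, ContMDiff I 𝓘(ℝ, ℝ) ∞ F → LocallyIntegrable F μ.inv :=
    fun F hF => hF.continuous.locallyIntegrable
  refine ⟨fun X => hli _ (contMDiff_invDeriv hv X), fun X Y ψ hψ => ?_⟩
  simp only [differential_apply]
  have j : ∀ F : G → ℝ, ContMDiff I 𝓘(ℝ, ℝ) ∞ F → Integrable (fun g => F g * ψ g) μ.inv :=
    fun F hF => integrable_mul_test (hli F hF) hψ.1.continuous hψ.2
  rw [integral_mul_invDeriv (contMDiff_invDeriv hv Y) hψ,
    integral_mul_invDeriv (contMDiff_invDeriv hv X) hψ]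
  have h1 : ∀ g, invDeriv ⁅X, Y⁆ v g * ψ g =
      invDeriv X (invDeriv Y v) g * ψ g - invDeriv Y (invDeriv X v) g * ψ g := fun g => by
    rw [invDeriv_bracket hv, sub_mul]
  simp only [h1]
  rw [integral_sub (j _ (contMDiff_invDeriv (contMDiff_invDeriv hv Y) X))
    (j _ (contMDiff_invDeriv (contMDiff_invDeriv hv X) Y))]
  ring

lemma support_invDeriv_subset (X : GroupLieAlgebra I G) (v : G → ℝ) {g : G}
    (hg : invDeriv X v g ≠ 0) : g ∈ tsupport v := by
  by_contra h
  apply hg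
  have h0 : v =ᶠ[𝓝 g] fun _ => 0 := notMem_tsupport_iff_eventuallyEq.mp h
  simp only [invDeriv]
  rw [h0.mfderiv_eq, mfderiv_const]
  rfl

omit [I.Boundaryless] in
/-- Integrability of a function that decays along translates of a compact set. -/
lemma memLp_of_translates {p : ℝ≥0∞} (hp : 1 ≤ p) (hp' : p ≠ ⊤) {f : G → ℝ} (hf : Continuous f)
    {K₀ K₁ : Set G} (hK₀ : IsCompact K₀) (hK₁ : IsCompact K₁) {gk : ℕ → G} {h r M : ℝ}
    (hmod : ∀ k, (Measure.modularCharacterFun (gk k) : ℝ) = Real.exp (h * k))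
    (hr : h < r * p.toReal) (hM : 0 ≤ M)
    (hdecay : ∀ k g, g * gk k ∈ K₀ → |f g| ≤ M * Real.exp (-r * k))
    (hsupp : ∀ g, f g ≠ 0 → g ∈ K₁ ∨ ∃ k, g * gk k ∈ K₀) : MemLp f p μ := by
  have hp0 : p ≠ 0 := (zero_lt_one.trans_le hp).ne'
  have hq0 : 0 < p.toReal := ENNReal.toReal_pos hp0 hp'
  refine ⟨hf.aestronglyMeasurable, ?_⟩
  rw [eLpNorm_lt_top_iff_lintegral_rpow_enorm_lt_top hp0 hp']
  set S : ℕ → Set G := fun k => (· * gk k) ⁻¹' K₀ with hS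
  have hSm : ∀ k, MeasurableSet (S k) := fun k =>
    measurable_mul_const (gk k) hK₀.isClosed.measurableSet
  have h1 : ∫⁻ g, ‖f g‖ₑ ^ p.toReal ∂μ = ∫⁻ g in K₁ ∪ ⋃ k, S k, ‖f g‖ₑ ^ p.toReal ∂μ := by
    refine (setLIntegral_eq_of_support_subset ?_).symm
    intro g hg
    have hfg : f g ≠ 0 := by
      rintro h0
      simp [h0, hq0] at hg
    rcases hsupp g hfg with h2 | ⟨k, hk⟩
    · exact Or.inl h2
    · exact Or.inr (Set.mem_iUnion.2 ⟨k, hk⟩)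
  have h2 : ∫⁻ g in K₁, ‖f g‖ₑ ^ p.toReal ∂μ < ⊤ := by
    obtain ⟨C, hC⟩ := hK₁.exists_bound_of_continuousOn hf.continuousOn
    refine (setLIntegral_mono' hK₁.isClosed.measurableSet (g := fun _ => ENNReal.ofReal C ^ p.toReal)
      fun g hg => ?_).trans_lt ?_
    · gcongr
      rw [← ofReal_norm]
      exact ENNReal.ofReal_le_ofReal (hC g hg)
    · rw [setLIntegral_const]
      exact ENNReal.mul_lt_top (ENNReal.rpow_lt_top_of_nonneg hq0.le ENNReal.ofReal_ne_top)
        hK₁.measure_lt_top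
  have hμS : ∀ k, μ (S k) = ENNReal.ofReal (Real.exp (h * k)) * μ K₀ := fun k => by
    have h3 := congrArg (fun ν : Measure G => ν K₀) (map_mul_right_eq_smul μ (gk k))
    simp only [Measure.smul_apply] at h3
    rw [Measure.map_apply (measurable_mul_const _) hK₀.isClosed.measurableSet] at h3
    rw [hS, h3, ← hmod, ENNReal.ofReal_coe_nnreal]
    rfl
  -- Volume growth `exp (h k)` against decay `exp (-r p k)` gives a geometric series of ratio `exp
  -- (h - r p)`, which is less than 1 by `hr`.
  have h4 : ∀ k, ∫⁻ g in S k, ‖f g‖ₑ ^ p.toReal ∂μ ≤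
      ENNReal.ofReal M ^ p.toReal * μ K₀ * ENNReal.ofReal (Real.exp (h - r * p.toReal)) ^ k := by
    intro k
    refine (setLIntegral_mono' (hSm k)
      (g := fun _ => ENNReal.ofReal (M * Real.exp (-r * k)) ^ p.toReal) fun g hg => ?_).trans ?_
    · gcongr
      rw [← ofReal_norm]
      exact ENNReal.ofReal_le_ofReal (hdecay k g hg)
    · rw [setLIntegral_const, hμS, ENNReal.ofReal_mul hM, ENNReal.mul_rpow_of_nonneg _ _ hq0.le,
        ENNReal.ofReal_rpow_of_pos (Real.exp_pos _), ← Real.exp_mul,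
        ← ENNReal.ofReal_pow (Real.exp_pos _).le, ← Real.exp_nat_mul]
      have h5 : ENNReal.ofReal (Real.exp (k * (h - r * p.toReal))) =
          ENNReal.ofReal (Real.exp (-r * k * p.toReal)) * ENNReal.ofReal (Real.exp (h * k)) := by
        rw [← ENNReal.ofReal_mul (Real.exp_pos _).le, ← Real.exp_add]
        ring_nf
      rw [h5]
      apply le_of_eq
      ring
  rw [h1]
  refine (lintegral_union_le _ _ _).trans_lt (ENNReal.add_lt_top.2 ⟨h2, ?_⟩)
  refine ((lintegral_iUnion_le _ _).trans (ENNReal.tsum_le_tsum h4)).trans_lt ?_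
  rw [ENNReal.tsum_mul_left, ENNReal.tsum_geometric]
  refine ENNReal.mul_lt_top (ENNReal.mul_lt_top
    (ENNReal.rpow_lt_top_of_nonneg hq0.le ENNReal.ofReal_ne_top) hK₀.measure_lt_top) ?_
  rw [ENNReal.inv_lt_top, tsub_pos_iff_lt, ENNReal.ofReal_lt_one, Real.exp_lt_one_iff]
  linarith

/-- A smooth function that disappears along the flow is a flow primitive of its derivative. -/
lemma integral_mul_eq_flowPairing_invDeriv {a : ℝ → G} {ξ : GroupLieAlgebra I G}
    (ha : IsOneParameter a ξ) {h : ℝ} (hh : 0 < h)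
    (hmod : ∀ s, (Measure.modularCharacterFun (a s) : ℝ) = Real.exp (h * s)) {p : ℝ≥0∞}
    (hp : 1 ≤ p) (hp' : p ≠ ⊤) {u : G → ℝ} (hu : ContMDiff I 𝓘(ℝ, ℝ) ∞ u)
    (hF : MemLp (invDeriv ξ u) p μ) {η : G → ℝ} (hη : IsTestFunction I η)
    (h0 : ∀ᶠ s in atTop, ∀ g, u g * η (g * a s) = 0) :
    ∫ g, u g * η g ∂μ.inv = flowPairing a μ (invDeriv ξ u) η := by
  have hli : LocallyIntegrable u μ.inv := hu.continuous.locallyIntegrable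
  -- No integrability of `u` is assumed: the boundary term at infinity vanishes because `h0` makes
  -- the product zero for large `s`.
  have hd : ∀ s, HasDerivAt (fun s => -∫ g, u g * η (g * a s) ∂μ.inv)
      (∫ g, invDeriv ξ u g * η (g * a s) ∂μ.inv) s := fun s => by
    have h1 := (hasDerivAt_integral_comp_right hli hη ha s).neg
    have h2 := integral_mul_invDeriv (ν := μ.inv) hu (hη.comp_mul_right (a s)) ξ
    simp only [invDeriv_flow ha hmod hp hp' hη] at h2
    rwa [h2, neg_neg] at h1
  have hlim : Tendsto (fun s => -∫ g, u g * η (g * a s) ∂μ.inv) atTop (𝓝 0) := by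
    refine tendsto_const_nhds.congr' ?_
    filter_upwards [h0] with s hs
    simp [hs]
  rw [flowPairing, integral_Ioi_of_hasDerivAt_of_tendsto (a := 0)
    (hd 0).continuousAt.continuousWithinAt (fun s _ => hd s)
    (integrableOn_flow ha hh hmod hp hp' hF hη) hlim, ha.zero]
  simp

end Differential

end LpCohomology

/-! ### A nontrivial class above the critical exponent. -/

namespace SemidirectLine

open LpCohomology

variable {E H : Type*} [NormedAddCommGroup E] [NormedSpace ℝ E] [FiniteDimensional ℝ E]
  [TopologicalSpace H] {I : ModelWithCorners ℝ E H} [I.Boundaryless]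
  {N : Type*} [TopologicalSpace N] [ChartedSpace H N] [Group N] [LieGroup I ∞ N] [T2Space N]
  {α : GroupLieAlgebra I N →ₗ[ℝ] GroupLieAlgebra I N} (A : IntegratedAction α)

/-- The function on the semidirect product that depends on the first factor only. -/
def pull (w : N → ℝ) (g : SemidirectLine A) : ℝ := w g.1

/-- A smooth cutoff in the second factor. -/
def cutoff (g : SemidirectLine A) : ℝ := Real.smoothTransition (3 - g.2)

lemma contMDiff_pull {w : N → ℝ} (hw : ContMDiff I 𝓘(ℝ, ℝ) ∞ w) :
    ContMDiff (I.prod 𝓘(ℝ, ℝ)) 𝓘(ℝ, ℝ) ∞ (pull A w) :=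
  hw.comp contMDiff_fst

lemma contMDiff_cutoff : ContMDiff (I.prod 𝓘(ℝ, ℝ)) 𝓘(ℝ, ℝ) ∞ (cutoff A) := by
  have h1 : ContDiff ℝ ∞ fun t : ℝ => Real.smoothTransition (3 - t) :=
    Real.smoothTransition.contDiff.comp (contDiff_const.sub contDiff_id)
  exact h1.contMDiff.comp (contMDiff_snd (M := N) (I := I))

lemma continuous_fst' : Continuous fun g : SemidirectLine A => g.1 := continuous_fst (X := N)

lemma continuous_snd' : Continuous fun g : SemidirectLine A => g.2 := continuous_snd (X := N)

lemma cutoff_eq_one {g : SemidirectLine A} (hg : g.2 ≤ 2) : cutoff A g = 1 :=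
  Real.smoothTransition.one_of_one_le (by linarith)

lemma cutoff_eq_zero {g : SemidirectLine A} (hg : 3 ≤ g.2) : cutoff A g = 0 :=
  Real.smoothTransition.zero_of_nonpos (by linarith)

lemma mul_line_fst (g : SemidirectLine A) (s : ℝ) : (g * line A s).1 = g.1 := by
  rw [mul_def]
  simp [line]

lemma mul_line_snd (g : SemidirectLine A) (s : ℝ) : (g * line A s).2 = g.2 + s := by
  rw [mul_def]
  simp [line]

lemma pull_mul_line (w : N → ℝ) (g : SemidirectLine A) (s : ℝ) :
    pull A w (g * line A s) = pull A w g := by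
  simp only [pull, mul_line_fst]

lemma invDeriv_lineVec_pull {w : N → ℝ} (hw : ContMDiff I 𝓘(ℝ, ℝ) ∞ w) (g : SemidirectLine A) :
    invDeriv (lineVec A) (pull A w) g = 0 := by
  have h1 := (((isOneParameter_line A).velocity 0).mul_left g).hasDerivAt (contMDiff_pull A hw)
  simp only [pull_mul_line] at h1
  have h2 := h1.unique (hasDerivAt_const (0 : ℝ) _)
  rwa [(isOneParameter_line A).zero, mul_one] at h2

lemma invDeriv_inclVec_pull_one {w : N → ℝ} (hw : ContMDiff I 𝓘(ℝ, ℝ) ∞ w)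
    (X : GroupLieAlgebra I N) : invDeriv (inclVec A X) (pull A w) 1 = invDeriv X w 1 :=
  (invDeriv_comp_hom (contMDiff_incl A) (incl_mul A) (contMDiff_pull A hw) X 1).symm

/-- The function whose differential represents a nontrivial class. -/
def cutoffPull (w : N → ℝ) (g : SemidirectLine A) : ℝ := cutoff A g * pull A w g

variable {w : N → ℝ}

lemma contMDiff_cutoffPull (hw : ContMDiff I 𝓘(ℝ, ℝ) ∞ w) :
    ContMDiff (I.prod 𝓘(ℝ, ℝ)) 𝓘(ℝ, ℝ) ∞ (cutoffPull A w) :=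
  (contMDiff_cutoff A).mul (contMDiff_pull A hw)

lemma tsupport_cutoffPull_subset :
    tsupport (cutoffPull A w) ⊆ {g | g.1 ∈ tsupport w ∧ g.2 ≤ 3} := by
  have hc : IsClosed {g : SemidirectLine A | g.1 ∈ tsupport w ∧ g.2 ≤ 3} :=
    ((isClosed_tsupport w).preimage (continuous_fst' A)).inter
      (isClosed_le (continuous_snd' A) continuous_const)
  refine closure_minimal (fun g hg => ⟨subset_tsupport w fun h => hg ?_, ?_⟩) hc
  · have : pull A w g = 0 := h
    rw [cutoffPull, this, mul_zero]
  · by_contra! h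
    exact hg (by rw [cutoffPull, cutoff_eq_zero A h.le, zero_mul])

variable {d : ℕ} (e : Module.Basis (Fin d) ℝ (GroupLieAlgebra I N)) 

/-- The derivative of the cut-off function far down the second factor. -/
lemma invDeriv_cutoffPull (hw : ContMDiff I 𝓘(ℝ, ℝ) ∞ w)
    (X : GroupLieAlgebra (I.prod 𝓘(ℝ, ℝ)) (SemidirectLine A)) (k : ℕ) {g : SemidirectLine A}
    (hg : (g * line A k).2 ≤ 1) :
    invDeriv X (cutoffPull A w) g =
      invDeriv (adInv (I.prod 𝓘(ℝ, ℝ)) (line A k) X) (pull A w) (g * line A k) := by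
  have hv := contMDiff_cutoffPull A hw
  have h1 := invDeriv_comp_mul_right hv (adInv (I.prod 𝓘(ℝ, ℝ)) (line A k) X) (line A (-k))
    (g * line A k)
  rw [← adInv_mul, mul_assoc, ← line_add, add_neg_cancel] at h1
  have h0 : line A 0 = 1 := rfl
  rw [h0, adInv_one, mul_one] at h1
  rw [← h1, invDeriv, invDeriv]
  -- The cutoff equals 1 up to height 2 while the point has height at most 1. This room gives
  -- equality of germs, hence of derivatives.
  have h2 : (fun x => cutoffPull A w (x * line A (-k))) =ᶠ[𝓝 (g * line A k)] pull A w := by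
    have h3 : {x : SemidirectLine A | x.2 < 2} ∈ 𝓝 (g * line A k) :=
      (isOpen_lt (continuous_snd' A) continuous_const).mem_nhds (lt_of_le_of_lt hg (by norm_num))
    filter_upwards [h3] with x hx
    rw [cutoffPull, pull_mul_line, cutoff_eq_one, one_mul]
    rw [mul_line_snd]
    have : (0 : ℝ) ≤ k := Nat.cast_nonneg k
    have hx' : x.2 < 2 := hx
    linarith
  rw [h2.mfderiv_eq]
  rfl

variable [SecondCountableTopology N] {lam : Fin d → ℝ}
  (heig : ((α.charpoly.map (algebraMap ℝ ℂ)).roots.map Complex.re) = Finset.univ.val.map lam)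
  [NeZero d] (hmono : Monotone lam) (hpos : 0 < lam 0)
  {μ : Measure (SemidirectLine A)} [μ.IsHaarMeasure] {p : ℝ≥0∞} (hp : 1 ≤ p) (hp' : p ≠ ⊤)
  (hw : IsTestFunction I w)

include heig hmono hw

/-- The derivatives of the cut-off function decay exponentially down the second factor. -/
lemma exists_abs_invDeriv_cutoffPull_le {r : ℝ} (hr : r < lam 0) (j : Fin d ⊕ Unit) :
    ∃ M : ℝ, 0 ≤ M ∧ ∀ (k : ℕ) (g : SemidirectLine A),
      (g * line A k).1 ∈ tsupport w → (g * line A k).2 ∈ Set.Icc (0 : ℝ) 1 →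
      |invDeriv (basis A e j) (cutoffPull A w) g| ≤ M * Real.exp (-r * k) := by
  obtain ⟨C, hC⟩ := exists_abs_repr_actVec_le A e heig hmono hr
  have hK : IsCompact ((tsupport w) ×ˢ (Set.Icc (0 : ℝ) 1)) := hw.2.isCompact.prod isCompact_Icc
  have hc : Continuous fun g : SemidirectLine A => ∑ i, |invDeriv (inclVec A (e i)) (pull A w) g| :=
    continuous_finsetSum _ fun i _ =>
      (contMDiff_invDeriv (contMDiff_pull A hw.1) _).continuous.abs
  obtain ⟨D, hD⟩ := hK.exists_bound_of_continuousOn (α := N × ℝ) (Continuous.continuousOn hc)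
  rcases j with j | ⟨⟩
  · refine ⟨|C| * (∑ i, |e.repr (e j) i|) * |D|, by positivity, fun k g hg1 hg2 => ?_⟩
    -- Going down by `k` applies the action at time `-k` to the direction, and that contracts at any
    -- rate `r < lam 0`.
    have h1 : adInv (I.prod 𝓘(ℝ, ℝ)) (line A k) (inclVec A (e j)) =
        inclVec A (actVec A (-k) (e j)) := by
      rw [← adInv_line_neg, neg_neg]
    have h2 : abs (∑ i, |invDeriv (inclVec A (e i)) (pull A w) (g * line A k)|) ≤ D :=
      hD (g * line A k) ⟨hg1, hg2⟩
    have h3 : ∀ i, |invDeriv (inclVec A (e i)) (pull A w) (g * line A k)| ≤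
        ∑ i, |invDeriv (inclVec A (e i)) (pull A w) (g * line A k)| := fun i =>
      Finset.single_le_sum (f := fun i => |invDeriv (inclVec A (e i)) (pull A w) (g * line A k)|)
        (fun _ _ => abs_nonneg _) (Finset.mem_univ i)
    rw [invDeriv_cutoffPull A hw.1 _ k hg2.2, basis_inl, h1, invDeriv_eq_sum (basis A e),
      Fintype.sum_sum_type]
    simp only [Finset.univ_unique, Finset.sum_singleton, basis_repr_inclVec_inl,
      basis_repr_inclVec_inr, zero_mul, add_zero, basis_inl, PUnit.default_eq_unit]
    calc |∑ i, e.repr (actVec A (-k) (e j)) i *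
          invDeriv (inclVec A (e i)) (pull A w) (g * line A k)|
        ≤ ∑ i, (|C| * Real.exp (-r * k) * ∑ j', |e.repr (e j) j'|) *
          |invDeriv (inclVec A (e i)) (pull A w) (g * line A k)| := by
          refine (Finset.abs_sum_le_sum_abs _ _).trans (Finset.sum_le_sum fun i _ => ?_)
          rw [abs_mul]
          gcongr
          refine (hC k (e j) i).trans ?_
          gcongr
          exact le_abs_self C
      _ ≤ (|C| * Real.exp (-r * k) * ∑ j', |e.repr (e j) j'|) * |D| := by
          rw [← Finset.mul_sum]
          gcongr
          exact (le_abs_self _).trans (h2.trans (le_abs_self D))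
      _ = _ := by ring
  · refine ⟨0, le_rfl, fun k g hg1 hg2 => ?_⟩
    rw [invDeriv_cutoffPull A hw.1 _ k hg2.2, basis_inr, (isOneParameter_line A).adInv_self,
      invDeriv_lineVec_pull A hw.1]
    simp

include e hpos hp hp'

/-- The hypothesis leaves room for a rate `r` strictly between `(∑ i, lam i) / p` and `lam 0`: decay
at rate `r` is available from the contraction and beats the volume growth. -/
lemma memLp_invDeriv_cutoffPull (hpp : ∑ i, lam i < p.toReal * lam 0)
    (X : GroupLieAlgebra (I.prod 𝓘(ℝ, ℝ)) (SemidirectLine A)) :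
    MemLp (invDeriv X (cutoffPull A w)) p μ := by
  have hv := contMDiff_cutoffPull A hw.1
  have hp0 : 0 < p.toReal := ENNReal.toReal_pos (zero_lt_one.trans_le hp).ne' hp'
  obtain ⟨r, hr1, hr2⟩ : ∃ r, (∑ i, lam i) / p.toReal < r ∧ r < lam 0 :=
    exists_between (by rw [div_lt_iff₀ hp0]; linarith)
  have hb : ∀ j, MemLp (invDeriv (basis A e j) (cutoffPull A w)) p μ := fun j => by
    obtain ⟨M, hM, hM'⟩ := exists_abs_invDeriv_cutoffPull_le A e heig hmono hw hr2 j
    have hK₀ : IsCompact (X := SemidirectLine A) ((tsupport w) ×ˢ (Set.Icc (0 : ℝ) 1)) :=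
      IsCompact.prod (X := N) (Y := ℝ) hw.2.isCompact isCompact_Icc
    have hK₁ : IsCompact (X := SemidirectLine A) ((tsupport w) ×ˢ (Set.Icc (0 : ℝ) 3)) :=
      IsCompact.prod (X := N) (Y := ℝ) hw.2.isCompact isCompact_Icc
    refine memLp_of_translates hp hp' (contMDiff_invDeriv hv _).continuous hK₀ hK₁
      (gk := fun k : ℕ => line A k) (fun k => modularCharacterFun_line A e heig k)
      ((div_lt_iff₀ hp0).1 hr1) hM (fun k g hg => hM' k g hg.1 hg.2) fun g hg => ?_
    obtain ⟨h1, h2⟩ := tsupport_cutoffPull_subset A (support_invDeriv_subset _ _ hg)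
    rcases le_or_gt 0 g.2 with h3 | h3
    · exact Or.inl ⟨h1, h3, h2⟩
    -- Raising a point of negative height by this integer brings its height into `[0, 1]`.
    · refine Or.inr ⟨⌈-g.2⌉₊, ?_, ?_, ?_⟩
      · rw [mul_line_fst]
        exact h1
      · rw [mul_line_snd]
        linarith [Nat.le_ceil (-g.2)]
      · rw [mul_line_snd]
        linarith [Nat.ceil_lt_add_one (show 0 ≤ -g.2 by linarith)]
  have h2 : invDeriv X (cutoffPull A w) = fun g =>
      ∑ i, (basis A e).repr X i * invDeriv (basis A e i) (cutoffPull A w) g :=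
    funext fun g => invDeriv_eq_sum (basis A e) X _ g
  rw [h2]
  exact memLp_finsetSum _ fun i _ => (hb i).const_mul _

lemma differential_cutoffPull_mem_closedForms (hpp : ∑ i, lam i < p.toReal * lam 0)
    {ι : Type*} [Fintype ι]
    (b : Module.Basis ι ℝ (GroupLieAlgebra (I.prod 𝓘(ℝ, ℝ)) (SemidirectLine A))) :
    differential (I.prod 𝓘(ℝ, ℝ)) (cutoffPull A w) ∈ closedForms b μ p :=
  ⟨OneForm.memLp_coeff fun i =>
    memLp_invDeriv_cutoffPull A e heig hmono hpos hp hp' hw hpp (b i),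
    isWeaklyClosed_differential (contMDiff_cutoffPull A hw.1)⟩

/-- Subtracting `pull A w` from `cutoffPull A w` does not change the derivative along the line and
makes the function vanish far down, so the difference is the flow primitive. Its defect in the
direction `X` is the pairing of `ψ` with the derivative of `pull A w`, which is nonzero for a
suitable `ψ`. -/
lemma differential_cutoffPull_notMem_exactForms (hpp : ∑ i, lam i < p.toReal * lam 0)
    {ι : Type*} [Fintype ι]
    (b : Module.Basis ι ℝ (GroupLieAlgebra (I.prod 𝓘(ℝ, ℝ)) (SemidirectLine A)))
    {X : GroupLieAlgebra I N} (hX : invDeriv X w 1 ≠ 0) :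
    differential (I.prod 𝓘(ℝ, ℝ)) (cutoffPull A w) ∉ exactForms b μ p := by
  have hh := sum_pos_of_monotone hmono hpos
  have hmod := modularCharacterFun_line A e heig
  have ha := isOneParameter_line A
  have hv := contMDiff_cutoffPull A hw.1
  have hw' := contMDiff_pull A hw.1
  set u : SemidirectLine A → ℝ := fun g => cutoffPull A w g - pull A w g with hu
  have hus : ContMDiff (I.prod 𝓘(ℝ, ℝ)) 𝓘(ℝ, ℝ) ∞ u := hv.sub hw'
  have hξ : invDeriv (lineVec A) u = invDeriv (lineVec A) (cutoffPull A w) := by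
    funext g
    have h1 := ((ha.velocity 0).mul_left g).hasDerivAt hus
    have h2 := ((ha.velocity 0).mul_left g).hasDerivAt hv
    simp only [hu, pull_mul_line] at h1
    have h3 := h1.unique (h2.sub_const _)
    rwa [ha.zero, mul_one] at h3
  have hF := memLp_invDeriv_cutoffPull (μ := μ) A e heig hmono hpos hp hp' hw hpp (lineVec A)
  have hflow : ∀ η : SemidirectLine A → ℝ, IsTestFunction (I.prod 𝓘(ℝ, ℝ)) η →
      ∫ g, u g * η g ∂μ.inv =
        flowPairing (line A) μ (invDeriv (lineVec A) (cutoffPull A w)) η := fun η hη => by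
    rw [← hξ]
    refine integral_mul_eq_flowPairing_invDeriv ha hh hmod hp hp' hus (by rwa [hξ]) hη ?_
    -- The function `u` lives at heights above 2, and for `s ≥ T` the translate of `η` lives at
    -- heights at most 0.
    obtain ⟨T, hT⟩ := (hη.2.isCompact.image (continuous_snd' A)).bddAbove
    filter_upwards [eventually_ge_atTop T] with s hs g
    by_cases hg : g.2 ≤ 2
    · simp only [hu, cutoffPull, cutoff_eq_one A hg, one_mul, sub_self, zero_mul]
    · have h4 : η (g * line A s) = 0 := by
        by_contra h5
        have h6 : (g * line A s).2 ≤ T := hT ⟨_, subset_tsupport η h5, rfl⟩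
        rw [mul_line_snd] at h6
        linarith
      rw [h4, mul_zero]
  obtain ⟨ψ, hψ, h7⟩ : ∃ ψ : SemidirectLine A → ℝ, IsTestFunction (I.prod 𝓘(ℝ, ℝ)) ψ ∧
      ∫ g, invDeriv (inclVec A X) (pull A w) g * ψ g ∂μ.inv ≠ 0 := by
    by_contra! h8
    obtain ⟨ρ, hρ, -, hρ1⟩ := exists_testFunction_apply_one (I := I.prod 𝓘(ℝ, ℝ))
      (G := SemidirectLine A)
    have hQ := hρ.mul_left (contMDiff_invDeriv hw' (inclVec A X))
    have h9 := eq_zero_of_integral_mul_eq_zero (ν := μ.inv) hQ fun η hη => by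
      rw [← h8 _ (hρ.mul_left hη.1)]
      exact integral_congr_ae (Eventually.of_forall fun g => by simp only; ring)
    have h10 := congrFun h9 1
    simp only [hρ1, mul_one, Pi.zero_apply, invDeriv_inclVec_pull_one A hw.1] at h10
    exact hX h10
  refine notMem_exactForms ha hh hmod hp hp' hflow (X := inclVec A X) hψ ?_
  have hli : ∀ F : SemidirectLine A → ℝ, ContMDiff (I.prod 𝓘(ℝ, ℝ)) 𝓘(ℝ, ℝ) ∞ F →
      LocallyIntegrable F μ.inv := fun F hF => hF.continuous.locallyIntegrable
  have hψX := hψ.invDeriv (inclVec A X)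
  have h11 := integral_mul_invDeriv (ν := μ.inv) hv hψ (inclVec A X)
  have h12 := integral_mul_invDeriv (ν := μ.inv) hw' hψ (inclVec A X)
  have h13 : ∫ g, u g * invDeriv (inclVec A X) ψ g ∂μ.inv =
      ∫ g, cutoffPull A w g * invDeriv (inclVec A X) ψ g ∂μ.inv -
        ∫ g, pull A w g * invDeriv (inclVec A X) ψ g ∂μ.inv := by
    simp only [hu, sub_mul]
    exact integral_sub (integrable_mul_test (hli _ hv) hψX.1.continuous hψX.2)
      (integrable_mul_test (hli _ hw') hψX.1.continuous hψX.2)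
  rw [defect, h13, h11, h12, differential_apply]
  intro h14
  exact h7 (by linarith)

omit hw in
/-- Above the critical exponent there is a closed form which is not exact. -/
lemma exists_mem_closedForms_notMem_exactForms (hpp : ∑ i, lam i < p.toReal * lam 0)
    {ι : Type*} [Fintype ι]
    (b : Module.Basis ι ℝ (GroupLieAlgebra (I.prod 𝓘(ℝ, ℝ)) (SemidirectLine A))) :
    ∃ θ ∈ closedForms b μ p, θ ∉ exactForms b μ p := by
  let e' : Module.Basis (Fin d) ℝ E := e
  obtain ⟨w, hw, hw'⟩ := exists_testFunction_invDeriv_one (I := I) (G := N)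
    (LinearMap.toContinuousLinearMap (e'.coord 0))
  refine ⟨_, differential_cutoffPull_mem_closedForms A e heig hmono hpos hp hp' hw hpp b,
    differential_cutoffPull_notMem_exactForms A e heig hmono hpos hp hp' hw hpp b (X := e 0) ?_⟩
  rw [hw']
  have h1 : e'.coord 0 (e' 0) = 1 := by simp
  intro h2
  exact one_ne_zero (h1.symm.trans h2)

end SemidirectLine

end

/-! ### Assembly of the three assertions. -/

theorem mainTheorem2 {d : ℕ} [NeZero d]
    -- a simply connected nilpotent Lie group `N` of dimension `d = n - 1 ≥ 1`
    {N : Type*} [TopologicalSpace N] [ChartedSpace (EuclideanSpace ℝ (Fin d)) N] [Group N]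
    [LieGroup (𝓡 d) ∞ N] [T2Space N] [SecondCountableTopology N]
    [SimplyConnectedSpace N] [Group.IsNilpotent N]
    -- a derivation `α` of its Lie algebra, and the action of `ℝ` on `N` integrating it
    (α : LieDerivation ℝ (GroupLieAlgebra (𝓡 d) N) (GroupLieAlgebra (𝓡 d) N))
    (A : IntegratedAction (α : GroupLieAlgebra (𝓡 d) N →ₗ[ℝ] GroupLieAlgebra (𝓡 d) N))
    -- the real parts of the eigenvalues of `α`, with multiplicity, in increasing order
    (lam : Fin d → ℝ) (hmono : Monotone lam) (hpos : 0 < lam 0)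
    (heig : (((α : GroupLieAlgebra (𝓡 d) N →ₗ[ℝ] GroupLieAlgebra (𝓡 d) N).charpoly.map
      (algebraMap ℝ ℂ)).roots.map Complex.re) = Finset.univ.val.map lam)
    -- an arbitrary left-invariant Riemannian metric on `G = N ⋊_α ℝ`, given by an orthonormal
    -- frame, and an arbitrary normalisation of the left-invariant volume
    {ι : Type*} [Fintype ι]
    (b : Module.Basis ι ℝ (GroupLieAlgebra ((𝓡 d).prod 𝓘(ℝ, ℝ)) (SemidirectLine A)))
    (μ : Measure (SemidirectLine A)) [μ.IsHaarMeasure] :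
    (∀ p : ℝ, 1 ≤ p → LpCohomology.torsion b μ (ENNReal.ofReal p) = ⊥) ∧
    (∀ p : ℝ, 1 ≤ p → p ≤ (∑ i, lam i) / lam 0 →
      Subsingleton (LpCohomology.R1 b μ (ENNReal.ofReal p))) ∧
    (∀ p : ℝ, (∑ i, lam i) / lam 0 < p →
      Nontrivial (LpCohomology.R1 b μ (ENNReal.ofReal p))) := by
  have hconn : ConnectedSpace N := inferInstance
  let e : Module.Basis (Fin d) ℝ (GroupLieAlgebra (𝓡 d) N) :=
    (EuclideanSpace.basisFun (Fin d) ℝ).toBasis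
  have hh := SemidirectLine.sum_pos_of_monotone hmono hpos
  have hmod := SemidirectLine.modularCharacterFun_line A e heig
  have ha := SemidirectLine.isOneParameter_line A
  have hle : ∀ p : ℝ, 1 ≤ p → (1 : ℝ≥0∞) ≤ ENNReal.ofReal p := fun p hp => by
    rwa [← ENNReal.ofReal_one, ENNReal.ofReal_le_ofReal_iff (zero_le_one.trans hp)]
  have hlim : ∀ p : ℝ, 1 ≤ p → LpCohomology.limitForms b μ (ENNReal.ofReal p) ≤
      LpCohomology.exactForms b μ (ENNReal.ofReal p) := fun p hp =>
    LpCohomology.limitForms_le_exactForms ha hh hmod (hle p hp) ENNReal.ofReal_ne_top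
  refine ⟨fun p hp => LpCohomology.torsion_eq_bot (hlim p hp), fun p hp hpp => ?_,
    fun p hpp => ?_⟩
  · refine LpCohomology.subsingleton_R1 (SemidirectLine.closedForms_le_exactForms A e heig hmono
      hpos (hle p hp) ENNReal.ofReal_ne_top ?_ b)
    rw [ENNReal.toReal_ofReal (zero_le_one.trans hp)]
    exact (le_div_iff₀ hpos).1 hpp
  -- The critical exponent is at least 1, since `lam 0` is one of the positive summands in its
  -- numerator.
  · have hp : 1 ≤ p := by
      refine le_trans ?_ hpp.le
      rw [le_div_iff₀ hpos, one_mul]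
      exact Finset.single_le_sum (fun i _ => (hpos.trans_le (hmono (Fin.zero_le i))).le)
        (Finset.mem_univ 0)
    obtain ⟨θ, h1, h2⟩ := SemidirectLine.exists_mem_closedForms_notMem_exactForms A e heig hmono
      hpos (μ := μ) (hle p hp) ENNReal.ofReal_ne_top
      (by rw [ENNReal.toReal_ofReal (zero_le_one.trans hp)]; exact (div_lt_iff₀ hpos).1 hpp) b
    exact LpCohomology.nontrivial_R1 (hlim p hp) h1 h2
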